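/- Let $\sigma=\sigma_{d-1}$ be the surface measure on the unit sphere $\mathbb S^{d-1}\subset\mathbb R^d$; all functions are complex-valued. For $f_1,\dots,f_{m+1}\in L^2(\mathbb S^{d-1})$ let $$\mathrm M(f_1,\dots,f_{m+1})=(f_1\sigma*\cdots*f_{m+1}\sigma)\big|_{\mathbb S^{d-1}}\in L^2(\mathbb S^{d-1})$$ be the restriction to the sphere of the density of the convolution measure $\mu=f_1\sigma*\cdots*f_{m+1}\sigma$ on $\mathbb R^d$, that is, the limit in $L^2(\mathbb S^{d-1},\sigma)$, as $r\to0^+$, of the averages $\omega\mapsto \mu(B(\omega,r))/|B(\omega,r)|$. For $1\le i<j\le d$ let $e^{tX_{i,j}}$ denote the rotation by $t$ radians in the $(x_i,x_j)$-plane. For $s\in(0,1)$ let $\mathcal H^s$ be the space of all $f\in L^2(\mathbb S^{d-1})$ with $$\|f\|_{\mathcal H^s}=\|f\|_{L^2(\mathbb S^{d-1})}+\sum_{1\le i<j\le d}\ \sup_{0<|t|\le1}|t|^{-s}\,\|f\circ e^{tX_{i,j}}-f\|_{L^2(\mathbb S^{d-1})}<\infty ,$$ and for Lipschitz $h:\mathbb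 S^{d-1}\to\mathbb C$ let $$\|h\|_{\mathrm{Lip}}=\sup_{\omega}|h(\omega)|+\sup_{\omega\ne\omega'}\frac{|h(\omega)-h(\omega')|}{|\omega-\omega'|}.$$ **Lemma.** Let $(d,m)\in\{(2,4),(3,3)\}\cup\{(d,2):d\ge3\}$. There exist $\alpha\in(0,1)$ and $C<\infty$, depending only on $(d,m)$, such that for all Lipschitz functions $h_1,\dots,h_m:\mathbb S^{d-1}\to\mathbb C$ and all $g\in L^2(\mathbb S^{d-1})$, the restriction $\mathrm M(h_1,\dots,h_m,g)$ exists, belongs to $\mathcal H^\alpha$, and satisfies $$\|\mathrm M(h_1,\dots,h_m,g)\|_{\mathcal H^\alpha}\le C\,\prod_{j=1}^m\|h_j\|_{\mathrm{Lip}}\;\|g\|_{L^2(\mathbb S^{d-1})}.$$ -/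

import Mathlib

open MeasureTheory Filter Topology
open scoped NNReal ENNReal

noncomputable section

namespace SphereConv

/-- The Euclidean space `ℝ^d`. -/
abbrev Space (d : ℕ) : Type := EuclideanSpace ℝ (Fin d)

/-- The unit sphere `S^{d-1} ⊆ ℝ^d`. Its metric is the chordal one, `|ω - ω'|`. -/
abbrev Sph (d : ℕ) : Type := Metric.sphere (0 : Space d) 1

/-- The (unnormalised) surface measure `σ_{d-1}` on `S^{d-1}`. -/
def surf (d : ℕ) : Measure (Sph d) := (volume : Measure (Space d)).toSphere

/-- The boundary `∂𝔘 = {(2,4),(3,3)} ∪ {(d,2) : d ≥ 3}` of the set of admissible parameters. -/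
def boundaryParams : Set (ℕ × ℕ) :=
  {(2, 4), (3, 3)} ∪ {p | 3 ≤ p.1 ∧ p.2 = 2}

/-- The convolution `f_1 σ ∗ ⋯ ∗ f_n σ`, a complex Borel measure on `ℝ^d`: the push-forward of the
product measure `f_1 σ ⊗ ⋯ ⊗ f_n σ` under `(ν_1, …, ν_n) ↦ ν_1 + ⋯ + ν_n`. -/
def convMeasure {d n : ℕ} (f : Fin n → Sph d → ℂ) : ComplexMeasure (Space d) :=
  ((Measure.pi fun _ : Fin n => surf d).withDensityᵥ fun ν => ∏ j, f j (ν j)).map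
    fun ν => ∑ j, (ν j : Space d)

/-- The mean density of the complex measure `μ` on the ball `B(x, r)`. -/
def ballAverage {d : ℕ} (μ : ComplexMeasure (Space d)) (r : ℝ) (x : Space d) : ℂ :=
  μ (Metric.closedBall x r) / ((volume.real (Metric.closedBall x r) : ℝ) : ℂ)

/-- `u ∈ L²(S^{d-1})` is the restriction to the sphere (the `L²` trace) of the density of `μ`:
the mean densities of `μ` on balls of radius `r` centred on the sphere converge to `u` in
`L²(S^{d-1})` as `r → 0`. Such a `u` is unique up to null sets, and if the density of `μ` is
continuous near the sphere then `u` is its pointwise restriction. -/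
def IsRestriction {d : ℕ} (μ : ComplexMeasure (Space d)) (u : Sph d → ℂ) : Prop :=
  MemLp u 2 (surf d) ∧
    Tendsto (fun r : ℝ => eLpNorm (fun ω : Sph d => ballAverage μ r ω - u ω) 2 (surf d))
      (𝓝[>] 0) (𝓝 0)

open Classical in
/-- The multilinear operator `M(f_1, …, f_n) = (f_1 σ ∗ ⋯ ∗ f_n σ)|_{S^{d-1}}`
(and `0` where the restriction does not exist). -/
def M {d n : ℕ} (f : Fin n → Sph d → ℂ) : Sph d → ℂ :=
  if h : ∃ u, IsRestriction (convMeasure f) u then h.choose else 0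

/-- Rotation of `ℝ^d` by `t` radians in the `(x_i, x_j)`-plane. -/
def rotVec {d : ℕ} (i j : Fin d) (t : ℝ) (x : Space d) : Space d :=
  WithLp.toLp 2 fun k =>
    if k = i then Real.cos t * x i - Real.sin t * x j
    else if k = j then Real.sin t * x i + Real.cos t * x j
    else x k

theorem norm_rotVec {d : ℕ} {i j : Fin d} (hij : i ≠ j) (t : ℝ) (x : Space d) :
    ‖rotVec i j t x‖ = ‖x‖ := by
  have key : ∑ k, (rotVec i j t x k) ^ 2 = ∑ k, (x k) ^ 2 := by
    have hj : j ∈ (Finset.univ.erase i : Finset (Fin d)) := by simp [hij.symm]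
    rw [← Finset.add_sum_erase _ _ (Finset.mem_univ i), ← Finset.add_sum_erase _ _ hj,
      ← Finset.add_sum_erase _ _ (Finset.mem_univ i), ← Finset.add_sum_erase _ _ hj,
      ← add_assoc, ← add_assoc]
    congr 1
    · simp only [rotVec, if_true, hij.symm, if_false]
      linear_combination (x i ^ 2 + x j ^ 2) * Real.sin_sq_add_cos_sq t
    · refine Finset.sum_congr rfl fun k hk => ?_
      simp only [Finset.mem_erase, Finset.mem_univ, and_true] at hk
      simp [rotVec, hk.1, hk.2]
  simp only [EuclideanSpace.norm_eq, Real.norm_eq_abs, sq_abs]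
  rw [key]

/-- The rotation `e^{t X_{i,j}}` of the sphere `S^{d-1}`. -/
def rot {d : ℕ} (i j : Fin d) (hij : i < j) (t : ℝ) (ω : Sph d) : Sph d :=
  ⟨rotVec i j t ω, by
    rw [mem_sphere_zero_iff_norm, norm_rotVec hij.ne, norm_eq_of_mem_sphere]⟩

/-- The norm of `𝓗^s(S^{d-1})`, `0 < s < 1`, as an extended nonnegative number:
`‖f‖_{L²} + ∑_{i<j} sup_{|t| ≤ 1} |t|^{-s} ‖f ∘ e^{t X_{i,j}} - f‖_{L²}`. -/
def eHNorm {d : ℕ} (s : ℝ) (f : Sph d → ℂ) : ℝ≥0∞ :=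
  eLpNorm f 2 (surf d) +
    ∑ p : {p : Fin d × Fin d // p.1 < p.2},
      ⨆ (t : ℝ) (_ : 0 < |t| ∧ |t| ≤ 1),
        ENNReal.ofReal (|t| ^ (-s)) *
          eLpNorm (fun ω => f (rot p.1.1 p.1.2 p.2 t ω) - f ω) 2 (surf d)

/-- Membership in `𝓗^s(S^{d-1})`, `0 < s < 1`. -/
def MemH {d : ℕ} (s : ℝ) (f : Sph d → ℂ) : Prop :=
  MemLp f 2 (surf d) ∧ eHNorm s f < ⊤

/-- The norm of `Lip(S^{d-1})` as an extended nonnegative number: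
`sup_ω |h(ω)| + sup_{ω ≠ ω'} |h(ω) - h(ω')| / |ω - ω'|`. -/
def eLipNorm {d : ℕ} (h : Sph d → ℂ) : ℝ≥0∞ :=
  (⨆ ω, ‖h ω‖ₑ) + ⨆ (ω) (ω') (_ : ω ≠ ω'), ‖h ω - h ω'‖ₑ / edist ω ω'

end SphereConv

end

noncomputable section

namespace SphereConv

/-! Write `f = (h_1, …, h_m, g)` and regularise the convolution by a Gaussian: `heatConv f s` has
Fourier representation `∫ e^{-s|ξ|²} ∏ ĥ_j(ξ) ĝ(ξ) e^{-2πi⟨ξ,x⟩} dξ`. Everything follows from the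
behaviour of these continuous functions on the sphere along `s = 2^{-k}`.

Two estimates carry the proof. The first is Fourier decay: for Lipschitz `h`, `|ĥ(ξ)| ≤ C L
|ξ|^{-β}` whenever `β < 1` and `β ≤ (d-1)/2` (`norm_fhat_le_rpow`). It comes from integrating by
parts along the rotation fields with a weight adapted to the critical points `±e` of the phase. For
each admissible pair some such `β` satisfies `mβ = 3/2`, so `∏ ĥ_j` is `O(|ξ|^{-3/2})`. The second
is a Gaussian Agmon–Hörmander bound: a multiplier dominated by `A e^{-s|ξ|²}` maps `L²` of the
sphere to itself with norm `O(A s^{-1/2})` (`integral_norm_multOp_sq_le`).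

The difference of two consecutive dyadic Gaussians is at most `s^{3/4}|ξ|^{3/2} e^{-s|ξ|²/4}`. The
decay cancels `|ξ|^{3/2}`, leaving `s^{3/4} s^{-1/2} = s^{1/4}`: the sequence is geometrically
Cauchy in `L²`, uniformly over translates of the sphere, since a translation only multiplies the
symbol by a phase. The margin of the decay exponent over `1` is what makes the power of `s`
positive.

The Lipschitz constant of the `k`-th term grows only geometrically in `k`. Choosing `k` according to
the rotation angle balances the two rates and gives Hölder continuity of the limit `u`
(`eLpNorm_comp_sphMap_sub_le`). The same balance gives `L²` equicontinuity under small translations,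
which identifies `u` with the limit of ball averages (`isRestriction_of_geometric`). Restrictions
are unique almost everywhere, so the bound for `u` passes to the representative selected by `M`. -/

instance (d : ℕ) : IsFiniteMeasure (surf d) := by unfold surf; infer_instance

/-! ### Isometries acting on the sphere -/

/-- The rotation `rotVec` as a linear isometry. -/
def rotIsometry {d : ℕ} (i j : Fin d) (hij : i ≠ j) (t : ℝ) : Space d ≃ₗᵢ[ℝ] Space d :=
  LinearIsometry.toLinearIsometryEquiv
    { toFun := rotVec i j t
      map_add' := fun x y => by
        ext k
        simp only [rotVec, PiLp.add_apply]
        split_ifs <;> ring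
      map_smul' := fun a x => by
        ext k
        simp only [rotVec, PiLp.smul_apply, smul_eq_mul, RingHom.id_apply]
        split_ifs <;> ring
      norm_map' := norm_rotVec hij t } rfl

theorem rotIsometry_apply {d : ℕ} (i j : Fin d) (hij : i ≠ j) (t : ℝ) (x : Space d) :
    rotIsometry i j hij t x = rotVec i j t x := rfl

/-- The action of a linear isometry of `ℝ^d` on the sphere. -/
def sphMap {d : ℕ} (e : Space d ≃ₗᵢ[ℝ] Space d) (ω : Sph d) : Sph d :=
  ⟨e ω, by simp⟩

theorem coe_sphMap {d : ℕ} (e : Space d ≃ₗᵢ[ℝ] Space d) (ω : Sph d) :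
    (sphMap e ω : Space d) = e ω := rfl

theorem sphMap_symm_apply {d : ℕ} (e : Space d ≃ₗᵢ[ℝ] Space d) (ω : Sph d) :
    sphMap e.symm (sphMap e ω) = ω :=
  Subtype.ext (e.symm_apply_apply (ω : Space d))

theorem sphMap_apply_symm {d : ℕ} (e : Space d ≃ₗᵢ[ℝ] Space d) (ω : Sph d) :
    sphMap e (sphMap e.symm ω) = ω :=
  Subtype.ext (e.apply_symm_apply (ω : Space d))

theorem continuous_sphMap {d : ℕ} (e : Space d ≃ₗᵢ[ℝ] Space d) : Continuous (sphMap e) :=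
  Continuous.subtype_mk (e.continuous.comp continuous_subtype_val) _

open scoped Pointwise in
-- Surface measure of a set is, up to a factor, the volume of the cone over it, and a linear
-- isometry carries cones to cones preserving volume.
theorem measurePreserving_sphMap {d : ℕ} (e : Space d ≃ₗᵢ[ℝ] Space d) :
    MeasurePreserving (sphMap e) (surf d) (surf d) := by
  refine ⟨(continuous_sphMap e).measurable, ?_⟩
  ext A hA
  rw [Measure.map_apply (continuous_sphMap e).measurable hA, surf,
    Measure.toSphere_apply' _ ((continuous_sphMap e).measurable hA),
    Measure.toSphere_apply' _ hA]
  congr 1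
  have : e ⁻¹' (Set.Ioo (0 : ℝ) 1 • ((↑) '' A)) =
      Set.Ioo (0 : ℝ) 1 • (((↑) : Sph d → Space d) '' (sphMap e ⁻¹' A)) := by
    ext x
    simp only [Set.mem_preimage, Set.mem_smul, Set.mem_image]
    constructor
    · rintro ⟨r, hr, _, ⟨ω, hω, rfl⟩, h⟩
      refine ⟨r, hr, _, ⟨sphMap e.symm ω, ?_, rfl⟩, ?_⟩
      · rwa [sphMap_apply_symm]
      · rw [coe_sphMap, ← map_smul, h, e.symm_apply_apply]
    · rintro ⟨r, hr, _, ⟨ω, hω, rfl⟩, rfl⟩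
      exact ⟨r, hr, _, ⟨_, hω, rfl⟩, (map_smul e r (ω : Space d)).symm⟩
  rw [← this]
  exact e.measurePreserving.measure_preimage_equiv (f := e.toMeasurableEquiv) _

/-! ### Polar coordinates and Gaussian averages over the sphere -/

theorem lintegral_eq_lintegral_surf {d : ℕ} [NeZero d] (f : Space d → ℝ≥0∞) (hf : Measurable f) :
    ∫⁻ x, f x = ∫⁻ ν, ∫⁻ r in Set.Ioi (0 : ℝ),
      ENNReal.ofReal (r ^ (d - 1)) * f (r • (ν : Space d)) ∂volume ∂(surf d) := by
  have hm := (volume : Measure (Space d)).measurePreserving_homeomorphUnitSphereProd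
  have h1 : ∫⁻ x, f x = ∫⁻ x : ({(0 : Space d)}ᶜ : Set (Space d)), f x ∂(volume.comap Subtype.val) := by
    rw [lintegral_subtype_comap (measurableSet_singleton _).compl, restrict_compl_singleton]
  have h2 := hm.lintegral_comp_emb (Homeomorph.measurableEmbedding _)
    (fun p => f (p.2.1 • (p.1 : Space d)))
  have h3 : ∀ x : ({(0 : Space d)}ᶜ : Set (Space d)),
      ((homeomorphUnitSphereProd (Space d) x).2.1 •
        ((homeomorphUnitSphereProd (Space d) x).1 : Space d)) = x := fun x =>
    congrArg Subtype.val ((homeomorphUnitSphereProd (Space d)).symm_apply_apply x)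
  simp only [h3] at h2
  have hmeas : Measurable fun p : Sph d × Set.Ioi (0 : ℝ) => f (p.2.1 • (p.1 : Space d)) := by
    fun_prop
  rw [h1, h2, lintegral_prod _ hmeas.aemeasurable]
  refine lintegral_congr fun ν => ?_
  rw [Measure.volumeIoiPow, lintegral_withDensity_eq_lintegral_mul _ (by fun_prop) (by fun_prop)]
  have := lintegral_subtype_comap (μ := (volume : Measure ℝ)) (measurableSet_Ioi (a := (0 : ℝ)))
    (fun r => ENNReal.ofReal (r ^ (d - 1)) * f (r • (ν : Space d)))
  rw [← this]
  simp

/-- A surface integral is controlled by an integral over the outer shell of thickness `δ`; only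
radii above `1` are used, so that the Jacobian `r^{d-1}` is at least `1`. -/
theorem mul_lintegral_surf_le {d : ℕ} [NeZero d] {δ : ℝ}
    (f : Space d → ℝ≥0∞) (hf : Measurable f) (g : Sph d → ℝ≥0∞)
    (h : ∀ ν : Sph d, ∀ r ∈ Set.Ioo 1 (1 + δ), g ν ≤ f (r • (ν : Space d))) :
    ENNReal.ofReal δ * ∫⁻ ν, g ν ∂(surf d) ≤ ∫⁻ x, f x := by
  rw [lintegral_eq_lintegral_surf f hf, ← lintegral_const_mul' _ _ ENNReal.ofReal_ne_top]
  refine lintegral_mono fun ν => ?_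
  calc ENNReal.ofReal δ * g ν = ∫⁻ _ in Set.Ioo (1 : ℝ) (1 + δ), g ν := by
        simp [mul_comm]
    _ ≤ ∫⁻ r in Set.Ioo (1 : ℝ) (1 + δ),
          ENNReal.ofReal (r ^ (d - 1)) * f (r • (ν : Space d)) := by
        refine setLIntegral_mono' measurableSet_Ioo fun r hr => ?_
        refine (h ν r hr).trans (le_mul_of_one_le_left zero_le ?_)
        exact ENNReal.one_le_ofReal.2 (one_le_pow₀ hr.1.le)
    _ ≤ _ := lintegral_mono_set fun r hr => lt_trans one_pos hr.1

/-- Gaussian averages over the sphere. -/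
theorem integral_exp_neg_mul_norm_sub_sq_le (d : ℕ) [NeZero d] :
    ∃ C : ℝ, 0 ≤ C ∧ ∀ τ : ℝ, 0 < τ → ∀ x : Space d,
      ∫ ν : Sph d, Real.exp (-τ * ‖(ν : Space d) - x‖ ^ 2) ∂(surf d) ≤
        C * τ ^ (-((d : ℝ) - 1) / 2) := by
  refine ⟨Real.exp 1 * (2 * Real.pi) ^ ((d : ℝ) / 2), by positivity, fun τ hτ x => ?_⟩
  -- The shell has the width of the Gaussian, so moving across it changes the exponent by a bounded
  -- amount.
  set δ : ℝ := τ ^ (-(1 / 2) : ℝ) with hδ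
  have hδ0 : 0 < δ := by positivity
  have hδ2 : τ * δ ^ 2 = 1 := by
    rw [hδ, ← Real.rpow_natCast, ← Real.rpow_mul hτ.le]
    norm_num
    rw [Real.rpow_neg_one, mul_inv_cancel₀ hτ.ne']
  have hint : Integrable (fun y : Space d => Real.exp (-(τ / 2) * ‖y - x‖ ^ 2)) := by
    have := (GaussianFourier.integrable_cexp_neg_mul_sq_norm_add (V := Space d)
      (b := ((τ / 2 : ℝ) : ℂ)) (by simpa using hτ) 0 0).norm
    simp only [zero_mul, add_zero, Complex.norm_exp] at this
    have := this.comp_sub_right x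
    refine this.congr (ae_of_all _ fun y => ?_)
    simp [← Complex.ofReal_pow]
  have hI : ∫ y : Space d, Real.exp (-(τ / 2) * ‖y - x‖ ^ 2) =
      (Real.pi / (τ / 2)) ^ ((d : ℝ) / 2) := by
    rw [integral_sub_right_eq_self (fun y : Space d => Real.exp (-(τ / 2) * ‖y‖ ^ 2)) x,
      GaussianFourier.integral_rexp_neg_mul_sq_norm (by positivity)]
    simp
  have hcont : Continuous fun ν : Sph d => Real.exp (-τ * ‖(ν : Space d) - x‖ ^ 2) := by
    fun_prop
  -- Halving the rate pays for the cross term: `|rν - x|² ≤ 2|ν - x|² + 2δ²` and `τδ² = 1`, at the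
  -- cost of `e^{-1}`.
  have key := mul_lintegral_surf_le (δ := δ)
    (fun y : Space d => ENNReal.ofReal (Real.exp (-(τ / 2) * ‖y - x‖ ^ 2))) (by fun_prop)
    (fun ν => ENNReal.ofReal (Real.exp (-1) * Real.exp (-τ * ‖(ν : Space d) - x‖ ^ 2)))
    (fun ν r hr => by
      refine ENNReal.ofReal_le_ofReal ?_
      rw [← Real.exp_add, Real.exp_le_exp]
      have h1 : ‖r • (ν : Space d) - x‖ ≤ ‖(ν : Space d) - x‖ + δ := by
        have : r • (ν : Space d) - x = ((ν : Space d) - x) + (r - 1) • (ν : Space d) := by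
          rw [sub_smul, one_smul]; abel
        rw [this]
        refine (norm_add_le _ _).trans (add_le_add_right ?_ _)
        rw [norm_smul, norm_eq_of_mem_sphere, mul_one, Real.norm_eq_abs,
          abs_of_nonneg (by linarith [hr.1])]
        linarith [hr.2]
      have h2 : ‖r • (ν : Space d) - x‖ ^ 2 ≤ 2 * ‖(ν : Space d) - x‖ ^ 2 + 2 * δ ^ 2 := by
        nlinarith [norm_nonneg (r • (ν : Space d) - x), sq_nonneg (‖(ν : Space d) - x‖ - δ)]
      nlinarith)
  rw [← ofReal_integral_eq_lintegral_ofReal hint (ae_of_all _ fun _ => (Real.exp_pos _).le), hI,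
    ← ofReal_integral_eq_lintegral_ofReal
      (by
        refine Integrable.of_bound (by fun_prop) 1 (ae_of_all _ fun ν => ?_)
        rw [← Real.exp_add, Real.norm_eq_abs, abs_of_pos (Real.exp_pos _), Real.exp_le_one_iff]
        nlinarith [sq_nonneg ‖(ν : Space d) - x‖])
      (ae_of_all _ fun _ => by positivity),
    ← ENNReal.ofReal_mul hδ0.le, ENNReal.ofReal_le_ofReal_iff (by positivity),
    integral_const_mul] at key
  have h3 : (Real.pi / (τ / 2)) ^ ((d : ℝ) / 2) =
      (2 * Real.pi) ^ ((d : ℝ) / 2) * τ ^ (-((d : ℝ) / 2)) := by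
    rw [Real.rpow_neg hτ.le, ← Real.inv_rpow hτ.le, ← Real.mul_rpow (by positivity) (by positivity)]
    congr 1; field_simp
  have h4 : τ ^ (-((d : ℝ) - 1) / 2) * δ = τ ^ (-((d : ℝ) / 2)) := by
    rw [hδ, ← Real.rpow_add hτ]; congr 1; ring
  rw [h3, ← h4] at key
  have h5 : Real.exp 1 * Real.exp (-1) = 1 := by rw [← Real.exp_add]; simp
  refine le_of_mul_le_mul_left ?_ hδ0
  calc δ * ∫ ν : Sph d, Real.exp (-τ * ‖(ν : Space d) - x‖ ^ 2) ∂(surf d)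
      = Real.exp 1 * (δ * (Real.exp (-1) *
          ∫ ν : Sph d, Real.exp (-τ * ‖(ν : Space d) - x‖ ^ 2) ∂(surf d))) := by
        linear_combination (-(δ * ∫ ν : Sph d, Real.exp (-τ * ‖(ν : Space d) - x‖ ^ 2) ∂(surf d)))
          * h5
    _ ≤ Real.exp 1 * _ := mul_le_mul_of_nonneg_left key (Real.exp_pos _).le
    _ = _ := by ring

/-! ### Regularised distance to the critical points of a linear phase -/

/-- `ρ² + |ω - ⟨e, ω⟩ e|²` for a unit vector `e`. -/
def reg {d : ℕ} (e : Space d) (ρ : ℝ) (ω : Sph d) : ℝ := 1 - inner ℝ e (ω : Space d) ^ 2 + ρ ^ 2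

theorem continuous_reg {d : ℕ} (e : Space d) (ρ : ℝ) : Continuous (reg e ρ) := by
  unfold reg; fun_prop

theorem abs_inner_sph_le_one {d : ℕ} {e : Space d} (he : ‖e‖ = 1) (ω : Sph d) :
    |inner ℝ e (ω : Space d)| ≤ 1 := by
  simpa [he] using abs_real_inner_le_norm e (ω : Space d)

theorem one_sub_inner_sq_nonneg {d : ℕ} {e : Space d} (he : ‖e‖ = 1) (ω : Sph d) :
    0 ≤ 1 - inner ℝ e (ω : Space d) ^ 2 := by
  have := abs_le.1 (abs_inner_sph_le_one he ω)
  nlinarith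

theorem sq_le_reg {d : ℕ} {e : Space d} (he : ‖e‖ = 1) (ρ : ℝ) (ω : Sph d) :
    ρ ^ 2 ≤ reg e ρ ω := by
  have := one_sub_inner_sq_nonneg he ω
  unfold reg; linarith

theorem reg_pos {d : ℕ} {e : Space d} (he : ‖e‖ = 1) {ρ : ℝ} (hρ : 0 < ρ) (ω : Sph d) :
    0 < reg e ρ ω := (by positivity : 0 < ρ ^ 2).trans_le (sq_le_reg he ρ ω)

theorem integrable_inv_reg {d : ℕ} {e : Space d} (he : ‖e‖ = 1) {ρ : ℝ} (hρ : 0 < ρ) :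
    Integrable (fun ω => (reg e ρ ω)⁻¹) (surf d) := by
  refine Integrable.of_bound ((continuous_reg e ρ).inv₀
    fun ω => (reg_pos he hρ ω).ne').aestronglyMeasurable ((ρ ^ 2)⁻¹) (ae_of_all _ fun ω => ?_)
  rw [Real.norm_eq_abs, abs_of_pos (inv_pos.2 (reg_pos he hρ ω))]
  exact inv_anti₀ (by positivity) (sq_le_reg he ρ ω)

/-- The exponent vanishes at both poles `±e` and dominates half the squared distance to the nearer
one, so two Gaussian averages suffice. They decay like `τ^{-(d-1)/2}`; for `τ ≥ 1` this may be
weakened to `τ^{-β}`, and for `τ ≤ 1` the total mass is enough. -/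
theorem integral_exp_neg_one_sub_inner_sq_le (d : ℕ) [NeZero d] {β : ℝ} (hβ0 : 0 ≤ β)
    (hβ : β ≤ ((d : ℝ) - 1) / 2) :
    ∃ C : ℝ, 0 ≤ C ∧ ∀ e : Space d, ‖e‖ = 1 → ∀ τ : ℝ, 0 < τ →
      ∫ ω : Sph d, Real.exp (-τ * (1 - inner ℝ e (ω : Space d) ^ 2)) ∂(surf d) ≤
        C * τ ^ (-β) := by
  obtain ⟨C, hC, h⟩ := integral_exp_neg_mul_norm_sub_sq_le d
  set D : ℝ := 2 * C * 2⁻¹ ^ (-((d : ℝ) - 1) / 2)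
  have hD : 0 ≤ D := by positivity
  refine ⟨(surf d).real Set.univ + D, by positivity, fun e he τ hτ => ?_⟩
  have hint : ∀ (x : Space d), Integrable
      (fun ω : Sph d => Real.exp (-(τ / 2) * ‖(ω : Space d) - x‖ ^ 2)) (surf d) := fun x => by
    refine Integrable.of_bound (by fun_prop) 1 (ae_of_all _ fun ν => ?_)
    rw [Real.norm_eq_abs, abs_of_pos (Real.exp_pos _), Real.exp_le_one_iff]
    nlinarith [sq_nonneg ‖(ν : Space d) - x‖]
  have hle1 : ∀ ω : Sph d, Real.exp (-τ * (1 - inner ℝ e (ω : Space d) ^ 2)) ≤ 1 := fun ω => by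
    rw [Real.exp_le_one_iff]
    nlinarith [one_sub_inner_sq_nonneg he ω]
  have hint1 : Integrable
      (fun ω : Sph d => Real.exp (-τ * (1 - inner ℝ e (ω : Space d) ^ 2))) (surf d) := by
    refine Integrable.of_bound (by fun_prop) 1 (ae_of_all _ fun ν => ?_)
    rw [Real.norm_eq_abs, abs_of_pos (Real.exp_pos _)]
    exact hle1 ν
  rcases le_total τ 1 with h1 | h1
  · calc _ ≤ ∫ _ : Sph d, (1 : ℝ) ∂(surf d) := integral_mono hint1 (integrable_const _) hle1
      _ = (surf d).real Set.univ * 1 := by simp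
      _ ≤ ((surf d).real Set.univ + D) * τ ^ (-β) := by
        refine mul_le_mul (by linarith) ?_ zero_le_one (by positivity)
        exact Real.one_le_rpow_of_pos_of_le_one_of_nonpos hτ h1 (by linarith)
  · have hpt : ∀ ω : Sph d, Real.exp (-τ * (1 - inner ℝ e (ω : Space d) ^ 2)) ≤
        Real.exp (-(τ / 2) * ‖(ω : Space d) - e‖ ^ 2) +
          Real.exp (-(τ / 2) * ‖(ω : Space d) - -e‖ ^ 2) := fun ω => by
      have hb := abs_le.1 (abs_inner_sph_le_one he ω)
      have n1 : ‖(ω : Space d) - e‖ ^ 2 = 2 - 2 * inner ℝ e (ω : Space d) := by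
        rw [norm_sub_sq_real, he, norm_eq_of_mem_sphere, real_inner_comm]; ring
      have n2 : ‖(ω : Space d) - -e‖ ^ 2 = 2 + 2 * inner ℝ e (ω : Space d) := by
        rw [sub_neg_eq_add, norm_add_sq_real, he, norm_eq_of_mem_sphere, real_inner_comm]; ring
      rw [n1, n2]
      rcases le_total 0 (inner ℝ e (ω : Space d)) with h0 | h0
      · refine le_add_of_le_of_nonneg (Real.exp_le_exp.2 ?_) (Real.exp_pos _).le
        nlinarith [mul_nonneg hτ.le (mul_nonneg h0 (sub_nonneg.2 hb.2))]
      · refine le_add_of_nonneg_of_le (Real.exp_pos _).le (Real.exp_le_exp.2 ?_)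
        nlinarith [mul_nonneg hτ.le (mul_nonneg (neg_nonneg.2 h0)
          (neg_le_iff_add_nonneg.1 hb.1))]
    calc _ ≤ ∫ ω : Sph d, (Real.exp (-(τ / 2) * ‖(ω : Space d) - e‖ ^ 2) +
          Real.exp (-(τ / 2) * ‖(ω : Space d) - -e‖ ^ 2)) ∂(surf d) :=
          integral_mono hint1 ((hint e).add (hint (-e))) hpt
      _ ≤ C * (τ / 2) ^ (-((d : ℝ) - 1) / 2) + C * (τ / 2) ^ (-((d : ℝ) - 1) / 2) := by
        rw [integral_add (hint e) (hint (-e))]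
        exact add_le_add (h _ (by positivity) _) (h _ (by positivity) _)
      _ = D * τ ^ (-((d : ℝ) - 1) / 2) := by
        rw [div_eq_mul_inv τ 2, Real.mul_rpow hτ.le (by norm_num)]
        simp only [D]; ring
      _ ≤ D * τ ^ (-β) := by
        refine mul_le_mul_of_nonneg_left (Real.rpow_le_rpow_of_exponent_le h1 ?_) hD
        linarith
      _ ≤ _ := mul_le_mul_of_nonneg_right (by simp) (by positivity)

/-- Laplace representation: `1/Q = ∫_0^∞ e^{-Qτ} dτ`, which reduces the claim to the Gaussian bound
and a Gamma integral. The condition `β < 1` is convergence of `∫ τ^{-β} e^{-ρ²τ} dτ` at `0`. -/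
theorem integral_inv_reg_le (d : ℕ) [NeZero d] {β : ℝ} (hβ0 : 0 ≤ β) (hβ1 : β < 1)
    (hβ : β ≤ ((d : ℝ) - 1) / 2) :
    ∃ C : ℝ, 0 ≤ C ∧ ∀ e : Space d, ‖e‖ = 1 → ∀ ρ : ℝ, 0 < ρ →
      ∫ ω : Sph d, (reg e ρ ω)⁻¹ ∂(surf d) ≤ C * (ρ ^ 2) ^ (β - 1) := by
  obtain ⟨C, hC, h⟩ := integral_exp_neg_one_sub_inner_sq_le d hβ0 hβ
  have hΓ : 0 < Real.Gamma (1 - β) := Real.Gamma_pos_of_pos (by linarith)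
  refine ⟨C * Real.Gamma (1 - β), by positivity, fun e he ρ hρ => ?_⟩
  have hρ2 : 0 < ρ ^ 2 := by positivity
  have e1 : ∀ ω : Sph d, (reg e ρ ω)⁻¹ =
      ∫ τ in Set.Ioi (0 : ℝ), Real.exp (-(reg e ρ ω) * τ) := fun ω => by
    rw [integral_exp_mul_Ioi (neg_lt_zero.2 (reg_pos he hρ ω))]
    simp [neg_div_neg_eq]
  have hexp : IntegrableOn (fun τ => Real.exp (-(ρ ^ 2) * τ)) (Set.Ioi (0 : ℝ)) :=
    integrableOn_exp_mul_Ioi (neg_lt_zero.2 hρ2) 0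
  have hprod : Integrable (Function.uncurry fun (ω : Sph d) (τ : ℝ) =>
      Real.exp (-(reg e ρ ω) * τ)) ((surf d).prod (volume.restrict (Set.Ioi (0 : ℝ)))) := by
    have hc := continuous_reg e ρ
    refine (Integrable.comp_snd hexp (surf d)).mono' (by fun_prop) ?_
    have : ∀ᵐ p ∂((surf d).prod (volume.restrict (Set.Ioi (0 : ℝ)))), p.2 ∈ Set.Ioi (0 : ℝ) :=
      Measure.quasiMeasurePreserving_snd.ae (ae_restrict_mem measurableSet_Ioi)
    filter_upwards [this] with p hp
    have hp' : (0 : ℝ) < p.2 := hp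
    simp only [Function.uncurry, Real.norm_eq_abs, Real.abs_exp]
    exact Real.exp_le_exp.2 (mul_le_mul_of_nonneg_right
      (neg_le_neg (sq_le_reg he ρ p.1)) hp'.le)
  simp_rw [e1]
  rw [integral_integral_swap hprod]
  have hgam := Real.integral_rpow_mul_exp_neg_mul_Ioi (a := 1 - β) (by linarith) hρ2
  -- Integrability is read off from the value of the integral: a non-integrable function would have
  -- integral `0`, but the Gamma value is positive.
  have hgi : IntegrableOn (fun τ : ℝ => C * (τ ^ (1 - β - 1) * Real.exp (-(ρ ^ 2 * τ))))
      (Set.Ioi 0) := by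
    refine Integrable.const_mul ?_ _
    by_contra hcon
    rw [integral_undef hcon] at hgam
    have : 0 < (1 / ρ ^ 2) ^ (1 - β) * Real.Gamma (1 - β) := by positivity
    linarith
  calc ∫ τ in Set.Ioi (0 : ℝ), ∫ ω : Sph d, Real.exp (-(reg e ρ ω) * τ) ∂(surf d)
      ≤ ∫ τ in Set.Ioi (0 : ℝ), C * (τ ^ (1 - β - 1) * Real.exp (-(ρ ^ 2 * τ))) := by
        refine setIntegral_mono_on hprod.integral_prod_right hgi measurableSet_Ioi fun τ hτ => ?_
        have : ∀ ω : Sph d, Real.exp (-(reg e ρ ω) * τ) =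
            Real.exp (-τ * (1 - inner ℝ e (ω : Space d) ^ 2)) * Real.exp (-(ρ ^ 2 * τ)) :=
          fun ω => by rw [← Real.exp_add]; unfold reg; ring_nf
        simp_rw [this]
        rw [integral_mul_const, ← mul_assoc]
        refine mul_le_mul_of_nonneg_right ?_ (Real.exp_pos _).le
        have := h e he τ hτ
        rwa [show 1 - β - 1 = -β by ring]
    _ = C * Real.Gamma (1 - β) * (ρ ^ 2) ^ (β - 1) := by
        rw [integral_const_mul, hgam, one_div, Real.inv_rpow hρ2.le, ← Real.rpow_neg hρ2.le]
        rw [show -(1 - β) = β - 1 by ring]; ring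

/-! ### Rotation fields and the weight for integration by parts -/

/-- The derivative at `ω` of `⟨e, ·⟩` along the rotations in the `(x_i, x_j)`-plane. -/
def angMom {d : ℕ} (e : Space d) (i j : Fin d) (ω : Sph d) : ℝ :=
  e j * (ω : Space d) i - e i * (ω : Space d) j

theorem continuous_angMom {d : ℕ} (e : Space d) (i j : Fin d) : Continuous (angMom e i j) := by
  unfold angMom; fun_prop

/-- Lagrange's identity for the pair `e, ω`. It says that the rotation fields together detect the
full tangential gradient of `⟨e, ·⟩`, so the phase is stationary only at `±e`. -/
theorem sum_angMom_sq {d : ℕ} {e : Space d} (he : ‖e‖ = 1) (ω : Sph d) :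
    ∑ i, ∑ j, angMom e i j ω ^ 2 = 2 * (1 - inner ℝ e (ω : Space d) ^ 2) := by
  have h1 : ∑ i, e i ^ 2 = 1 := by rw [← EuclideanSpace.real_norm_sq_eq, he, one_pow]
  have h2 : ∑ i, (ω : Space d) i ^ 2 = 1 := by
    rw [← EuclideanSpace.real_norm_sq_eq, norm_eq_of_mem_sphere, one_pow]
  have h3 : inner ℝ e (ω : Space d) = ∑ i, e i * (ω : Space d) i := by
    simp [PiLp.inner_apply, mul_comm]
  have h4 : ∀ i j, angMom e i j ω ^ 2 = (ω : Space d) i ^ 2 * e j ^ 2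
      - 2 * ((e i * (ω : Space d) i) * (e j * (ω : Space d) j))
      + e i ^ 2 * (ω : Space d) j ^ 2 := fun i j => by unfold angMom; ring
  simp_rw [h4, Finset.sum_add_distrib, Finset.sum_sub_distrib, ← Finset.mul_sum,
    ← Finset.sum_mul, h1, h2, ← h3]
  ring

theorem angMom_sq_le_reg {d : ℕ} {e : Space d} (he : ‖e‖ = 1) (ρ : ℝ) (i j : Fin d) (ω : Sph d) :
    angMom e i j ω ^ 2 ≤ 2 * reg e ρ ω := by
  have h1 : angMom e i j ω ^ 2 ≤ ∑ i, ∑ j, angMom e i j ω ^ 2 :=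
    (Finset.single_le_sum (f := fun j => angMom e i j ω ^ 2) (fun j _ => sq_nonneg _)
      (Finset.mem_univ j)).trans
    (Finset.single_le_sum (f := fun i => ∑ j, angMom e i j ω ^ 2)
      (fun i _ => Finset.sum_nonneg fun j _ => sq_nonneg _) (Finset.mem_univ i))
  rw [sum_angMom_sq he] at h1
  unfold reg
  nlinarith [sq_nonneg ρ]

theorem abs_coord_le_one {d : ℕ} {e : Space d} (he : ‖e‖ = 1) (i : Fin d) : |e i| ≤ 1 := by
  have := PiLp.norm_apply_le e i
  rwa [he] at this

theorem abs_angMom_sub_le {d : ℕ} {e : Space d} (he : ‖e‖ = 1) (i j : Fin d) (ω ω' : Sph d) :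
    |angMom e i j ω' - angMom e i j ω| ≤ 2 * ‖(ω' : Space d) - ω‖ := by
  have hc : ∀ k, |(ω' : Space d) k - (ω : Space d) k| ≤ ‖(ω' : Space d) - ω‖ := fun k =>
    PiLp.norm_apply_le ((ω' : Space d) - (ω : Space d)) k
  have : angMom e i j ω' - angMom e i j ω =
      e j * ((ω' : Space d) i - (ω : Space d) i) - e i * ((ω' : Space d) j - (ω : Space d) j) := by
    unfold angMom; ring
  rw [this]
  refine (abs_sub _ _).trans ?_
  rw [abs_mul, abs_mul]
  have a1 := mul_le_mul (abs_coord_le_one he j) (hc i) (abs_nonneg _) zero_le_one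
  have a2 := mul_le_mul (abs_coord_le_one he i) (hc j) (abs_nonneg _) zero_le_one
  linarith

theorem abs_angMom_le {d : ℕ} {e : Space d} (he : ‖e‖ = 1) (i j : Fin d) (ω : Sph d) :
    |angMom e i j ω| ≤ 2 := by
  refine (abs_sub _ _).trans ?_
  rw [abs_mul, abs_mul]
  have a1 := mul_le_mul (abs_coord_le_one he j)
    (abs_coord_le_one (norm_eq_of_mem_sphere ω) i) (abs_nonneg _) zero_le_one
  have a2 := mul_le_mul (abs_coord_le_one he i)
    (abs_coord_le_one (norm_eq_of_mem_sphere ω) j) (abs_nonneg _) zero_le_one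
  linarith

theorem norm_sub_inner_smul_sq {d : ℕ} {e : Space d} (he : ‖e‖ = 1) (ω : Sph d) :
    ‖(ω : Space d) - inner ℝ e (ω : Space d) • e‖ ^ 2 = 1 - inner ℝ e (ω : Space d) ^ 2 := by
  rw [norm_sub_sq_real, inner_smul_right, norm_smul, he, norm_eq_of_mem_sphere, real_inner_comm e,
    Real.norm_eq_abs, mul_one, sq_abs]
  ring

/-- Up to the constant `ρ²`, `reg` is the squared norm of the projection of `ω` orthogonal to `e`.
Factoring the difference of squares keeps the gain of `√reg`. -/
theorem abs_reg_sub_le {d : ℕ} {e : Space d} (he : ‖e‖ = 1) (ρ : ℝ) (ω ω' : Sph d) :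
    |reg e ρ ω' - reg e ρ ω| ≤
      2 * ‖(ω' : Space d) - ω‖ * (√(reg e ρ ω') + √(reg e ρ ω)) := by
  set P : Sph d → Space d := fun ω => (ω : Space d) - inner ℝ e (ω : Space d) • e
  have hP : ∀ ω, reg e ρ ω = ‖P ω‖ ^ 2 + ρ ^ 2 := fun ω => by
    rw [norm_sub_inner_smul_sq he]; rfl
  have hle : ∀ ω, ‖P ω‖ ≤ √(reg e ρ ω) := fun ω => by
    refine Real.le_sqrt_of_sq_le ?_
    rw [hP]; linarith [sq_nonneg ρ]
  have hd : |‖P ω'‖ - ‖P ω‖| ≤ 2 * ‖(ω' : Space d) - ω‖ := by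
    refine (abs_norm_sub_norm_le _ _).trans ?_
    have : P ω' - P ω = ((ω' : Space d) - ω) - inner ℝ e ((ω' : Space d) - ω) • e := by
      simp only [P, inner_sub_right, sub_smul]; abel
    rw [this]
    refine (norm_sub_le _ _).trans ?_
    rw [norm_smul, he, mul_one]
    have := norm_inner_le_norm (𝕜 := ℝ) e ((ω' : Space d) - ω)
    rw [he, one_mul] at this
    linarith
  have : reg e ρ ω' - reg e ρ ω = (‖P ω'‖ - ‖P ω‖) * (‖P ω'‖ + ‖P ω‖) := by
    rw [hP, hP]; ring
  rw [this, abs_mul, abs_of_nonneg (by positivity : 0 ≤ ‖P ω'‖ + ‖P ω‖)]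
  exact mul_le_mul hd (add_le_add (hle _) (hle _)) (by positivity) (by positivity)

/-- Bounded by `L`, and `L`-Lipschitz. -/
structure LipBound {d : ℕ} (L : ℝ) (h : Sph d → ℂ) : Prop where
  norm_le : ∀ ω, ‖h ω‖ ≤ L
  norm_sub_le : ∀ ω ω', ‖h ω - h ω'‖ ≤ L * ‖(ω : Space d) - ω'‖

theorem LipBound.continuous {d : ℕ} {L : ℝ} {h : Sph d → ℂ} (hh : LipBound L h) :
    Continuous h := by
  have : LipschitzWith (Real.toNNReal L) h := LipschitzWith.of_dist_le' fun ω ω' => by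
    rw [dist_eq_norm, Subtype.dist_eq, dist_eq_norm]; exact hh.norm_sub_le ω ω'
  exact this.continuous

theorem LipBound.integrable {d : ℕ} {L : ℝ} {h : Sph d → ℂ} (hh : LipBound L h) :
    Integrable h (surf d) :=
  Integrable.of_bound hh.continuous.aestronglyMeasurable L (ae_of_all _ hh.norm_le)

/-- The weight `angMom / reg`. -/
def wt {d : ℕ} (e : Space d) (ρ : ℝ) (i j : Fin d) (ω : Sph d) : ℝ :=
  angMom e i j ω / reg e ρ ω

theorem continuous_wt {d : ℕ} {e : Space d} (he : ‖e‖ = 1) {ρ : ℝ} (hρ : 0 < ρ) (i j : Fin d) :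
    Continuous (wt e ρ i j) :=
  (continuous_angMom e i j).div (continuous_reg e ρ) fun ω => (reg_pos he hρ ω).ne'

theorem abs_wt_le {d : ℕ} {e : Space d} (he : ‖e‖ = 1) {ρ : ℝ} (hρ : 0 < ρ) (i j : Fin d)
    (ω : Sph d) : |wt e ρ i j ω| ≤ 2 * (reg e ρ ω)⁻¹ := by
  rw [wt, abs_div, abs_of_pos (reg_pos he hρ ω), div_eq_mul_inv]
  exact mul_le_mul_of_nonneg_right (abs_angMom_le he i j ω) (inv_pos.2 (reg_pos he hρ ω)).le

/-- Scaling: `angMom` is Lipschitz and `O(√Q)` with `Q = reg`, while `Q` has derivative `O(√Q)`;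
hence the quotient has derivative `O(1/Q)`. The bound is symmetric in the two points, so no
comparability of `Q` at them is required. -/
theorem abs_wt_sub_le {d : ℕ} {e : Space d} (he : ‖e‖ = 1) {ρ : ℝ} (hρ : 0 < ρ) (i j : Fin d)
    (ω ω' : Sph d) : |wt e ρ i j ω' - wt e ρ i j ω| ≤
      10 * ‖(ω' : Space d) - ω‖ * ((reg e ρ ω')⁻¹ + (reg e ρ ω)⁻¹) := by
  have hQ := reg_pos he hρ ω
  have hQ' := reg_pos he hρ ω'
  set η := ‖(ω' : Space d) - ω‖
  have hη : 0 ≤ η := norm_nonneg _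
  have h1 := abs_angMom_sub_le he i j ω ω'
  have h2 := abs_reg_sub_le he ρ ω ω'
  have h3 : |angMom e i j ω| ≤ 2 * √(reg e ρ ω) := by
    refine abs_le_of_sq_le_sq ?_ (by positivity)
    rw [mul_pow, Real.sq_sqrt hQ.le]
    linarith [angMom_sq_le_reg he ρ i j ω]
  set A := √(reg e ρ ω)
  set B := √(reg e ρ ω')
  have hA : 0 < A := Real.sqrt_pos.2 hQ
  have hB : 0 < B := Real.sqrt_pos.2 hQ'
  have hA2 : reg e ρ ω = A ^ 2 := (Real.sq_sqrt hQ.le).symm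
  have hB2 : reg e ρ ω' = B ^ 2 := (Real.sq_sqrt hQ'.le).symm
  have e1 : wt e ρ i j ω' - wt e ρ i j ω =
      ((angMom e i j ω' - angMom e i j ω) * A ^ 2 -
        angMom e i j ω * (reg e ρ ω' - reg e ρ ω)) / (A ^ 2 * B ^ 2) := by
    unfold wt
    rw [hA2, hB2]
    field_simp
    ring
  rw [e1, abs_div, abs_of_pos (by positivity : 0 < A ^ 2 * B ^ 2), div_le_iff₀ (by positivity),
    hA2, hB2]
  have e2 : 10 * η * ((B ^ 2)⁻¹ + (A ^ 2)⁻¹) * (A ^ 2 * B ^ 2) = 10 * η * (A ^ 2 + B ^ 2) := by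
    field_simp
  rw [e2]
  refine (abs_sub _ _).trans ?_
  rw [abs_mul, abs_mul, abs_of_pos (by positivity : 0 < A ^ 2)]
  have b1 : |angMom e i j ω' - angMom e i j ω| * A ^ 2 ≤ 2 * η * A ^ 2 :=
    mul_le_mul_of_nonneg_right h1 (by positivity)
  have b2 : |angMom e i j ω| * |reg e ρ ω' - reg e ρ ω| ≤ (2 * A) * (2 * η * (B + A)) :=
    mul_le_mul h3 h2 (abs_nonneg _) (by positivity)
  rw [hA2, hB2] at b2
  nlinarith [mul_nonneg hη (sq_nonneg (A - B)), mul_nonneg hη (sq_nonneg B)]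

theorem norm_mul_wt_sub_le {d : ℕ} {e : Space d} (he : ‖e‖ = 1) {ρ : ℝ} (hρ : 0 < ρ) (i j : Fin d)
    {L : ℝ} {h : Sph d → ℂ} (hh : LipBound L h) (ω ω' : Sph d) :
    ‖h ω' * wt e ρ i j ω' - h ω * wt e ρ i j ω‖ ≤
      12 * L * ‖(ω' : Space d) - ω‖ * ((reg e ρ ω')⁻¹ + (reg e ρ ω)⁻¹) := by
  have hL : 0 ≤ L := (norm_nonneg _).trans (hh.norm_le ω)
  have e1 : h ω' * wt e ρ i j ω' - h ω * wt e ρ i j ω =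
      (h ω' - h ω) * wt e ρ i j ω' + h ω * ((wt e ρ i j ω' - wt e ρ i j ω : ℝ) : ℂ) := by
    push_cast; ring
  rw [e1]
  refine (norm_add_le _ _).trans ?_
  rw [norm_mul, norm_mul, Complex.norm_real, Complex.norm_real, Real.norm_eq_abs, Real.norm_eq_abs]
  have b1 := mul_le_mul (hh.norm_sub_le ω' ω) (abs_wt_le he hρ i j ω') (abs_nonneg _)
    (mul_nonneg hL (norm_nonneg _))
  have b2 := mul_le_mul (hh.norm_le ω) (abs_wt_sub_le he hρ i j ω ω') (abs_nonneg _) hL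
  have hQ := inv_pos.2 (reg_pos he hρ ω)
  nlinarith [mul_nonneg (mul_nonneg hL (norm_nonneg ((ω' : Space d) - ω))) hQ.le]

/-! ### Integration by parts and Fourier decay of Lipschitz densities -/

theorem norm_rotVec_sub_le {d : ℕ} {i j : Fin d} (hij : i ≠ j) (t : ℝ) (x : Space d) :
    ‖rotVec i j t x - x‖ ≤ |t| * ‖x‖ := by
  refine abs_le_of_sq_le_sq' ?_ (by positivity) |>.2
  have hj : j ∈ (Finset.univ.erase i : Finset (Fin d)) := by simp [hij.symm]
  have key : ‖rotVec i j t x - x‖ ^ 2 = (2 - 2 * Real.cos t) * (x i ^ 2 + x j ^ 2) := by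
    rw [EuclideanSpace.real_norm_sq_eq, ← Finset.add_sum_erase _ _ (Finset.mem_univ i),
      ← Finset.add_sum_erase _ _ hj, Finset.sum_eq_zero fun k hk => ?_]
    · simp only [PiLp.sub_apply, rotVec, if_true, hij.symm, if_false]
      linear_combination (x i ^ 2 + x j ^ 2) * Real.sin_sq_add_cos_sq t
    · simp only [Finset.mem_erase, Finset.mem_univ, and_true] at hk
      simp [rotVec, hk.1, hk.2]
  have h2 : x i ^ 2 + x j ^ 2 ≤ ‖x‖ ^ 2 := by
    rw [EuclideanSpace.real_norm_sq_eq, ← Finset.add_sum_erase _ _ (Finset.mem_univ i),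
      ← Finset.add_sum_erase _ _ hj, ← add_assoc]
    exact le_add_of_nonneg_right (Finset.sum_nonneg fun k _ => sq_nonneg _)
  have h3 : 2 - 2 * Real.cos t ≤ t ^ 2 := by
    have := Real.one_sub_sq_div_two_le_cos (x := t); linarith
  rw [key, mul_pow, sq_abs]
  exact mul_le_mul h3 h2 (by positivity) (sq_nonneg t)

theorem norm_rot_sub_le {d : ℕ} {i j : Fin d} (hij : i ≠ j) (t : ℝ) (ω : Sph d) :
    ‖(sphMap (rotIsometry i j hij t) ω : Space d) - ω‖ ≤ |t| := by
  simpa [coe_sphMap, rotIsometry_apply, norm_eq_of_mem_sphere] using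
    norm_rotVec_sub_le hij t (ω : Space d)

theorem hasDerivAt_inner_rot {d : ℕ} {i j : Fin d} (hij : i ≠ j) (e : Space d) (ω : Sph d) :
    HasDerivAt (fun t => inner ℝ e (rotVec i j t (ω : Space d))) (angMom e i j ω) 0 := by
  have hj : j ∈ (Finset.univ.erase i : Finset (Fin d)) := by simp [hij.symm]
  have key : ∀ t, inner ℝ e (rotVec i j t (ω : Space d)) =
      (e i * (Real.cos t * (ω : Space d) i - Real.sin t * (ω : Space d) j) +
      e j * (Real.sin t * (ω : Space d) i + Real.cos t * (ω : Space d) j)) +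
      ∑ k ∈ (Finset.univ.erase i).erase j, e k * (ω : Space d) k := fun t => by
    have : inner ℝ e (rotVec i j t (ω : Space d)) = ∑ k, e k * rotVec i j t (ω : Space d) k := by
      simp [PiLp.inner_apply, mul_comm]
    rw [this, ← Finset.add_sum_erase _ _ (Finset.mem_univ i), ← Finset.add_sum_erase _ _ hj,
      ← add_assoc]
    congr 1
    · simp [rotVec, hij.symm]
    · refine Finset.sum_congr rfl fun k hk => ?_
      simp only [Finset.mem_erase, Finset.mem_univ, and_true] at hk
      simp [rotVec, hk.1, hk.2]
  refine HasDerivAt.congr_of_eventuallyEq ?_ (Eventually.of_forall key)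
  have hs := Real.hasDerivAt_sin 0
  have hc := Real.hasDerivAt_cos 0
  have := ((((hc.mul_const ((ω : Space d) i)).sub (hs.mul_const ((ω : Space d) j))).const_mul
    (e i)).add (((hs.mul_const ((ω : Space d) i)).add
      (hc.mul_const ((ω : Space d) j))).const_mul (e j))).add_const
    (∑ k ∈ (Finset.univ.erase i).erase j, e k * (ω : Space d) k)
  refine HasDerivAt.congr_deriv this ?_
  rw [Real.sin_zero, Real.cos_zero]
  unfold angMom; ring

/-- The character `ω ↦ e^{iλ⟨e, ω⟩}`. -/
def osc {d : ℕ} (e : Space d) (l : ℝ) (x : Space d) : ℂ :=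
  Complex.exp (((l * inner ℝ e x : ℝ) : ℂ) * Complex.I)

theorem continuous_osc {d : ℕ} (e : Space d) (l : ℝ) : Continuous (osc e l) := by
  unfold osc; fun_prop

theorem norm_osc {d : ℕ} (e : Space d) (l : ℝ) (x : Space d) : ‖osc e l x‖ = 1 :=
  Complex.norm_exp_ofReal_mul_I _

theorem norm_exp_mul_I_sub_le (a b : ℝ) :
    ‖Complex.exp ((a : ℂ) * Complex.I) - Complex.exp ((b : ℂ) * Complex.I)‖ ≤ |a - b| := by
  have : Complex.exp ((a : ℂ) * Complex.I) - Complex.exp ((b : ℂ) * Complex.I) =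
      Complex.exp ((b : ℂ) * Complex.I) * (Complex.exp (Complex.I * ((a - b : ℝ) : ℂ)) - 1) := by
    rw [mul_sub, ← Complex.exp_add, mul_one]; congr 2; push_cast; ring
  rw [this, norm_mul, Complex.norm_exp_ofReal_mul_I, one_mul]
  exact Real.norm_exp_I_mul_ofReal_sub_one_le

theorem norm_osc_sub_le {d : ℕ} {e : Space d} (he : ‖e‖ = 1) {l : ℝ} (hl : 0 ≤ l)
    (x y : Space d) : ‖osc e l x - osc e l y‖ ≤ l * ‖x - y‖ := by
  refine (norm_exp_mul_I_sub_le _ _).trans ?_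
  rw [← mul_sub, abs_mul, abs_of_nonneg hl, ← inner_sub_right]
  refine mul_le_mul_of_nonneg_left ?_ hl
  simpa [he] using abs_real_inner_le_norm e (x - y)

/-- Discrete integration by parts: invariance of the surface measure moves the rotation difference
from the oscillating factor to the amplitude `h · wt`, which needs only a Lipschitz bound. -/
theorem norm_integral_mul_osc_rot_sub_le {d : ℕ} {i j : Fin d} (hij : i ≠ j) {e : Space d}
    (he : ‖e‖ = 1) {ρ : ℝ} (hρ : 0 < ρ) (l : ℝ) {L : ℝ} {h : Sph d → ℂ}
    (hh : LipBound L h) (t : ℝ) :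
    ‖∫ ω, h ω * wt e ρ i j ω *
        (osc e l (sphMap (rotIsometry i j hij t) ω) - osc e l ω) ∂(surf d)‖ ≤
      |t| * (24 * L * ∫ ω, (reg e ρ ω)⁻¹ ∂(surf d)) := by
  set R := rotIsometry i j hij t
  set u : Sph d → ℂ := fun ω => h ω * wt e ρ i j ω
  have hu : Continuous u := hh.continuous.mul
    (Complex.continuous_ofReal.comp (continuous_wt he hρ i j))
  have hE : Continuous fun ω : Sph d => osc e l ω := (continuous_osc e l).comp continuous_subtype_val
  have hRc := continuous_sphMap R
  have hmp := measurePreserving_sphMap R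
  have hint : ∀ f : Sph d → ℂ, Continuous f → Integrable f (surf d) := fun f hf =>
    hf.integrable_of_hasCompactSupport (HasCompactSupport.of_compactSpace f)
  have hemb : MeasurableEmbedding (sphMap R) :=
    (show IsClosedEmbedding (sphMap R) from hRc.isClosedEmbedding
      (Function.LeftInverse.injective (sphMap_symm_apply R))).measurableEmbedding
  have e1 : ∫ ω, u ω * osc e l ω ∂(surf d) =
      ∫ ω, u (sphMap R ω) * osc e l (sphMap R ω) ∂(surf d) :=
    (hmp.integral_comp hemb (fun ω => u ω * osc e l ω)).symm
  have e2 : ∫ ω, u ω * (osc e l (sphMap R ω) - osc e l ω) ∂(surf d) =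
      ∫ ω, (u ω - u (sphMap R ω)) * osc e l (sphMap R ω) ∂(surf d) := by
    simp_rw [mul_sub, sub_mul]
    have i1 : Integrable (fun ω => u ω * osc e l (sphMap R ω)) (surf d) :=
      hint _ (hu.mul (hE.comp hRc))
    have i2 : Integrable (fun ω => u ω * osc e l ω) (surf d) := hint _ (hu.mul hE)
    have i3 : Integrable (fun ω => u (sphMap R ω) * osc e l (sphMap R ω)) (surf d) :=
      hint _ ((hu.comp hRc).mul (hE.comp hRc))
    rw [integral_sub i1 i2, integral_sub i1 i3, e1]
  rw [e2]
  have hL : ∀ ω : Sph d, 0 ≤ L := fun ω => (norm_nonneg _).trans (hh.norm_le ω)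
  have hi := integrable_inv_reg he hρ (e := e)
  have hi' : Integrable (fun ω => (reg e ρ (sphMap R ω))⁻¹) (surf d) :=
    hmp.integrable_comp_of_integrable hi
  have e3 : ∫ ω, (reg e ρ (sphMap R ω))⁻¹ ∂(surf d) = ∫ ω, (reg e ρ ω)⁻¹ ∂(surf d) :=
    hmp.integral_comp hemb (fun ω => (reg e ρ ω)⁻¹)
  calc _ ≤ ∫ ω, 12 * L * |t| * ((reg e ρ ω)⁻¹ + (reg e ρ (sphMap R ω))⁻¹) ∂(surf d) := by
        refine norm_integral_le_of_norm_le ((hi.add hi').const_mul _) (ae_of_all _ fun ω => ?_)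
        rw [norm_mul, norm_osc, mul_one]
        refine (norm_mul_wt_sub_le he hρ i j hh (sphMap R ω) ω).trans ?_
        have h0 := (inv_pos.2 (reg_pos he hρ ω)).le
        have h1 := (inv_pos.2 (reg_pos he hρ (sphMap R ω))).le
        refine mul_le_mul_of_nonneg_right (mul_le_mul_of_nonneg_left ?_ ?_) (by positivity)
        · rw [norm_sub_rev]; exact norm_rot_sub_le hij t ω
        · linarith [hL ω]
    _ = _ := by
        rw [integral_const_mul, integral_add hi hi', e3]; ring

/-- The function `i l · angMom · osc` is the derivative of `osc` along the rotation, so the integral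
is a limit of difference quotients, each bounded uniformly in `t` by the discrete integration by
parts. Working with quotients avoids differentiating `h`. -/
theorem norm_integral_mul_wt_angMom_osc_le {d : ℕ} (i j : Fin d) {e : Space d}
    (he : ‖e‖ = 1) {ρ : ℝ} (hρ : 0 < ρ) {l : ℝ} (hl : 0 < l) {L : ℝ} (hL : 0 ≤ L) {h : Sph d → ℂ}
    (hh : LipBound L h) :
    l * ‖∫ ω, h ω * wt e ρ i j ω * (angMom e i j ω * osc e l ω) ∂(surf d)‖ ≤
      24 * L * ∫ ω, (reg e ρ ω)⁻¹ ∂(surf d) := by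
  have hI : 0 ≤ ∫ ω, (reg e ρ ω)⁻¹ ∂(surf d) :=
    integral_nonneg fun ω => (inv_pos.2 (reg_pos he hρ ω)).le
  by_cases hij : i = j
  · subst hij
    have : ∀ ω, angMom e i i ω = 0 := fun ω => by unfold angMom; ring
    simp only [this]
    simp only [Complex.ofReal_zero, zero_mul, mul_zero, integral_zero, norm_zero]
    positivity
  set u : Sph d → ℂ := fun ω => h ω * wt e ρ i j ω with hudef
  have hu : Continuous u := hh.continuous.mul
    (Complex.continuous_ofReal.comp (continuous_wt he hρ i j))
  have hE := continuous_osc e l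
  have hui : Integrable (fun ω => l * ‖u ω‖) (surf d) :=
    ((hu.integrable_of_hasCompactSupport (HasCompactSupport.of_compactSpace u)).norm).const_mul l
  have hder : ∀ ω : Sph d, Tendsto (fun t : ℝ => u ω * (t⁻¹ •
      (osc e l (sphMap (rotIsometry i j hij t) ω) - osc e l ω))) (𝓝[≠] 0)
      (𝓝 (u ω * ((l : ℂ) * Complex.I * (angMom e i j ω * osc e l ω)))) := fun ω => by
    refine Tendsto.const_mul _ ?_
    have h1 := (((hasDerivAt_inner_rot hij e ω).const_mul l).ofReal_comp.mul_const
      Complex.I).cexp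
    have h2 := h1.tendsto_slope_zero
    have h0 : rotVec i j 0 (ω : Space d) = ω := by
      ext k; simp only [rotVec]; split_ifs <;> simp_all
    simp only [zero_add, h0] at h2
    convert h2 using 2
    · rfl
    · simp only [osc]
      push_cast; ring
  have hlim : Tendsto (fun t : ℝ => ∫ ω, u ω * (t⁻¹ •
      (osc e l (sphMap (rotIsometry i j hij t) ω) - osc e l ω)) ∂(surf d)) (𝓝[≠] 0)
      (𝓝 (∫ ω, u ω * ((l : ℂ) * Complex.I * (angMom e i j ω * osc e l ω)) ∂(surf d))) := by
    refine tendsto_integral_filter_of_dominated_convergence _ (Eventually.of_forall fun t => ?_)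
      ?_ hui (ae_of_all _ hder)
    · have h1 := continuous_sphMap (rotIsometry i j hij t)
      have h2 : Continuous fun ω => osc e l (sphMap (rotIsometry i j hij t) ω) :=
        hE.comp (continuous_subtype_val.comp h1)
      have h3 : Continuous fun ω : Sph d => osc e l ω := hE.comp continuous_subtype_val
      exact (hu.mul ((h2.sub h3).const_smul t⁻¹)).aestronglyMeasurable
    · filter_upwards [self_mem_nhdsWithin] with t ht
      have ht' : 0 < |t| := abs_pos.2 ht
      refine ae_of_all _ fun ω => ?_
      rw [norm_mul, norm_smul, mul_comm l]
      refine mul_le_mul_of_nonneg_left ?_ (norm_nonneg _)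
      rw [norm_inv, Real.norm_eq_abs, inv_mul_le_iff₀ ht', mul_comm]
      exact (norm_osc_sub_le he hl.le _ _).trans
        (mul_le_mul_of_nonneg_left (norm_rot_sub_le hij t ω) hl.le)
  have e1 : l * ‖∫ ω, u ω * (angMom e i j ω * osc e l ω) ∂(surf d)‖ =
      ‖∫ ω, u ω * ((l : ℂ) * Complex.I * (angMom e i j ω * osc e l ω)) ∂(surf d)‖ := by
    have : ∀ ω : Sph d, u ω * ((l : ℂ) * Complex.I * (angMom e i j ω * osc e l ω)) =
      ((l : ℂ) * Complex.I) * (u ω * (angMom e i j ω * osc e l ω)) := fun ω => by ring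
    simp_rw [this]
    rw [integral_const_mul, norm_mul, norm_mul, Complex.norm_I, mul_one, Complex.norm_real,
      Real.norm_eq_abs, abs_of_pos hl]
  rw [e1]
  refine le_of_tendsto hlim.norm ?_
  filter_upwards [self_mem_nhdsWithin] with t ht
  have ht' : 0 < |t| := abs_pos.2 ht
  have e2 : ∀ ω : Sph d, u ω * (t⁻¹ •
      (osc e l (sphMap (rotIsometry i j hij t) ω) - osc e l ω)) = t⁻¹ • (u ω *
      (osc e l (sphMap (rotIsometry i j hij t) ω) - osc e l ω)) := fun ω => by
    rw [mul_smul_comm]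
  simp_rw [e2]
  rw [integral_smul, norm_smul, norm_inv, Real.norm_eq_abs, inv_mul_le_iff₀ ht']
  exact norm_integral_mul_osc_rot_sub_le hij he hρ l hh t

/-- Decay of the Fourier transform of a Lipschitz density on the sphere. -/
theorem norm_integral_mul_osc_le (d : ℕ) [NeZero d] {β : ℝ} (hβ0 : 0 ≤ β) (hβ1 : β < 1)
    (hβ : β ≤ ((d : ℝ) - 1) / 2) :
    ∃ C : ℝ, 0 ≤ C ∧ ∀ e : Space d, ‖e‖ = 1 → ∀ l : ℝ, 0 < l → ∀ (L : ℝ) (h : Sph d → ℂ), 0 ≤ L →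
      LipBound L h → ‖∫ ω, h ω * osc e l ω ∂(surf d)‖ ≤ C * L * l ^ (-β) := by
  obtain ⟨C, hC, hJ⟩ := integral_inv_reg_le d hβ0 hβ1 hβ
  refine ⟨(1 + 12 * d ^ 2) * C, by positivity, fun e he l hl L h hL hh => ?_⟩
  -- The scale `ρ² = 1/l` balances the region near `±e` against the integrated-by-parts remainder:
  -- both contribute `l⁻¹ ∫ 1/reg = O(l^{-β})`.
  set ρ : ℝ := l ^ (-(1 / 2) : ℝ)
  have hρ : 0 < ρ := by positivity
  have hρ2 : ρ ^ 2 = l⁻¹ := by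
    rw [← Real.rpow_natCast, ← Real.rpow_mul hl.le]
    norm_num
    exact Real.rpow_neg_one l
  set J := ∫ ω, (reg e ρ ω)⁻¹ ∂(surf d)
  have hJρ : l⁻¹ * J ≤ C * l ^ (-β) := by
    have := hJ e he ρ hρ
    rw [hρ2, Real.inv_rpow hl.le, ← Real.rpow_neg hl.le] at this
    calc l⁻¹ * J ≤ l⁻¹ * (C * l ^ (-(β - 1))) := mul_le_mul_of_nonneg_left this (by positivity)
      _ = C * l ^ (-β) := by
        rw [← Real.rpow_neg_one l, mul_left_comm, ← Real.rpow_add hl]; congr 2; ring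
  have hcont := continuous_osc e l
  have hE : Continuous fun ω : Sph d => osc e l ω := hcont.comp continuous_subtype_val
  have hint : ∀ f : Sph d → ℂ, Continuous f → Integrable f (surf d) := fun f hf =>
    hf.integrable_of_hasCompactSupport (HasCompactSupport.of_compactSpace f)
  have hQc : Continuous fun ω : Sph d => (((reg e ρ ω)⁻¹ : ℝ) : ℂ) :=
    Complex.continuous_ofReal.comp ((continuous_reg e ρ).inv₀ fun ω => (reg_pos he hρ ω).ne')
  have hterm : ∀ i j, Integrable
      (fun ω => h ω * wt e ρ i j ω * (angMom e i j ω * osc e l ω)) (surf d) := fun i j =>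
    hint _ ((hh.continuous.mul (Complex.continuous_ofReal.comp (continuous_wt he hρ i j))).mul
      ((Complex.continuous_ofReal.comp (continuous_angMom e i j)).mul hE))
  -- Partition of unity `1 = ρ²/reg + (1 - ⟨e,ω⟩²)/reg`, with the second numerator written as half
  -- the sum of the squares of `angMom`. One factor `angMom` goes into the weight `wt`; the other is
  -- the derivative of the phase.
  have hdec : ∀ ω : Sph d, h ω * osc e l ω =
      (l⁻¹ : ℝ) * (h ω * osc e l ω * ((reg e ρ ω)⁻¹ : ℝ)) +
      (1 / 2 : ℂ) * ∑ i, ∑ j, h ω * wt e ρ i j ω * (angMom e i j ω * osc e l ω) := fun ω => by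
    have hQ := reg_pos he hρ ω
    have h1 : ∀ i j, h ω * wt e ρ i j ω * (angMom e i j ω * osc e l ω) =
        (h ω * osc e l ω * ((reg e ρ ω)⁻¹ : ℝ)) * ((angMom e i j ω ^ 2 : ℝ) : ℂ) := fun i j => by
      unfold wt; push_cast; ring
    have h2 : ∑ i, ∑ j, ((angMom e i j ω ^ 2 : ℝ) : ℂ) =
        ((2 * (1 - inner ℝ e (ω : Space d) ^ 2) : ℝ) : ℂ) := by
      rw [← sum_angMom_sq he]; push_cast; rfl
    simp_rw [h1, ← Finset.mul_sum, h2]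
    have h3 : ((l⁻¹ : ℝ) : ℂ) + ((1 - inner ℝ e (ω : Space d) ^ 2 : ℝ) : ℂ) =
        ((reg e ρ ω : ℝ) : ℂ) := by
      rw [← Complex.ofReal_add]; congr 1; unfold reg; rw [hρ2]; ring
    have h4 : ((reg e ρ ω : ℝ) : ℂ) * (((reg e ρ ω)⁻¹ : ℝ) : ℂ) = 1 := by
      rw [← Complex.ofReal_mul, mul_inv_cancel₀ hQ.ne', Complex.ofReal_one]
    rw [← h3] at h4
    have h5 : ((2 * (1 - inner ℝ e (ω : Space d) ^ 2) : ℝ) : ℂ) =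
      2 * ((1 - inner ℝ e (ω : Space d) ^ 2 : ℝ) : ℂ) := by push_cast; ring
    rw [h5]
    linear_combination (-(h ω * osc e l ω)) * h4
  have hfirst : Integrable (fun ω => h ω * osc e l ω * ((reg e ρ ω)⁻¹ : ℝ)) (surf d) :=
    hint _ ((hh.continuous.mul hE).mul hQc)
  rw [integral_congr_ae (ae_of_all _ hdec), integral_add (hfirst.const_mul _)
    ((integrable_finsetSum _ fun i _ => integrable_finsetSum _ fun j _ => hterm i j).const_mul _),
    integral_const_mul, integral_const_mul,
    integral_finsetSum _ fun i _ => integrable_finsetSum _ fun j _ => hterm i j]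
  simp_rw [fun i => integral_finsetSum (μ := surf d) Finset.univ fun j _ => hterm i j]
  have b1 : ‖((l⁻¹ : ℝ) : ℂ) * ∫ ω, h ω * osc e l ω * ((reg e ρ ω)⁻¹ : ℝ) ∂(surf d)‖ ≤
      L * (C * l ^ (-β)) := by
    rw [norm_mul, Complex.norm_real, Real.norm_eq_abs, abs_of_pos (inv_pos.2 hl)]
    have : ‖∫ ω, h ω * osc e l ω * ((reg e ρ ω)⁻¹ : ℝ) ∂(surf d)‖ ≤ L * J := by
      rw [← integral_const_mul]
      refine norm_integral_le_of_norm_le ((integrable_inv_reg he hρ).const_mul _)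
        (ae_of_all _ fun ω => ?_)
      have h0 := inv_pos.2 (reg_pos he hρ ω)
      rw [norm_mul, norm_mul, norm_osc, mul_one, Complex.norm_real, Real.norm_eq_abs,
        abs_of_pos h0]
      exact mul_le_mul_of_nonneg_right (hh.norm_le ω) h0.le
    calc _ ≤ l⁻¹ * (L * J) := mul_le_mul_of_nonneg_left this (by positivity)
      _ = L * (l⁻¹ * J) := by ring
      _ ≤ _ := mul_le_mul_of_nonneg_left hJρ hL
  have b2 : ∀ i j, ‖∫ ω, h ω * wt e ρ i j ω * (angMom e i j ω * osc e l ω) ∂(surf d)‖ ≤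
      24 * L * (C * l ^ (-β)) := fun i j => by
    have := norm_integral_mul_wt_angMom_osc_le i j he hρ hl hL hh
    rw [← le_inv_mul_iff₀ hl] at this
    refine this.trans ?_
    calc l⁻¹ * (24 * L * J) = 24 * L * (l⁻¹ * J) := by ring
      _ ≤ _ := mul_le_mul_of_nonneg_left hJρ (by positivity)
  have b3 : ‖∑ i, ∑ j, ∫ ω, h ω * wt e ρ i j ω * (angMom e i j ω * osc e l ω) ∂(surf d)‖ ≤
      d * (d * (24 * L * (C * l ^ (-β)))) := by
    refine (norm_sum_le_of_le _ fun i _ => norm_sum_le_of_le _ fun j _ => b2 i j).trans_eq ?_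
    simp
  refine (norm_add_le_of_le b1 (norm_mul_le_of_le (le_refl _) b3)).trans_eq ?_
  norm_num
  ring

/-! ### Fourier transforms on the sphere and Gaussian kernels -/

/-- The character `x ↦ e^{2πi⟨ξ, x⟩}`. -/
def ch {d : ℕ} (ξ x : Space d) : ℂ :=
  Complex.exp (((2 * Real.pi * inner ℝ ξ x : ℝ) : ℂ) * Complex.I)

theorem continuous_uncurry_ch (d : ℕ) : Continuous fun p : Space d × Space d => ch p.1 p.2 := by
  unfold ch; fun_prop

theorem Continuous.ch {X : Type*} [TopologicalSpace X] {d : ℕ} {a b : X → Space d}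
    (ha : Continuous a) (hb : Continuous b) : Continuous fun x => ch (a x) (b x) :=
  (continuous_uncurry_ch d).comp (ha.prodMk hb)

theorem norm_ch {d : ℕ} (ξ x : Space d) : ‖ch ξ x‖ = 1 := Complex.norm_exp_ofReal_mul_I _

theorem ch_add {d : ℕ} (ξ x y : Space d) : ch ξ (x + y) = ch ξ x * ch ξ y := by
  unfold ch; rw [← Complex.exp_add, inner_add_right]; push_cast; ring_nf

theorem ch_neg {d : ℕ} (ξ x : Space d) : ch ξ (-x) = (starRingEnd ℂ) (ch ξ x) := by
  unfold ch
  rw [← Complex.exp_conj, inner_neg_right, map_mul, Complex.conj_I, Complex.conj_ofReal]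
  push_cast; ring_nf

theorem ch_sum {d : ℕ} {ι : Type*} (s : Finset ι) (ξ : Space d) (x : ι → Space d) :
    ch ξ (∑ j ∈ s, x j) = ∏ j ∈ s, ch ξ (x j) := by
  unfold ch
  rw [← Complex.exp_sum, inner_sum, ← Finset.sum_mul, Finset.mul_sum]
  push_cast; rfl

/-- The Fourier transform of the density `f` on the sphere. -/
def fhat {d : ℕ} (f : Sph d → ℂ) (ξ : Space d) : ℂ := ∫ ν, f ν * ch ξ ν ∂(surf d)

theorem continuous_ch_sph {d : ℕ} (ξ : Space d) : Continuous fun ν : Sph d => ch ξ ν :=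
  Continuous.ch continuous_const continuous_subtype_val

theorem integrable_mul_ch {X : Type*} [TopologicalSpace X] [MeasurableSpace X]
    [OpensMeasurableSpace X] {μ : Measure X} {d : ℕ} {f : X → ℂ} (hf : Integrable f μ)
    {a b : X → Space d} (ha : Continuous a) (hb : Continuous b)  :
    Integrable (fun x => f x * ch (a x) (b x)) μ :=
  hf.mul_bdd (c := 1) (Continuous.ch ha hb).aestronglyMeasurable
    (ae_of_all _ fun _ => (norm_ch _ _).le)

theorem continuous_fhat {d : ℕ} {f : Sph d → ℂ} (hf : Integrable f (surf d)) :
    Continuous (fhat f) := by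
  refine continuous_of_dominated (bound := fun ν => ‖f ν‖)
    (fun ξ => hf.1.mul (continuous_ch_sph ξ).aestronglyMeasurable)
    (fun ξ => ae_of_all _ fun ν => by rw [norm_mul, norm_ch, mul_one]) hf.norm
    (ae_of_all _ fun ν => continuous_const.mul (Continuous.ch continuous_id continuous_const))

theorem norm_fhat_le {d : ℕ} (f : Sph d → ℂ) (ξ : Space d) :
    ‖fhat f ξ‖ ≤ ∫ ν, ‖f ν‖ ∂(surf d) := by
  refine (norm_integral_le_integral_norm _).trans_eq ?_
  simp_rw [norm_mul, norm_ch, mul_one]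

/-- The Gaussian weight `e^{-s|ξ|²}`. -/
def gw {d : ℕ} (s : ℝ) (ξ : Space d) : ℝ := Real.exp (-s * ‖ξ‖ ^ 2)

theorem gw_pos {d : ℕ} (s : ℝ) (ξ : Space d) : 0 < gw s ξ := Real.exp_pos _

theorem continuous_gw {d : ℕ} (s : ℝ) : Continuous (gw s : Space d → ℝ) := by
  unfold gw; fun_prop

/-- The Gaussian kernel, the Fourier transform of `gw`. -/
def gk {d : ℕ} (s : ℝ) (x : Space d) : ℝ :=
  (Real.pi / s) ^ ((d : ℝ) / 2) * Real.exp (-(Real.pi ^ 2 / s) * ‖x‖ ^ 2)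

theorem gk_nonneg {d : ℕ} {s : ℝ} (hs : 0 < s) (x : Space d) : 0 ≤ gk s x := by
  unfold gk; positivity

theorem continuous_gk {d : ℕ} (s : ℝ) : Continuous (gk s : Space d → ℝ) := by
  unfold gk; fun_prop

theorem gk_le {d : ℕ} {s : ℝ} (hs : 0 < s) (x : Space d) :
    gk s x ≤ (Real.pi / s) ^ ((d : ℝ) / 2) := by
  unfold gk
  refine mul_le_of_le_one_right (by positivity) ?_
  rw [Real.exp_le_one_iff, neg_mul, neg_nonpos]
  positivity

theorem gk_neg {d : ℕ} (s : ℝ) (x : Space d) : gk s (-x) = gk s x := by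
  unfold gk; rw [norm_neg]

theorem integrable_gw {d : ℕ} {s : ℝ} (hs : 0 < s) : Integrable (gw s : Space d → ℝ) := by
  have := (GaussianFourier.integrable_cexp_neg_mul_sq_norm_add (V := Space d)
    (b := (s : ℂ)) (by simpa using hs) 0 0).norm
  refine this.congr (ae_of_all _ fun y => ?_)
  simp [Complex.norm_exp, gw, ← Complex.ofReal_pow]

theorem ofReal_gk {d : ℕ} {s : ℝ} (hs : 0 < s) (x : Space d) :
    (gk s x : ℂ) = ∫ ξ : Space d, (gw s ξ : ℂ) * ch ξ x := by
  have h := GaussianFourier.integral_cexp_neg_mul_sq_norm_add (V := Space d)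
    (b := (s : ℂ)) (by simpa using hs) (2 * Real.pi * Complex.I) x
  have e1 : ∀ ξ : Space d, (gw s ξ : ℂ) * ch ξ x =
      Complex.exp (-s * ‖ξ‖ ^ 2 + 2 * Real.pi * Complex.I * (inner ℝ x ξ : ℝ)) := fun ξ => by
    unfold gw ch
    rw [Complex.ofReal_exp, ← Complex.exp_add, real_inner_comm]; push_cast; ring_nf
  simp_rw [e1]
  rw [h]
  unfold gk
  rw [Complex.ofReal_mul, Complex.ofReal_exp, Complex.ofReal_cpow (by positivity)]
  congr 1
  · simp
  · congr 1
    push_cast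
    have : (s : ℂ) ≠ 0 := by exact_mod_cast hs.ne'
    field_simp
    rw [Complex.I_sq]; ring

/-- The sphere has codimension one: the kernel has height `s^{-d/2}` and width `√s`, and the sphere
meets a ball of that width in measure `O(s^{(d-1)/2})`. -/
theorem integral_gk_le (d : ℕ) [NeZero d] :
    ∃ C : ℝ, 0 < C ∧ ∀ s : ℝ, 0 < s → ∀ x : Space d,
      ∫ ν : Sph d, gk s (x - (ν : Space d)) ∂(surf d) ≤ C * s ^ (-(1 / 2) : ℝ) := by
  obtain ⟨C, hC, h⟩ := integral_exp_neg_mul_norm_sub_sq_le d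
  refine ⟨(C + 1) * (Real.pi ^ ((d : ℝ) / 2) * (Real.pi ^ 2) ^ (-((d : ℝ) - 1) / 2)),
    by positivity, fun s hs x => ?_⟩
  have h1 := h (Real.pi ^ 2 / s) (by positivity) x
  unfold gk
  simp_rw [norm_sub_rev x]
  rw [integral_const_mul]
  calc _ ≤ (Real.pi / s) ^ ((d : ℝ) / 2) *
        ((C + 1) * (Real.pi ^ 2 / s) ^ (-((d : ℝ) - 1) / 2)) := by
        refine mul_le_mul_of_nonneg_left (h1.trans ?_) (by positivity)
        exact mul_le_mul_of_nonneg_right (by linarith) (by positivity)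
    _ = _ := by
        rw [div_eq_mul_inv, div_eq_mul_inv (Real.pi ^ 2), Real.mul_rpow (by positivity)
          (by positivity), Real.mul_rpow (by positivity) (by positivity), Real.inv_rpow hs.le,
          Real.inv_rpow hs.le, ← Real.rpow_neg hs.le, ← Real.rpow_neg hs.le]
        have : s ^ (-(1 / 2) : ℝ) =
            s ^ (-((d : ℝ) / 2)) * s ^ (-(-((d : ℝ) - 1) / 2)) := by
          rw [← Real.rpow_add hs]; congr 1; ring
        rw [this]; ring

theorem ofReal_norm_fhat_sq {d : ℕ} {g : Sph d → ℂ} (ξ : Space d) :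
    ((‖fhat g ξ‖ ^ 2 : ℝ) : ℂ) =
      ∫ p : Sph d × Sph d, g p.1 * (starRingEnd ℂ) (g p.2) * ch ξ ((p.1 : Space d) - (p.2 : Space d))
        ∂((surf d).prod (surf d)) := by
  have h1 : ((‖fhat g ξ‖ ^ 2 : ℝ) : ℂ) = fhat g ξ * (starRingEnd ℂ) (fhat g ξ) := by
    rw [Complex.mul_conj, Complex.normSq_eq_norm_sq]
  rw [h1]
  unfold fhat
  rw [← integral_conj, ← integral_prod_mul]
  refine integral_congr_ae (ae_of_all _ fun p => ?_)
  simp only [map_mul]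
  rw [sub_eq_add_neg, ch_add, ch_neg]; ring

/-! ### Fourier multipliers from the sphere to the sphere -/

/-- The Gaussian form of the Agmon–Hörmander bound. -/
theorem integral_gw_mul_norm_fhat_sq_le (d : ℕ) [NeZero d] :
    ∃ C : ℝ, 0 < C ∧ ∀ s : ℝ, 0 < s → ∀ g : Sph d → ℂ, MemLp g 2 (surf d) →
      ∫ ξ : Space d, gw s ξ * ‖fhat g ξ‖ ^ 2 ≤
        C * s ^ (-(1 / 2) : ℝ) * ∫ ν, ‖g ν‖ ^ 2 ∂(surf d) := by
  obtain ⟨C, hC, hgk⟩ := integral_gk_le d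
  refine ⟨C, hC, fun s hs g hg => ?_⟩
  have hgi : Integrable g (surf d) := hg.integrable one_le_two
  have hg2 : Integrable (fun ν => ‖g ν‖ ^ 2) (surf d) := (memLp_two_iff_integrable_sq_norm hg.1).1 hg
  have hgc : Integrable (fun ν => (starRingEnd ℂ) (g ν)) (surf d) :=
    (Complex.conjLIE.toContinuousLinearEquiv.toContinuousLinearMap).integrable_comp hgi
  have hgg : Integrable (fun p : Sph d × Sph d => g p.1 * (starRingEnd ℂ) (g p.2))
      ((surf d).prod (surf d)) := hgi.mul_prod hgc
  have hgw : Integrable (fun ξ : Space d => (gw s ξ : ℂ)) := (integrable_gw hs).ofReal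
  have hswap : Integrable (Function.uncurry fun (ξ : Space d) (p : Sph d × Sph d) =>
      (gw s ξ : ℂ) * (g p.1 * (starRingEnd ℂ) (g p.2)) * ch ξ ((p.1 : Space d) - (p.2 : Space d)))
      (volume.prod ((surf d).prod (surf d))) :=
    integrable_mul_ch (hgw.mul_prod hgg) (by fun_prop) (by fun_prop)
  -- Expanding the square turns the Gaussian energy of `ĝ` into a quadratic form on the sphere with
  -- kernel `gk`. Since this kernel is symmetric with bounded row integrals, Schur's test finishes
  -- the proof.
  have key : ((∫ ξ : Space d, gw s ξ * ‖fhat g ξ‖ ^ 2 : ℝ) : ℂ) =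
      ∫ p : Sph d × Sph d, g p.1 * (starRingEnd ℂ) (g p.2) *
        ((gk s ((p.1 : Space d) - (p.2 : Space d)) : ℝ) : ℂ) ∂((surf d).prod (surf d)) := by
    rw [← integral_complex_ofReal]
    have e1 : ∀ ξ : Space d, (((gw s ξ * ‖fhat g ξ‖ ^ 2 : ℝ)) : ℂ) = ∫ p : Sph d × Sph d,
        (gw s ξ : ℂ) * (g p.1 * (starRingEnd ℂ) (g p.2)) * ch ξ ((p.1 : Space d) - (p.2 : Space d))
        ∂((surf d).prod (surf d)) := fun ξ => by
      rw [Complex.ofReal_mul, ofReal_norm_fhat_sq, ← integral_const_mul]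
      simp_rw [mul_assoc]
    rw [integral_congr_ae (ae_of_all _ e1), integral_integral_swap hswap]
    refine integral_congr_ae (ae_of_all _ fun p => ?_)
    simp only
    rw [ofReal_gk hs, ← integral_const_mul]
    refine integral_congr_ae (ae_of_all _ fun ξ => ?_)
    simp only; ring
  have hk1 : Integrable (fun p : Sph d × Sph d => ‖g p.1‖ ^ 2 * gk s ((p.1 : Space d) - (p.2 : Space d)))
      ((surf d).prod (surf d)) := by
    have hc := continuous_gk (d := d) s
    refine (Integrable.comp_fst hg2 (surf d)).mul_bdd (c := (Real.pi / s) ^ ((d : ℝ) / 2))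
      (by fun_prop) (ae_of_all _ fun p => ?_)
    rw [Real.norm_eq_abs, abs_of_nonneg (gk_nonneg hs _)]; exact gk_le hs _
  have hk2 : Integrable (fun p : Sph d × Sph d => ‖g p.2‖ ^ 2 * gk s ((p.1 : Space d) - (p.2 : Space d)))
      ((surf d).prod (surf d)) := by
    refine hk1.swap.congr (ae_of_all _ fun p => ?_)
    simp only [Function.comp, Prod.fst_swap, Prod.snd_swap]
    rw [← neg_sub, gk_neg]
  have b1 : ∫ p : Sph d × Sph d, ‖g p.1‖ ^ 2 * gk s ((p.1 : Space d) - (p.2 : Space d))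
      ∂((surf d).prod (surf d)) ≤ C * s ^ (-(1 / 2) : ℝ) * ∫ ν, ‖g ν‖ ^ 2 ∂(surf d) := by
    rw [integral_prod _ hk1, ← integral_const_mul]
    refine integral_mono hk1.integral_prod_left (hg2.const_mul _) fun ν => ?_
    simp only
    rw [integral_const_mul, mul_comm]
    exact mul_le_mul_of_nonneg_right (hgk s hs ν) (by positivity)
  have b2 : ∫ p : Sph d × Sph d, ‖g p.2‖ ^ 2 * gk s ((p.1 : Space d) - (p.2 : Space d))
      ∂((surf d).prod (surf d)) ≤ C * s ^ (-(1 / 2) : ℝ) * ∫ ν, ‖g ν‖ ^ 2 ∂(surf d) := by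
    refine le_trans (le_of_eq ?_) b1
    rw [← integral_prod_swap]
    refine integral_congr_ae (ae_of_all _ fun p => ?_)
    simp only [Prod.fst_swap, Prod.snd_swap]
    rw [← neg_sub, gk_neg]
  calc ∫ ξ : Space d, gw s ξ * ‖fhat g ξ‖ ^ 2
      ≤ ‖((∫ ξ : Space d, gw s ξ * ‖fhat g ξ‖ ^ 2 : ℝ) : ℂ)‖ := by
        rw [Complex.norm_real]; exact le_abs_self _
    _ ≤ ∫ p : Sph d × Sph d, (1 / 2) * (‖g p.1‖ ^ 2 * gk s ((p.1 : Space d) - (p.2 : Space d)) +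
          ‖g p.2‖ ^ 2 * gk s ((p.1 : Space d) - (p.2 : Space d))) ∂((surf d).prod (surf d)) := by
        rw [key]
        refine norm_integral_le_of_norm_le ((hk1.add hk2).const_mul _) (ae_of_all _ fun p => ?_)
        rw [norm_mul, norm_mul, RCLike.norm_conj, Complex.norm_real, Real.norm_eq_abs,
          abs_of_nonneg (gk_nonneg hs _), ← add_mul, ← mul_assoc]
        refine mul_le_mul_of_nonneg_right ?_ (gk_nonneg hs _)
        nlinarith [sq_nonneg (‖g p.1‖ - ‖g p.2‖)]
    _ ≤ _ := by
        rw [integral_const_mul, integral_add hk1 hk2]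
        linarith

/-- The operator with Fourier multiplier `n`, from the sphere to the sphere. -/
def multOp {d : ℕ} (n : Space d → ℂ) (g : Sph d → ℂ) (ω : Sph d) : ℂ :=
  ∫ ξ : Space d, n ξ * fhat g ξ * ch ξ (-(ω : Space d))

theorem continuous_multOp {d : ℕ} {n : Space d → ℂ} {g : Sph d → ℂ}
    (hi : Integrable (fun ξ => n ξ * fhat g ξ)) : Continuous (multOp n g) := by
  refine continuous_of_dominated (bound := fun ξ => ‖n ξ * fhat g ξ‖)
    (fun ω => (integrable_mul_ch hi continuous_id continuous_const).1)
    (fun ω => ae_of_all _ fun ξ => by rw [norm_mul _ (ch _ _), norm_ch, mul_one]) hi.norm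
    (ae_of_all _ fun ξ => continuous_const.mul
      (Continuous.ch continuous_const continuous_subtype_val.neg))

/-- A `TT*`-type duality: with `u = multOp n g`, the squared norm of `u` is `∫ n ĝ conj(û)`, which
is controlled by the Gaussian energies of `ĝ` and `û`. Both are bounded by the Agmon–Hörmander
estimate. -/
theorem integral_norm_multOp_sq_le (d : ℕ) [NeZero d] :
    ∃ C : ℝ, 0 < C ∧ ∀ s : ℝ, 0 < s → ∀ A : ℝ, 0 < A → ∀ n : Space d → ℂ,
      AEStronglyMeasurable n → (∀ ξ, ‖n ξ‖ ≤ A * gw s ξ) → ∀ g : Sph d → ℂ, MemLp g 2 (surf d) →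
      ∫ ω, ‖multOp n g ω‖ ^ 2 ∂(surf d) ≤
        (C * A * s ^ (-(1 / 2) : ℝ)) ^ 2 * ∫ ν, ‖g ν‖ ^ 2 ∂(surf d) := by
  obtain ⟨C, hC, hAH⟩ := integral_gw_mul_norm_fhat_sq_le d
  refine ⟨C, hC, fun s hs A hA n hn hnA g hg => ?_⟩
  set K : ℝ := C * s ^ (-(1 / 2) : ℝ)
  have hK : 0 < K := by positivity
  have hgi : Integrable g (surf d) := hg.integrable one_le_two
  have hwi : ∀ f : Sph d → ℂ, Integrable f (surf d) →
      Integrable (fun ξ : Space d => gw s ξ * ‖fhat f ξ‖ ^ 2) := fun f hf => by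
    refine (integrable_gw hs).mul_bdd (c := (∫ ν, ‖f ν‖ ∂(surf d)) ^ 2)
      ((continuous_fhat hf).norm.pow 2).aestronglyMeasurable (ae_of_all _ fun ξ => ?_)
    rw [norm_pow, norm_norm]
    exact pow_le_pow_left₀ (norm_nonneg _) (norm_fhat_le f ξ) 2
  have hni : Integrable n := ((integrable_gw hs).const_mul A).mono' hn (ae_of_all _ hnA)
  have hi : Integrable (fun ξ => n ξ * fhat g ξ) :=
    hni.mul_bdd (continuous_fhat hgi).aestronglyMeasurable
      (ae_of_all _ fun ξ => norm_fhat_le g ξ)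
  set u := multOp n g
  have huc : Continuous u := continuous_multOp hi
  have hu : MemLp u 2 (surf d) := huc.memLp_of_hasCompactSupport (HasCompactSupport.of_compactSpace u)
  have hui : Integrable u (surf d) := hu.integrable one_le_two
  have huci : Integrable (fun ω => (starRingEnd ℂ) (u ω)) (surf d) :=
    (Complex.conjLIE.toContinuousLinearEquiv.toContinuousLinearMap).integrable_comp hui
  have hX : ((∫ ω, ‖u ω‖ ^ 2 ∂(surf d) : ℝ) : ℂ) =
      ∫ ξ : Space d, n ξ * fhat g ξ * (starRingEnd ℂ) (fhat u ξ) := by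
    rw [← integral_complex_ofReal]
    have e1 : ∀ ω, ((‖u ω‖ ^ 2 : ℝ) : ℂ) = ∫ ξ : Space d,
        (starRingEnd ℂ) (u ω) * (n ξ * fhat g ξ) * ch ξ (-(ω : Space d)) := fun ω => by
      have : ((‖u ω‖ ^ 2 : ℝ) : ℂ) = (starRingEnd ℂ) (u ω) * u ω := by
        rw [mul_comm, Complex.mul_conj, Complex.normSq_eq_norm_sq]
      have h2 : u ω = ∫ ξ : Space d, n ξ * fhat g ξ * ch ξ (-(ω : Space d)) := rfl
      simp_rw [this, mul_assoc ((starRingEnd ℂ) (u ω))]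
      rw [integral_const_mul, ← h2]
    have hswap : Integrable (Function.uncurry fun (ω : Sph d) (ξ : Space d) =>
        (starRingEnd ℂ) (u ω) * (n ξ * fhat g ξ) * ch ξ (-(ω : Space d)))
        ((surf d).prod volume) :=
      integrable_mul_ch (huci.mul_prod hi) (by fun_prop) (by fun_prop)
    rw [integral_congr_ae (ae_of_all _ e1), integral_integral_swap hswap]
    refine integral_congr_ae (ae_of_all _ fun ξ => ?_)
    have h3 : (starRingEnd ℂ) (fhat u ξ) =
        ∫ ω, (starRingEnd ℂ) (u ω) * ch ξ (-(ω : Space d)) ∂(surf d) := by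
      rw [fhat, ← integral_conj]
      simp only [map_mul, ch_neg]
    simp only
    rw [h3, ← integral_const_mul]
    refine integral_congr_ae (ae_of_all _ fun ω => ?_)
    simp only; ring
  set X := ∫ ω, ‖u ω‖ ^ 2 ∂(surf d)
  set G := ∫ ν, ‖g ν‖ ^ 2 ∂(surf d)
  -- AM–GM with weights chosen so that the `û` term, after the Agmon–Hörmander bound, is exactly `X
  -- / 2` and can be absorbed on the left.
  have h1 : X ≤ ∫ ξ : Space d, ((A ^ 2 * K / 2) * (gw s ξ * ‖fhat g ξ‖ ^ 2) +
      (1 / (2 * K)) * (gw s ξ * ‖fhat u ξ‖ ^ 2)) := by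
    have : X ≤ ‖((X : ℝ) : ℂ)‖ := by rw [Complex.norm_real]; exact le_abs_self _
    refine this.trans ?_
    rw [hX]
    refine norm_integral_le_of_norm_le (((hwi g hgi).const_mul _).add ((hwi u hui).const_mul _))
      (ae_of_all _ fun ξ => ?_)
    rw [norm_mul, norm_mul, RCLike.norm_conj]
    have hw := gw_pos s ξ
    calc ‖n ξ‖ * ‖fhat g ξ‖ * ‖fhat u ξ‖
        ≤ A * gw s ξ * ‖fhat g ξ‖ * ‖fhat u ξ‖ := by gcongr; exact hnA ξ
      _ = gw s ξ * (A * ‖fhat g ξ‖ * ‖fhat u ξ‖) := by ring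
      _ ≤ gw s ξ * (A ^ 2 * K / 2 * ‖fhat g ξ‖ ^ 2 + 1 / (2 * K) * ‖fhat u ξ‖ ^ 2) := by
        refine mul_le_mul_of_nonneg_left ?_ hw.le
        have : A ^ 2 * K / 2 * ‖fhat g ξ‖ ^ 2 + 1 / (2 * K) * ‖fhat u ξ‖ ^ 2 -
            A * ‖fhat g ξ‖ * ‖fhat u ξ‖ =
            1 / (2 * K) * (A * K * ‖fhat g ξ‖ - ‖fhat u ξ‖) ^ 2 := by
          field_simp; ring
        have h0 : 0 ≤ 1 / (2 * K) * (A * K * ‖fhat g ξ‖ - ‖fhat u ξ‖) ^ 2 := by positivity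
        linarith
      _ = _ := by ring
  rw [integral_add ((hwi g hgi).const_mul _) ((hwi u hui).const_mul _), integral_const_mul,
    integral_const_mul] at h1
  have h2 := mul_le_mul_of_nonneg_left (hAH s hs g hg) (by positivity : 0 ≤ A ^ 2 * K / 2)
  have h3 := mul_le_mul_of_nonneg_left (hAH s hs u hu) (by positivity : 0 ≤ 1 / (2 * K))
  have h4 : 1 / (2 * K) * (K * X) = X / 2 := by field_simp
  rw [h4] at h3
  calc X ≤ A ^ 2 * K ^ 2 * G := by nlinarith
    _ = _ := by simp only [K]; ring

/-! ### Gaussian regularisation of the convolution -/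

variable {d n : ℕ}

/-- The product measure on `(S^{d-1})^n`. -/
abbrev surfPi (d n : ℕ) : Measure (Fin n → Sph d) := Measure.pi fun _ : Fin n => surf d

/-- `∫ φ(ν_1 + ⋯ + ν_n - x) f_1(ν_1) ⋯ f_n(ν_n)`. -/
def smear (φ : Space d → ℂ) (f : Fin n → Sph d → ℂ) (x : Space d) : ℂ :=
  ∫ ν, φ (∑ j, (ν j : Space d) - x) * ∏ j, f j (ν j) ∂(surfPi d n)

/-- The density at `x` of the convolution regularised by the Gaussian kernel. -/
def heatConv (f : Fin n → Sph d → ℂ) (s : ℝ) (x : Space d) : ℂ :=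
  smear (fun y => (gk s y : ℂ)) f x

theorem integrable_prod_apply {f : Fin n → Sph d → ℂ} (hf : ∀ j, Integrable (f j) (surf d)) :
    Integrable (fun ν : Fin n → Sph d => ∏ j, f j (ν j)) (surfPi d n) :=
  Integrable.fintype_prod hf

theorem continuous_sum_coe : Continuous fun ν : Fin n → Sph d => ∑ j, (ν j : Space d) := by
  fun_prop

/-- The product of the `L¹` norms. -/
def massProd (f : Fin n → Sph d → ℂ) : ℝ := ∏ j, ∫ ν, ‖f j ν‖ ∂(surf d)

theorem integral_norm_prod_apply (f : Fin n → Sph d → ℂ) :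
    ∫ ν, ‖∏ j, f j (ν j)‖ ∂(surfPi d n) = massProd f := by
  simp_rw [norm_prod]
  exact integral_fintype_prod_eq_prod (𝕜 := ℝ) (fun j ν => ‖f j ν‖)

/-- Fubini: the Gaussian kernel is an integral of characters, and a character of a sum factors, so
the integral over the product of spheres splits into the `fhat (f j) ξ`. -/
theorem heatConv_eq {f : Fin n → Sph d → ℂ} (hf : ∀ j, Integrable (f j) (surf d)) {s : ℝ}
    (hs : 0 < s) (x : Space d) :
    heatConv f s x = ∫ ξ : Space d, (gw s ξ : ℂ) * ch ξ (-x) * ∏ j, fhat (f j) ξ := by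
  have hgw : Integrable (fun ξ : Space d => (gw s ξ : ℂ)) := (integrable_gw hs).ofReal
  have hswap : Integrable (Function.uncurry fun (ν : Fin n → Sph d) (ξ : Space d) =>
      (∏ j, f j (ν j)) * (gw s ξ : ℂ) * ch ξ (∑ j, (ν j : Space d) - x))
      ((surfPi d n).prod volume) :=
    integrable_mul_ch ((integrable_prod_apply hf).mul_prod hgw) (by fun_prop) (by fun_prop)
  have e1 : ∀ ν : Fin n → Sph d, (gk s (∑ j, (ν j : Space d) - x) : ℂ) * ∏ j, f j (ν j) =
      ∫ ξ : Space d, (∏ j, f j (ν j)) * (gw s ξ : ℂ) * ch ξ (∑ j, (ν j : Space d) - x) :=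
    fun ν => by
      rw [ofReal_gk hs, mul_comm, ← integral_const_mul]
      simp_rw [mul_assoc]
  unfold heatConv smear
  rw [integral_congr_ae (ae_of_all _ e1), integral_integral_swap hswap]
  refine integral_congr_ae (ae_of_all _ fun ξ => ?_)
  simp only
  have e2 : ∏ j, fhat (f j) ξ = ∫ ν, ∏ j, (f j (ν j) * ch ξ (ν j)) ∂(surfPi d n) :=
    (integral_fintype_prod_eq_prod (𝕜 := ℂ) (fun j (ν : Sph d) => f j ν * ch ξ ν)).symm
  rw [e2, ← integral_const_mul]
  refine integral_congr_ae (ae_of_all _ fun ν => ?_)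
  simp only [Finset.prod_mul_distrib, ← ch_sum, sub_eq_add_neg, ch_add]
  ring

theorem norm_smear_le {φ : Space d → ℂ} {f : Fin n → Sph d → ℂ}
    (hf : ∀ j, Integrable (f j) (surf d)) {B : ℝ} (hB : ∀ y, ‖φ y‖ ≤ B) (x : Space d) :
    ‖smear φ f x‖ ≤ B * massProd f := by
  rw [← integral_norm_prod_apply, ← integral_const_mul]
  refine norm_integral_le_of_norm_le ((integrable_prod_apply hf).norm.const_mul B)
    (ae_of_all _ fun ν => ?_)
  rw [norm_mul]
  exact mul_le_mul_of_nonneg_right (hB _) (norm_nonneg _)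

theorem integrable_smear_integrand {φ : Space d → ℂ} {f : Fin n → Sph d → ℂ}
    (hf : ∀ j, Integrable (f j) (surf d)) (hφ : Measurable φ) {B : ℝ} (hB : ∀ y, ‖φ y‖ ≤ B)
    (x : Space d) :
    Integrable (fun ν : Fin n → Sph d => φ (∑ j, (ν j : Space d) - x) * ∏ j, f j (ν j))
      (surfPi d n) :=
  (integrable_prod_apply hf).bdd_mul
    (hφ.comp (continuous_sum_coe.measurable.sub_const x)).aestronglyMeasurable
    (ae_of_all _ fun _ => hB _)

theorem norm_smear_sub_le {φ : Space d → ℂ} {f : Fin n → Sph d → ℂ}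
    (hf : ∀ j, Integrable (f j) (surf d)) (hφ : Measurable φ) {B K : ℝ} (hB : ∀ y, ‖φ y‖ ≤ B)
    (hK : ∀ y y', ‖φ y - φ y'‖ ≤ K * ‖y - y'‖) (x x' : Space d) :
    ‖smear φ f x - smear φ f x'‖ ≤ K * ‖x - x'‖ * massProd f := by
  unfold smear
  rw [← integral_sub (integrable_smear_integrand hf hφ hB x)
    (integrable_smear_integrand hf hφ hB x'), ← integral_norm_prod_apply, ← integral_const_mul]
  refine norm_integral_le_of_norm_le ((integrable_prod_apply hf).norm.const_mul _)
    (ae_of_all _ fun ν => ?_)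
  rw [← sub_mul, norm_mul]
  refine mul_le_mul_of_nonneg_right ((hK _ _).trans_eq ?_) (norm_nonneg _)
  rw [sub_sub_sub_cancel_left, norm_sub_rev]

theorem abs_exp_neg_sq_sub_le (a b : ℝ) :
    |Real.exp (-a ^ 2) - Real.exp (-b ^ 2)| ≤ |a - b| := by
  have hder : ∀ x : ℝ, HasDerivAt (fun x : ℝ => Real.exp (-x ^ 2))
      (Real.exp (-x ^ 2) * (-(2 * x))) x := fun x => by
    have := ((hasDerivAt_pow 2 x).neg).exp
    simpa using this
  have := Convex.norm_image_sub_le_of_norm_hasDerivWithin_le (s := Set.univ) (C := 1)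
    (fun x _ => (hder x).hasDerivWithinAt) (fun x _ => ?_) convex_univ (Set.mem_univ b)
    (Set.mem_univ a)
  · simpa using this
  · rw [norm_mul, Real.norm_eq_abs, Real.norm_eq_abs, Real.abs_exp, abs_neg, Real.exp_neg,
      inv_mul_le_iff₀ (Real.exp_pos _), mul_one]
    have h1 := Real.add_one_le_exp (x ^ 2)
    have h2 : |2 * x| ≤ x ^ 2 + 1 := abs_le.2 ⟨by nlinarith [sq_nonneg (x + 1)],
      by nlinarith [sq_nonneg (x - 1)]⟩
    exact h2.trans h1

/-- The profile `e^{-a²}` is `1`-Lipschitz, so rescaling by `π/√s` gives the constant. -/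
theorem abs_gk_sub_le {s : ℝ} (hs : 0 < s) (x y : Space d) :
    |gk s x - gk s y| ≤
      (Real.pi / s) ^ ((d : ℝ) / 2) * (Real.pi / √s) * ‖x - y‖ := by
  have hq : 0 < √s := Real.sqrt_pos.2 hs
  have e : ∀ z : Space d, Real.exp (-(Real.pi ^ 2 / s) * ‖z‖ ^ 2) =
      Real.exp (-(Real.pi / √s * ‖z‖) ^ 2) := fun z => by
    congr 1
    rw [mul_pow, div_pow, Real.sq_sqrt hs.le]; ring
  unfold gk
  rw [← mul_sub, abs_mul, abs_of_nonneg (by positivity), mul_assoc, e, e]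
  refine mul_le_mul_of_nonneg_left ((abs_exp_neg_sq_sub_le _ _).trans ?_) (by positivity)
  rw [← mul_sub, abs_mul, abs_of_pos (by positivity)]
  exact mul_le_mul_of_nonneg_left (abs_norm_sub_norm_le x y) (by positivity)

theorem integral_gk {s : ℝ} (hs : 0 < s) : ∫ x : Space d, gk s x = 1 := by
  unfold gk
  rw [integral_const_mul, GaussianFourier.integral_rexp_neg_mul_sq_norm (by positivity)]
  simp only [finrank_euclideanSpace, Fintype.card_fin]
  rw [← Real.mul_rpow (by positivity) (by positivity)]
  have : Real.pi / s * (Real.pi / (Real.pi ^ 2 / s)) = 1 := by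
    have := Real.pi_pos.ne'
    field_simp
  rw [this, Real.one_rpow]

theorem integrable_gk {s : ℝ} (hs : 0 < s) : Integrable (gk s : Space d → ℝ) := by
  by_contra h
  have := integral_gk (d := d) hs
  rw [integral_undef h] at this
  exact zero_ne_one this

/-! ### Dyadic differences in the Gaussian scale -/

/-- The difference of two consecutive dyadic Gaussian weights. -/
theorem abs_gw_sub_le {s : ℝ} (hs : 0 < s) (ξ : Space d) :
    |gw s ξ - gw (s / 2) ξ| ≤ s ^ (3 / 4 : ℝ) * ‖ξ‖ ^ (3 / 2 : ℝ) * gw (s / 4) ξ := by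
  set y := s * ‖ξ‖ ^ 2 with hy
  have hy0 : 0 ≤ y := by positivity
  have e1 : gw s ξ = Real.exp (-(y / 2)) * Real.exp (-(y / 2)) := by
    unfold gw; rw [← Real.exp_add]; congr 1; rw [hy]; ring
  have e2 : gw (s / 2) ξ = Real.exp (-(y / 2)) := by
    unfold gw; congr 1; rw [hy]; ring
  have e3 : gw (s / 4) ξ = Real.exp (-(y / 4)) := by
    unfold gw; congr 1; rw [hy]; ring
  have e4 : Real.exp (-(y / 2)) = Real.exp (-(y / 4)) * Real.exp (-(y / 4)) := by
    rw [← Real.exp_add]; congr 1; ring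
  have e5 : s ^ (3 / 4 : ℝ) * ‖ξ‖ ^ (3 / 2 : ℝ) = y ^ (3 / 4 : ℝ) := by
    rw [hy, Real.mul_rpow hs.le (by positivity), ← Real.rpow_natCast ‖ξ‖ 2,
      ← Real.rpow_mul (norm_nonneg _)]
    norm_num
  have h1 : 1 - Real.exp (-(y / 2)) ≤ y / 2 := by
    have := Real.add_one_le_exp (-(y / 2)); linarith
  have h2 : Real.exp (-(y / 2)) ≤ 1 := Real.exp_le_one_iff.2 (by linarith)
  have h3 : y * Real.exp (-(y / 4)) ≤ y ^ (3 / 4 : ℝ) := by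
    have a1 : y = y ^ (3 / 4 : ℝ) * y ^ (1 / 4 : ℝ) := by
      rw [← Real.rpow_add_of_nonneg hy0 (by norm_num) (by norm_num)]; norm_num
    have a2 : y ^ (1 / 4 : ℝ) ≤ Real.exp (y / 4) := by
      have : y ≤ Real.exp y := by have := Real.add_one_le_exp y; linarith
      calc y ^ (1 / 4 : ℝ) ≤ (Real.exp y) ^ (1 / 4 : ℝ) :=
            Real.rpow_le_rpow hy0 this (by norm_num)
        _ = Real.exp (y / 4) := by rw [← Real.exp_mul]; congr 1; ring
    have a3 : y ^ (1 / 4 : ℝ) * Real.exp (-(y / 4)) ≤ 1 := by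
      rw [Real.exp_neg, mul_inv_le_iff₀ (Real.exp_pos _), one_mul]; exact a2
    calc y * Real.exp (-(y / 4)) = y ^ (3 / 4 : ℝ) * (y ^ (1 / 4 : ℝ) * Real.exp (-(y / 4))) := by
          rw [← mul_assoc, ← a1]
      _ ≤ _ := mul_le_of_le_one_right (by positivity) a3
  have hp := Real.exp_pos (-(y / 4))
  have hp2 := Real.exp_pos (-(y / 2))
  rw [e1, e2, e3, e5, abs_sub_comm, abs_of_nonneg (by nlinarith)]
  calc Real.exp (-(y / 2)) - Real.exp (-(y / 2)) * Real.exp (-(y / 2))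
      = Real.exp (-(y / 2)) * (1 - Real.exp (-(y / 2))) := by ring
    _ ≤ Real.exp (-(y / 2)) * y := mul_le_mul_of_nonneg_left (by linarith) hp2.le
    _ = (y * Real.exp (-(y / 4))) * Real.exp (-(y / 4)) := by rw [e4]; ring
    _ ≤ _ := mul_le_mul_of_nonneg_right h3 hp.le

/-- All factors but `g` are absorbed in a multiplier applied to `g`. The decay of `∏ ĥ_j` cancels
the growth in `abs_gw_sub_le`, and `multOp` costs `s^{-1/2}`, leaving `s^{3/4 - 1/2}`. The
translation `z` enters as a unimodular phase, hence the uniformity in `z`. -/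
theorem integral_norm_heatConv_sub_sq_le (d : ℕ) [NeZero d] :
    ∃ C : ℝ, 0 < C ∧ ∀ (m : ℕ) (h : Fin m → Sph d → ℂ) (g : Sph d → ℂ) (H : ℝ),
      (∀ j, Integrable (h j) (surf d)) → MemLp g 2 (surf d) → 0 < H →
      (∀ ξ : Space d, ξ ≠ 0 → ‖∏ j, fhat (h j) ξ‖ ≤ H * ‖ξ‖ ^ (-(3 / 2) : ℝ)) →
      ∀ s : ℝ, 0 < s → ∀ z : Space d,
      ∫ ω : Sph d, ‖heatConv (Fin.snoc (α := fun _ => Sph d → ℂ) h g) s (ω + z) -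
          heatConv (Fin.snoc (α := fun _ => Sph d → ℂ) h g) (s / 2) (ω + z)‖ ^ 2 ∂(surf d) ≤
        (C * H * s ^ (1 / 4 : ℝ)) ^ 2 * ∫ ν, ‖g ν‖ ^ 2 ∂(surf d) := by
  obtain ⟨C, hC, hop⟩ := integral_norm_multOp_sq_le d
  refine ⟨2 * C, by positivity, fun m h g H hh hg hH hdec s hs z => ?_⟩
  have hgi : Integrable g (surf d) := hg.integrable one_le_two
  set f : Fin (m + 1) → Sph d → ℂ := Fin.snoc (α := fun _ => Sph d → ℂ) h g
  have hf : ∀ j, Integrable (f j) (surf d) := fun j => by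
    refine Fin.lastCases ?_ (fun j => ?_) j
    · simpa [f] using hgi
    · simpa [f] using hh j
  have hfprod : ∀ ξ, ∏ j, fhat (f j) ξ = (∏ j, fhat (h j) ξ) * fhat g ξ := fun ξ => by
    rw [Fin.prod_univ_castSucc]; simp [f]
  have hcont : Continuous fun ξ : Space d => ∏ j, fhat (f j) ξ :=
    continuous_finsetProd _ fun j _ => continuous_fhat (hf j)
  have hconth : Continuous fun ξ : Space d => ∏ j, fhat (h j) ξ :=
    continuous_finsetProd _ fun j _ => continuous_fhat (hh j)
  set N : Space d → ℂ := fun ξ =>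
    ((gw s ξ - gw (s / 2) ξ : ℝ) : ℂ) * ch ξ (-z) * ∏ j, fhat (h j) ξ
  have hNc : Continuous N := by
    have h1 : Continuous fun ξ : Space d => ch ξ (-z) :=
      Continuous.ch continuous_id continuous_const
    exact ((Complex.continuous_ofReal.comp ((continuous_gw s).sub (continuous_gw (s / 2)))).mul
      h1).mul hconth
  have hNb : ∀ ξ, ‖N ξ‖ ≤ H * s ^ (3 / 4 : ℝ) * gw (s / 4) ξ := fun ξ => by
    simp only [N]
    rw [norm_mul, norm_mul, norm_ch, mul_one, Complex.norm_real, Real.norm_eq_abs]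
    -- No decay is assumed at `ξ = 0`, but the two Gaussian weights agree there.
    rcases eq_or_ne ξ 0 with rfl | hξ
    · have : gw s (0 : Space d) - gw (s / 2) (0 : Space d) = 0 := by simp [gw]
      rw [this, abs_zero, zero_mul]
      have := gw_pos (s / 4) (0 : Space d)
      positivity
    · have hξ' : 0 < ‖ξ‖ := norm_pos_iff.2 hξ
      have hgp := gw_pos (s / 4) ξ
      calc _ ≤ (s ^ (3 / 4 : ℝ) * ‖ξ‖ ^ (3 / 2 : ℝ) * gw (s / 4) ξ) *
            (H * ‖ξ‖ ^ (-(3 / 2) : ℝ)) :=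
            mul_le_mul (abs_gw_sub_le hs ξ) (hdec ξ hξ) (norm_nonneg _) (by positivity)
        _ = H * s ^ (3 / 4 : ℝ) * gw (s / 4) ξ * (‖ξ‖ ^ (3 / 2 : ℝ) * ‖ξ‖ ^ (-(3 / 2) : ℝ)) := by
            ring
        _ = _ := by rw [← Real.rpow_add hξ']; norm_num
  have hint : ∀ s : ℝ, 0 < s → ∀ x : Space d, Integrable
      (fun ξ : Space d => (gw s ξ : ℂ) * ch ξ (-x) * ∏ j, fhat (f j) ξ) := fun s hs x => by
    refine (integrable_mul_ch (integrable_gw hs).ofReal continuous_id continuous_const).mul_bdd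
      (c := ∏ j, ∫ ν, ‖f j ν‖ ∂(surf d)) hcont.aestronglyMeasurable (ae_of_all _ fun ξ => ?_)
    rw [norm_prod]
    exact Finset.prod_le_prod (fun _ _ => norm_nonneg _) fun j _ => norm_fhat_le (f j) ξ
  have hrep : ∀ ω : Sph d, heatConv f s (ω + z) - heatConv f (s / 2) (ω + z) =
      multOp N g ω := fun ω => by
    rw [heatConv_eq hf hs, heatConv_eq hf (half_pos hs),
      ← integral_sub (hint s hs _) (hint _ (half_pos hs) _), multOp]
    refine integral_congr_ae (ae_of_all _ fun ξ => ?_)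
    simp only [N]
    rw [hfprod, neg_add, ch_add]
    push_cast; ring
  simp_rw [hrep]
  refine (hop (s / 4) (by positivity) (H * s ^ (3 / 4 : ℝ)) (by positivity) N
    hNc.aestronglyMeasurable hNb g hg).trans_eq ?_
  congr 2
  have : (s / 4) ^ (-(1 / 2) : ℝ) = 2 * s ^ (-(1 / 2) : ℝ) := by
    rw [Real.div_rpow hs.le (by norm_num), show (4 : ℝ) = 2 ^ (2 : ℝ) by norm_num,
      ← Real.rpow_mul (by norm_num)]
    norm_num
    ring
  rw [this]
  have h2 : s ^ (1 / 4 : ℝ) = s ^ (3 / 4 : ℝ) * s ^ (-(1 / 2) : ℝ) := by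
    rw [← Real.rpow_add hs]; norm_num
  rw [h2]; ring

/-! ### Geometric sequences in `L²` of the sphere -/

theorem eLpNorm_two_le_ofReal_iff {X : Type*} [MeasurableSpace X] {μ : Measure X} {f : X → ℂ}
    (hf : MemLp f 2 μ) {c : ℝ} (hc : 0 ≤ c) :
    eLpNorm f 2 μ ≤ ENNReal.ofReal c ↔ ∫ x, ‖f x‖ ^ 2 ∂μ ≤ c ^ 2 := by
  rw [hf.eLpNorm_eq_integral_rpow_norm two_ne_zero ENNReal.ofNat_ne_top,
    ENNReal.ofReal_le_ofReal_iff hc]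
  simp only [ENNReal.toReal_ofNat, Real.rpow_two]
  have h0 : 0 ≤ ∫ x, ‖f x‖ ^ 2 ∂μ := integral_nonneg fun x => by positivity
  rw [← Real.sqrt_le_left hc, Real.sqrt_eq_rpow]
  norm_num

/-- Fatou's lemma, with a bound that may vary along the sequence. -/
theorem eLpNorm_le_of_tendsto_of_le {X : Type*} [MeasurableSpace X] {μ : Measure X}
    {F : ℕ → X → ℂ} {G : X → ℂ} (hF : ∀ k, AEStronglyMeasurable (F k) μ)
    (hlim : ∀ x, Tendsto (fun k => F k x) atTop (𝓝 (G x))) {c : ℕ → ℝ≥0∞} {b : ℝ≥0∞}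
    (hle : ∀ᶠ k in atTop, eLpNorm (F k) 2 μ ≤ c k) (hc : Tendsto c atTop (𝓝 b)) :
    eLpNorm G 2 μ ≤ b :=
  (Lp.eLpNorm_lim_le_liminf_eLpNorm hF G (ae_of_all _ hlim)).trans
    ((liminf_le_liminf hle).trans_eq hc.liminf_eq)

theorem aestronglyMeasurable_comp_add {f : Space d → ℂ} (hf : Continuous f) (z : Space d) :
    AEStronglyMeasurable (fun ω : Sph d => f (ω + z)) (surf d) :=
  (hf.comp (continuous_subtype_val.add continuous_const)).aestronglyMeasurable

theorem eLpNorm_sub_le_of_geometric {T : ℕ → Space d → ℂ} (hT : ∀ k, Continuous (T k)) {D r : ℝ}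
    (hD : 0 ≤ D) (hr0 : 0 ≤ r) (hr1 : r < 1)
    (h : ∀ k z, eLpNorm (fun ω : Sph d => T k (ω + z) - T (k + 1) (ω + z)) 2 (surf d) ≤
      ENNReal.ofReal (D * r ^ k)) {k l : ℕ} (hkl : k ≤ l) (z : Space d) :
    eLpNorm (fun ω : Sph d => T k (ω + z) - T l (ω + z)) 2 (surf d) ≤
      ENNReal.ofReal (D * r ^ k / (1 - r)) := by
  have h1r : 0 < 1 - r := by linarith
  have hm := fun k => aestronglyMeasurable_comp_add (hT k) z
  have key : ∀ j, eLpNorm (fun ω : Sph d => T k (ω + z) - T (k + j) (ω + z)) 2 (surf d) ≤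
      ENNReal.ofReal (D * r ^ k * ((1 - r ^ j) / (1 - r))) := fun j => by
    induction j with
    | zero => simp
    | succ j ih =>
      have e : (fun ω : Sph d => T k (ω + z) - T (k + (j + 1)) (ω + z)) =
          (fun ω : Sph d => T k (ω + z) - T (k + j) (ω + z)) +
          fun ω : Sph d => T (k + j) (ω + z) - T (k + j + 1) (ω + z) := by
        ext ω; simp [add_assoc]
      rw [e]
      refine (eLpNorm_add_le ((hm _).sub (hm _)) ((hm _).sub (hm _)) one_le_two).trans
        ((add_le_add ih (h _ z)).trans_eq ?_)
      have h0 : 0 ≤ (1 - r ^ j) / (1 - r) :=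
        div_nonneg (sub_nonneg.2 (pow_le_one₀ hr0 hr1.le)) h1r.le
      rw [← ENNReal.ofReal_add (by positivity) (by positivity)]
      congr 1
      field_simp
      ring
  obtain ⟨j, rfl⟩ := Nat.exists_eq_add_of_le hkl
  refine (key j).trans (ENNReal.ofReal_le_ofReal ?_)
  rw [mul_div_assoc']
  refine div_le_div_of_nonneg_right ?_ h1r.le
  exact mul_le_of_le_one_right (by positivity) (by linarith [pow_nonneg hr0 j])

theorem memLp_two_of_continuous {f : Sph d → ℂ} (hf : Continuous f) : MemLp f 2 (surf d) :=
  hf.memLp_of_hasCompactSupport (HasCompactSupport.of_compactSpace f)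

theorem exists_limit_of_geometric {T : ℕ → Space d → ℂ} (hT : ∀ k, Continuous (T k)) {D r : ℝ}
    (hD : 0 ≤ D) (hr0 : 0 < r) (hr1 : r < 1)
    (h : ∀ k z, eLpNorm (fun ω : Sph d => T k (ω + z) - T (k + 1) (ω + z)) 2 (surf d) ≤
      ENNReal.ofReal (D * r ^ k)) :
    ∃ u : Sph d → ℂ, MemLp u 2 (surf d) ∧ ∀ k,
      eLpNorm (fun ω : Sph d => T k ω - u ω) 2 (surf d) ≤
        ENNReal.ofReal (D * r ^ k / (1 - r)) := by
  have h1r : 0 < 1 - r := by linarith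
  have hmem : ∀ k, MemLp (fun ω : Sph d => T k ω) 2 (surf d) := fun k =>
    memLp_two_of_continuous ((hT k).comp continuous_subtype_val)
  have htele : ∀ {k l : ℕ}, k ≤ l →
      eLpNorm (fun ω : Sph d => T k ω - T l ω) 2 (surf d) ≤
      ENNReal.ofReal (D * r ^ k / (1 - r)) := fun hkl => by
    simpa using eLpNorm_sub_le_of_geometric hT hD hr0.le hr1 h hkl 0
  -- Twice the geometric tail, by comparing both terms with the `N`-th; the extra `1` makes the
  -- Cauchy bound strict, also when `D = 0`.
  set E : ℝ := 2 * D / (1 - r) + 1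
  have hE : 0 < E := by positivity
  have hB : ∑' i : ℕ, ENNReal.ofReal (E * r ^ i) ≠ ∞ := by
    rw [← ENNReal.ofReal_tsum_of_nonneg (fun i => by positivity)
      ((summable_geometric_of_lt_one hr0.le hr1).mul_left E)]
    exact ENNReal.ofReal_ne_top
  obtain ⟨u, hu, hlim⟩ := Lp.cauchy_complete_eLpNorm (p := 2) one_le_two hmem hB
    (fun N n m hn hm => by
      have e : (fun ω : Sph d => T n ω) - (fun ω : Sph d => T m ω) =
          (fun ω : Sph d => T N ω - T m ω) - fun ω : Sph d => T N ω - T n ω := by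
        ext ω; simp
      rw [e]
      refine ((eLpNorm_sub_le ((hmem N).sub (hmem m)).1 ((hmem N).sub (hmem n)).1
        one_le_two).trans (add_le_add (htele hm) (htele hn))).trans_lt ?_
      rw [← ENNReal.ofReal_add (by positivity) (by positivity),
        ENNReal.ofReal_lt_ofReal_iff (by positivity)]
      have : 0 < r ^ N := by positivity
      have e2 : E * r ^ N = D * r ^ N / (1 - r) + D * r ^ N / (1 - r) + r ^ N := by
        simp only [E]; ring
      linarith)
  refine ⟨u, hu, fun k => ?_⟩
  have hle : ∀ᶠ l in atTop, eLpNorm (fun ω : Sph d => T k ω - u ω) 2 (surf d) ≤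
      ENNReal.ofReal (D * r ^ k / (1 - r)) +
        eLpNorm ((fun ω : Sph d => T l ω) - u) 2 (surf d) := by
    filter_upwards [eventually_ge_atTop k] with l hl
    have e : (fun ω : Sph d => T k ω - u ω) =
        (fun ω : Sph d => T k ω - T l ω) + ((fun ω : Sph d => T l ω) - u) := by
      ext ω; simp
    rw [e]
    exact (eLpNorm_add_le ((hmem k).sub (hmem l)).1 ((hmem l).sub hu).1 one_le_two).trans
      (add_le_add_left (htele hl) _)
  have := ge_of_tendsto (hlim.const_add (ENNReal.ofReal (D * r ^ k / (1 - r)))) hle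
  simpa using this

/-- Hölder continuity in `L²` along an isometry of a limit of a geometric sequence. -/
theorem eLpNorm_comp_sphMap_sub_le {T : ℕ → Space d → ℂ} (hT : ∀ k, Continuous (T k))
    {D A r Λ : ℝ} (hD : 0 ≤ D) (hA : 0 ≤ A) (hr0 : 0 < r) (hr1 : r < 1) (hΛ : 1 < Λ)
    (hlip : ∀ k x y, ‖T k x - T k y‖ ≤ A * Λ ^ k * ‖x - y‖) {u : Sph d → ℂ}
    (hu : MemLp u 2 (surf d))
    (h : ∀ k, eLpNorm (fun ω : Sph d => T k ω - u ω) 2 (surf d) ≤ ENNReal.ofReal (D * r ^ k))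
    (e : Space d ≃ₗᵢ[ℝ] Space d) {δ : ℝ} (hδ0 : 0 < δ) (hδ1 : δ ≤ 1)
    (he : ∀ ω : Sph d, ‖(sphMap e ω : Space d) - ω‖ ≤ δ) :
    eLpNorm (fun ω => u (sphMap e ω) - u ω) 2 (surf d) ≤
      ENNReal.ofReal ((2 * D + A * ((surf d).real Set.univ) ^ (1 / 2 : ℝ)) / r *
        δ ^ Real.logb (r / Λ) r) := by
  have hΛ0 : 0 < Λ := by linarith
  set θ := r / Λ
  have hθ0 : 0 < θ := by positivity
  have hθ1 : θ < 1 := by rw [div_lt_one hΛ0]; linarith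
  -- The level `k` with `(r/Λ)^{k+1} < δ ≤ (r/Λ)^k` balances the approximation error `r^k` with the
  -- Lipschitz variation `Λ^k δ`. Rewriting `r^k` through `r = θ^α` turns it into a power of `δ`.
  obtain ⟨k, hk1, hk2⟩ := exists_nat_pow_near_of_lt_one hδ0 hδ1 hθ0 hθ1
  set α := Real.logb θ r
  have hα : θ ^ α = r := Real.rpow_logb hθ0 hθ1.ne hr0
  have hα0 : 0 ≤ α := Real.logb_nonneg_of_base_lt_one hθ0 hθ1 hr0 hr1.le
  have hrk : r ^ k ≤ δ ^ α / r := by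
    rw [le_div_iff₀ hr0, ← pow_succ]
    calc r ^ (k + 1) = (θ ^ (k + 1)) ^ α := by
          rw [← Real.rpow_natCast, ← Real.rpow_natCast, ← Real.rpow_mul hθ0.le, mul_comm,
            Real.rpow_mul hθ0.le, hα]
      _ ≤ δ ^ α := Real.rpow_le_rpow (by positivity) hk1.le hα0
  have hΛk : Λ ^ k * δ ≤ r ^ k := by
    calc Λ ^ k * δ ≤ Λ ^ k * θ ^ k := by gcongr
      _ = r ^ k := by rw [← mul_pow]; congr 1; simp only [θ]; field_simp
  set S := ((surf d).real Set.univ) ^ (1 / 2 : ℝ)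
  have hS : 0 ≤ S := by positivity
  have hmem : MemLp (fun ω : Sph d => T k ω) 2 (surf d) :=
    memLp_two_of_continuous ((hT k).comp continuous_subtype_val)
  have hmp := measurePreserving_sphMap e
  have hd : MemLp (fun ω : Sph d => T k ω - u ω) 2 (surf d) := hmem.sub hu
  have hd' : MemLp (fun ω : Sph d => T k (sphMap e ω) - u (sphMap e ω)) 2 (surf d) :=
    hd.comp_measurePreserving hmp
  have hc : MemLp (fun ω : Sph d => T k (sphMap e ω) - T k ω) 2 (surf d) :=
    (hmem.comp_measurePreserving hmp).sub hmem
  have b1 : eLpNorm (fun ω : Sph d => T k (sphMap e ω) - u (sphMap e ω)) 2 (surf d) ≤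
      ENNReal.ofReal (D * r ^ k) := by
    exact (eLpNorm_comp_measurePreserving hd.1 hmp).trans_le (h k)
  have b2 : eLpNorm (fun ω : Sph d => T k (sphMap e ω) - T k ω) 2 (surf d) ≤
      ENNReal.ofReal (A * r ^ k * S) := by
    have hb : ∀ᵐ ω ∂(surf d), ‖T k (sphMap e ω) - T k ω‖ ≤ A * r ^ k := by
      refine ae_of_all _ fun ω => (hlip k _ _).trans ?_
      calc A * Λ ^ k * ‖(sphMap e ω : Space d) - ω‖ ≤ A * Λ ^ k * δ := by
            gcongr; exact he ω
        _ = A * (Λ ^ k * δ) := by ring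
        _ ≤ A * r ^ k := by gcongr
    refine (eLpNorm_le_of_ae_bound hb).trans_eq ?_
    rw [mul_comm, ENNReal.ofReal_mul (p := A * r ^ k) (by positivity)]
    congr 1
    simp only [S]
    rw [← ENNReal.ofReal_rpow_of_nonneg measureReal_nonneg (by norm_num), ofReal_measureReal]
    norm_num
  have e1 : (fun ω => u (sphMap e ω) - u ω) =
      ((fun ω : Sph d => T k (sphMap e ω) - T k ω) -
        fun ω : Sph d => T k (sphMap e ω) - u (sphMap e ω)) +
      fun ω : Sph d => T k ω - u ω := by
    ext ω; simp
  rw [e1]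
  refine (eLpNorm_add_le (hc.sub hd').1 hd.1 one_le_two).trans
    ((add_le_add ((eLpNorm_sub_le hc.1 hd'.1 one_le_two).trans (add_le_add b2 b1)) (h k)).trans ?_)
  rw [← ENNReal.ofReal_add (by positivity) (by positivity),
    ← ENNReal.ofReal_add (by positivity) (by positivity)]
  refine ENNReal.ofReal_le_ofReal ?_
  calc A * r ^ k * S + D * r ^ k + D * r ^ k = (2 * D + A * S) * r ^ k := by ring
    _ ≤ (2 * D + A * S) * (δ ^ α / r) := by gcongr
    _ = _ := by ring

/-! ### From Gaussian averages to ball averages -/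

/-- Cauchy–Schwarz for the weight `w`, obtained by optimising over `c` the integrated inequality
`2c|F| ≤ c² + |F|²`. -/
theorem norm_integral_mul_sq_le {X : Type*} [MeasurableSpace X] {μ : Measure X} {w : X → ℝ}
    {F : X → ℂ} (hw0 : ∀ x, 0 ≤ w x) (hw : Integrable w μ)
    (hF : Integrable (fun x => w x * ‖F x‖ ^ 2) μ) :
    ‖∫ x, (w x : ℂ) * F x ∂μ‖ ^ 2 ≤ (∫ x, w x ∂μ) * ∫ x, w x * ‖F x‖ ^ 2 ∂μ := by
  set a := ‖∫ x, (w x : ℂ) * F x ∂μ‖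
  set V := ∫ x, w x ∂μ
  set I := ∫ x, w x * ‖F x‖ ^ 2 ∂μ
  have ha : 0 ≤ a := norm_nonneg _
  have hV : 0 ≤ V := integral_nonneg hw0
  have hI : 0 ≤ I := integral_nonneg fun x => mul_nonneg (hw0 x) (by positivity)
  have key : ∀ c : ℝ, 0 ≤ c → 2 * c * a ≤ c ^ 2 * V + I := fun c hc => by
    have : ‖∫ x, (w x : ℂ) * F x ∂μ‖ ≤ ∫ x, ‖(w x : ℂ) * F x‖ ∂μ := norm_integral_le_integral_norm _
    rw [← integral_const_mul, ← integral_add (hw.const_mul _) hF]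
    calc 2 * c * a ≤ 2 * c * ∫ x, ‖(w x : ℂ) * F x‖ ∂μ := by gcongr
      _ = ∫ x, 2 * c * ‖(w x : ℂ) * F x‖ ∂μ := (integral_const_mul _ _).symm
      _ ≤ _ := by
        refine integral_mono_of_nonneg (ae_of_all _ fun x => by positivity)
          ((hw.const_mul _).add hF) (ae_of_all _ fun x => ?_)
        simp only
        rw [norm_mul, Complex.norm_real, Real.norm_eq_abs, abs_of_nonneg (hw0 x)]
        nlinarith [mul_nonneg (hw0 x) (sq_nonneg (c - ‖F x‖))]
  -- If the weight has mass zero, the optimal `c` is infinite; a large finite `c` already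
  -- contradicts a nonzero integral.
  rcases hV.eq_or_lt with hV0 | hV0
  · by_contra hcon
    have ha0 : 0 < a := by
      rcases ha.eq_or_lt with h | h
      · rw [← h, ← hV0] at hcon; simp at hcon
      · exact h
    have := key ((I + 1) / a) (by positivity)
    rw [← hV0] at this
    have e : 2 * ((I + 1) / a) * a = 2 * (I + 1) := by field_simp
    rw [e] at this
    linarith
  · have := key (a / V) (by positivity)
    have e1 : 2 * (a / V) * a = 2 * (a ^ 2 / V) := by ring
    have e2 : (a / V) ^ 2 * V = a ^ 2 / V := by field_simp
    rw [e1, e2] at this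
    have h3 : a ^ 2 / V ≤ I := by linarith
    rw [div_le_iff₀ hV0] at h3
    linarith

/-- Minkowski's inequality for averages of translates. -/
theorem eLpNorm_integral_mul_sub_le {T : Space d → ℂ} (hT : Continuous T) {B : ℝ}
    (hB : ∀ x, ‖T x‖ ≤ B) {φ : Space d → ℝ} (hφ0 : ∀ z, 0 ≤ φ z) (hφc : Continuous φ)
    (hφ : Integrable φ) {ε : ℝ} (hε : 0 ≤ ε)
    (h : ∀ z, φ z ≠ 0 → eLpNorm (fun ω : Sph d => T (ω + z) - T ω) 2 (surf d) ≤
      ENNReal.ofReal ε) :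
    eLpNorm (fun ω : Sph d => (∫ z, (φ z : ℂ) * T (ω + z)) - ((∫ z, φ z : ℝ) : ℂ) * T ω) 2 (surf d)
      ≤ ENNReal.ofReal ((∫ z, φ z) * ε) := by
  set V := ∫ z, φ z
  have hV : 0 ≤ V := integral_nonneg hφ0
  set F : Sph d → Space d → ℂ := fun ω z => T (ω + z) - T ω
  have hFc : Continuous fun p : Sph d × Space d => F p.1 p.2 := by fun_prop
  have hFb : ∀ ω z, ‖F ω z‖ ≤ 2 * B := fun ω z =>
    (norm_sub_le _ _).trans (by linarith [hB (ω + z), hB ω])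
  have hφC : Integrable (fun z => (φ z : ℂ)) := hφ.ofReal
  have hTi : ∀ ω : Sph d, Integrable (fun z => (φ z : ℂ) * T (ω + z)) := fun ω =>
    hφC.mul_bdd (c := B) (by fun_prop) (ae_of_all _ fun z => hB _)
  have e : ∀ ω : Sph d, (∫ z, (φ z : ℂ) * T (ω + z)) - ((V : ℝ) : ℂ) * T ω =
      ∫ z, (φ z : ℂ) * F ω z := fun ω => by
    simp only [F, mul_sub]
    rw [integral_sub (hTi ω) (hφC.mul_const _), integral_mul_const, integral_complex_ofReal]
  simp_rw [e]
  have hXc : Continuous fun ω : Sph d => ∫ z, (φ z : ℂ) * F ω z := by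
    refine continuous_of_dominated (bound := fun z => φ z * (2 * B))
      (fun ω => by fun_prop) (fun ω => ae_of_all _ fun z => ?_) (hφ.mul_const _)
      (ae_of_all _ fun z => by fun_prop)
    rw [norm_mul, Complex.norm_real, Real.norm_eq_abs, abs_of_nonneg (hφ0 z)]
    exact mul_le_mul_of_nonneg_left (hFb ω z) (hφ0 z)
  rw [eLpNorm_two_le_ofReal_iff (memLp_two_of_continuous hXc) (mul_nonneg hV hε)]
  have hprod : Integrable (fun p : Sph d × Space d => φ p.2 * ‖F p.1 p.2‖ ^ 2)
      ((surf d).prod volume) := by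
    refine (Integrable.comp_snd hφ (surf d)).mul_bdd (c := (2 * B) ^ 2)
      (by fun_prop) (ae_of_all _ fun p => ?_)
    rw [norm_pow, norm_norm]
    exact pow_le_pow_left₀ (norm_nonneg _) (hFb _ _) 2
  have hsec : ∀ ω, Integrable (fun z => φ z * ‖F ω z‖ ^ 2) := fun ω => by
    refine hφ.mul_bdd (c := (2 * B) ^ 2) (by fun_prop) (ae_of_all _ fun z => ?_)
    rw [norm_pow, norm_norm]
    exact pow_le_pow_left₀ (norm_nonneg _) (hFb _ _) 2
  calc ∫ ω : Sph d, ‖∫ z, (φ z : ℂ) * F ω z‖ ^ 2 ∂(surf d)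
      ≤ ∫ ω : Sph d, V * (∫ z, φ z * ‖F ω z‖ ^ 2) ∂(surf d) :=
        integral_mono_of_nonneg (ae_of_all _ fun ω => by positivity)
          (hprod.integral_prod_left.const_mul V)
          (ae_of_all _ fun ω => norm_integral_mul_sq_le hφ0 hφ (hsec ω))
    _ = V * ∫ z, ∫ ω : Sph d, φ z * ‖F ω z‖ ^ 2 ∂(surf d) := by
        rw [integral_const_mul, integral_integral_swap hprod]
    _ ≤ V * ∫ z, φ z * ε ^ 2 := by
        refine mul_le_mul_of_nonneg_left ?_ hV
        refine integral_mono hprod.integral_prod_right (hφ.mul_const _) fun z => ?_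
        simp only
        rw [integral_const_mul]
        by_cases hz : φ z = 0
        · simp [hz]
        · refine mul_le_mul_of_nonneg_left ?_ (hφ0 z)
          have hc : Continuous fun ω : Sph d => F ω z := by fun_prop
          exact (eLpNorm_two_le_ofReal_iff (memLp_two_of_continuous hc) hε).1 (h z hz)
    _ = (V * ε) ^ 2 := by rw [integral_mul_const]; ring

/-- Averaging translates of the regularisation is the same as smearing by the regularised test
function; this links `heatConv` to averages of the measure itself. -/
theorem integral_mul_heatConv {f : Fin n → Sph d → ℂ} (hf : ∀ j, Integrable (f j) (surf d))
    {φ : Space d → ℝ} (hφ : Integrable φ) {s : ℝ} (hs : 0 < s) (x : Space d) :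
    ∫ z, (φ z : ℂ) * heatConv f s (x + z) =
      smear (fun y => ∫ z, (gk s (y - z) : ℂ) * (φ z : ℂ)) f x := by
  have hgc := continuous_gk (d := d) s
  have hswap : Integrable (Function.uncurry fun (z : Space d) (ν : Fin n → Sph d) =>
      (φ z : ℂ) * (∏ j, f j (ν j)) * (gk s (∑ j, (ν j : Space d) - x - z) : ℂ))
      (volume.prod (surfPi d n)) := by
    refine (hφ.ofReal.mul_prod (integrable_prod_apply hf)).mul_bdd
      (c := (Real.pi / s) ^ ((d : ℝ) / 2)) (by fun_prop) (ae_of_all _ fun p => ?_)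
    rw [Complex.norm_real, Real.norm_eq_abs, abs_of_nonneg (gk_nonneg hs _)]
    exact gk_le hs _
  unfold heatConv smear
  have e1 : ∀ z : Space d, (φ z : ℂ) * ∫ ν, (gk s (∑ j, (ν j : Space d) - (x + z)) : ℂ) *
      ∏ j, f j (ν j) ∂(surfPi d n) = ∫ ν, (φ z : ℂ) * (∏ j, f j (ν j)) *
        (gk s (∑ j, (ν j : Space d) - x - z) : ℂ) ∂(surfPi d n) := fun z => by
    rw [← integral_const_mul]
    refine integral_congr_ae (ae_of_all _ fun ν => ?_)
    simp only [sub_sub]; ring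
  rw [integral_congr_ae (ae_of_all _ e1), integral_integral_swap hswap]
  refine integral_congr_ae (ae_of_all _ fun ν => ?_)
  simp only
  rw [← integral_mul_const]
  refine integral_congr_ae (ae_of_all _ fun z => ?_)
  simp only; ring

theorem tendsto_integral_gk_mul {φ : Space d → ℝ} (hφc : Continuous φ) (hφ : Integrable φ)
    {s : ℕ → ℝ} (hs0 : ∀ k, 0 < s k) (hs : Tendsto s atTop (𝓝 0)) (y : Space d) :
    Tendsto (fun k => ∫ z, (gk (s k) (y - z) : ℂ) * (φ z : ℂ)) atTop (𝓝 (φ y : ℂ)) := by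
  have h1 := Real.tendsto_integral_gaussian_smul' (f := fun z => (φ z : ℂ)) hφ.ofReal (v := y)
    (Complex.continuous_ofReal.comp hφc).continuousAt
  have h2 : Tendsto (fun k => (s k)⁻¹) atTop atTop :=
    (tendsto_inv_nhdsGT_zero).comp (tendsto_nhdsWithin_iff.2
      ⟨hs, Eventually.of_forall fun k => hs0 k⟩)
  refine (h1.comp h2).congr fun k => ?_
  simp only [Function.comp]
  refine integral_congr_ae (ae_of_all _ fun z => ?_)
  simp only [smul_eq_mul]
  congr 1
  unfold gk
  rw [Complex.ofReal_mul, Complex.ofReal_exp, Complex.ofReal_cpow (by have := hs0 k; positivity)]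
  simp [div_eq_mul_inv]

theorem norm_integral_gk_mul_le {φ : Space d → ℝ} {B : ℝ} (hφB : ∀ z, |φ z| ≤ B) {s : ℝ}
    (hs : 0 < s) (y : Space d) : ‖∫ z, (gk s (y - z) : ℂ) * (φ z : ℂ)‖ ≤ B := by
  have hi : Integrable (fun z => gk s (y - z)) := (integrable_gk hs).comp_sub_left y
  have : ∫ z, gk s (y - z) * B = B := by
    rw [integral_mul_const, integral_sub_left_eq_self (fun z => gk s z), integral_gk hs, one_mul]
  rw [← this]
  refine norm_integral_le_of_norm_le (hi.mul_const B) (ae_of_all _ fun z => ?_)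
  rw [norm_mul, Complex.norm_real, Complex.norm_real, Real.norm_eq_abs, Real.norm_eq_abs,
    abs_of_nonneg (gk_nonneg hs _)]
  exact mul_le_mul_of_nonneg_left (hφB z) (gk_nonneg hs _)

/-- Dominated convergence for `smear`. -/
theorem tendsto_smear {f : Fin n → Sph d → ℂ} (hf : ∀ j, Integrable (f j) (surf d))
    {φ : ℕ → Space d → ℂ} {ψ : Space d → ℂ} (hφm : ∀ k, Measurable (φ k)) {B : ℝ}
    (hB : ∀ k y, ‖φ k y‖ ≤ B) (h : ∀ y, Tendsto (fun k => φ k y) atTop (𝓝 (ψ y))) (x : Space d) :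
    Tendsto (fun k => smear (φ k) f x) atTop (𝓝 (smear ψ f x)) := by
  refine tendsto_integral_of_dominated_convergence (fun ν => B * ‖∏ j, f j (ν j)‖)
    (fun k => (integrable_smear_integrand hf (hφm k) (hB k) x).1)
    ((integrable_prod_apply hf).norm.const_mul B) (fun k => ae_of_all _ fun ν => ?_)
    (ae_of_all _ fun ν => (h _).mul_const _)
  rw [norm_mul]
  exact mul_le_mul_of_nonneg_right (hB _ _) (norm_nonneg _)

theorem aestronglyMeasurable_smear {f : Fin n → Sph d → ℂ}
    (hf : ∀ j, Integrable (f j) (surf d)) {φ : Space d → ℂ} (hφ : Measurable φ) :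
    AEStronglyMeasurable (fun ω : Sph d => smear φ f ω) (surf d) := by
  have h1 : Measurable fun p : Sph d × (Fin n → Sph d) =>
      φ (∑ j, (p.2 j : Space d) - (p.1 : Space d)) := by
    refine hφ.comp (Continuous.measurable ?_)
    fun_prop
  have h2 : AEStronglyMeasurable (fun p : Sph d × (Fin n → Sph d) => ∏ j, f j (p.2 j))
      ((surf d).prod (surfPi d n)) := (integrable_prod_apply hf).1.comp_snd
  exact (h1.aestronglyMeasurable.mul h2).integral_prod_right'

theorem measurable_integral_gk_mul {φ : Space d → ℝ} (hφc : Continuous φ) {s : ℝ} :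
    Measurable fun y : Space d => ∫ z, (gk s (y - z) : ℂ) * (φ z : ℂ) := by
  have hgc := continuous_gk (d := d) s
  have : Continuous fun p : Space d × Space d => (gk s (p.1 - p.2) : ℂ) * (φ p.2 : ℂ) := by
    fun_prop
  exact (this.stronglyMeasurable.integral_prod_right').measurable

/-- The convolution measure tested against balls. -/
theorem convMeasure_apply {f : Fin n → Sph d → ℂ} (hf : ∀ j, Integrable (f j) (surf d))
    (r : ℝ) (x : Space d) : convMeasure f (Metric.closedBall x r) =
      smear ((Metric.closedBall (0 : Space d) r).indicator fun _ => 1) f x := by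
  have hm : Measurable fun ν : Fin n → Sph d => ∑ j, (ν j : Space d) :=
    continuous_sum_coe.measurable
  have hS : MeasurableSet ((fun ν : Fin n → Sph d => ∑ j, (ν j : Space d)) ⁻¹'
    Metric.closedBall x r) := hm measurableSet_closedBall
  rw [convMeasure, VectorMeasure.map_apply _ hm measurableSet_closedBall,
    withDensityᵥ_apply (integrable_prod_apply hf) hS, ← integral_indicator hS]
  refine integral_congr_ae (ae_of_all _ fun ν => ?_)
  simp only [Set.indicator, Set.mem_preimage, Metric.mem_closedBall, dist_eq_norm, sub_zero]
  split_ifs <;> simp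

/-- Compare through the coarser level `k`: on the sphere and on its translate, level `l` is within a
geometric tail of level `k`, and level `k` is Lipschitz. The bound does not depend on `l`, so `l →
∞` is possible at a fixed radius. -/
theorem eLpNorm_translate_sub_le {T : ℕ → Space d → ℂ} (hT : ∀ k, Continuous (T k))
    {D A r Λ : ℝ} (hD : 0 ≤ D) (hA : 0 ≤ A) (hr0 : 0 ≤ r) (hr1 : r < 1) (hΛ : 0 ≤ Λ)
    (h : ∀ k z, eLpNorm (fun ω : Sph d => T k (ω + z) - T (k + 1) (ω + z)) 2 (surf d) ≤
      ENNReal.ofReal (D * r ^ k))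
    (hlip : ∀ k x y, ‖T k x - T k y‖ ≤ A * Λ ^ k * ‖x - y‖) {k l : ℕ} (hkl : k ≤ l) (z : Space d) :
    eLpNorm (fun ω : Sph d => T l (ω + z) - T l ω) 2 (surf d) ≤
      ENNReal.ofReal (2 * (D * r ^ k / (1 - r)) +
        ((surf d).real Set.univ) ^ (1 / 2 : ℝ) * (A * Λ ^ k * ‖z‖)) := by
  have h1r : 0 < 1 - r := by linarith
  set S := ((surf d).real Set.univ) ^ (1 / 2 : ℝ)
  have hS : 0 ≤ S := by positivity
  have m := fun k z => aestronglyMeasurable_comp_add (hT k) z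
  have m0 : ∀ k, AEStronglyMeasurable (fun ω : Sph d => T k ω) (surf d) := fun k =>
    ((hT k).comp continuous_subtype_val).aestronglyMeasurable
  have b1 := eLpNorm_sub_le_of_geometric hT hD hr0 hr1 h hkl z
  have b2 : eLpNorm (fun ω : Sph d => T k ω - T l ω) 2 (surf d) ≤
      ENNReal.ofReal (D * r ^ k / (1 - r)) := by
    simpa using eLpNorm_sub_le_of_geometric hT hD hr0 hr1 h hkl 0
  have b3 : eLpNorm (fun ω : Sph d => T k (ω + z) - T k ω) 2 (surf d) ≤
      ENNReal.ofReal (S * (A * Λ ^ k * ‖z‖)) := by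
    have hb : ∀ᵐ ω : Sph d ∂(surf d), ‖T k (ω + z) - T k ω‖ ≤ A * Λ ^ k * ‖z‖ :=
      ae_of_all _ fun ω => (hlip k _ _).trans_eq (by rw [add_sub_cancel_left])
    refine (eLpNorm_le_of_ae_bound hb).trans_eq ?_
    rw [ENNReal.ofReal_mul hS]
    congr 1
    simp only [S]
    rw [← ENNReal.ofReal_rpow_of_nonneg measureReal_nonneg (by norm_num), ofReal_measureReal]
    norm_num
  have e : (fun ω : Sph d => T l (ω + z) - T l ω) =
      ((fun ω : Sph d => T k ω - T l ω) - fun ω : Sph d => T k (ω + z) - T l (ω + z)) +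
      fun ω : Sph d => T k (ω + z) - T k ω := by
    ext ω; simp only [Pi.add_apply, Pi.sub_apply]; ring
  rw [e]
  refine (eLpNorm_add_le (((m0 _).sub (m0 _)).sub ((m _ _).sub (m _ _))) ((m _ _).sub (m0 _))
    one_le_two).trans ((add_le_add ((eLpNorm_sub_le ((m0 _).sub (m0 _)) ((m _ _).sub (m _ _))
      one_le_two).trans (add_le_add b2 b1)) b3).trans_eq ?_)
  rw [← ENNReal.ofReal_add (by positivity) (by positivity),
    ← ENNReal.ofReal_add (by positivity) (by positivity)]
  congr 1; ring

theorem continuous_heatConv {f : Fin n → Sph d → ℂ} (hf : ∀ j, Integrable (f j) (surf d)) {s : ℝ}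
    (hs : 0 < s) : Continuous (heatConv f s) := by
  have hgc := continuous_gk (d := d) s
  refine continuous_of_dominated
    (bound := fun ν => (Real.pi / s) ^ ((d : ℝ) / 2) * ‖∏ j, f j (ν j)‖)
    (fun x => ?_) (fun x => ae_of_all _ fun ν => ?_)
    ((integrable_prod_apply hf).norm.const_mul _) (ae_of_all _ fun ν => by fun_prop)
  · refine AEStronglyMeasurable.mul ?_ (integrable_prod_apply hf).1
    exact Continuous.aestronglyMeasurable (by fun_prop)
  · rw [norm_mul, Complex.norm_real, Real.norm_eq_abs, abs_of_nonneg (gk_nonneg hs _)]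
    exact mul_le_mul_of_nonneg_right (gk_le hs _) (norm_nonneg _)

/-- Minkowski over translates compares the average of `heatConv f (s k)` against `φ` with `(∫ φ) ·
heatConv f (s k)`. As `k → ∞` the first tends pointwise to the smearing by `φ`, the second to `(∫ φ)
u` in `L²`, and Fatou passes the bound to the limit. -/
theorem eLpNorm_smear_sub_le {f : Fin n → Sph d → ℂ}
    (hf : ∀ j, Integrable (f j) (surf d)) {s : ℕ → ℝ} (hs0 : ∀ k, 0 < s k)
    (hs : Tendsto s atTop (𝓝 0)) {u : Sph d → ℂ} (hu : MemLp u 2 (surf d))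
    (hlim : Tendsto (fun k => eLpNorm (fun ω : Sph d => heatConv f (s k) ω - u ω) 2 (surf d))
      atTop (𝓝 0)) {δ ε : ℝ} (hε : 0 ≤ ε) {k₀ : ℕ}
    (htr : ∀ k, k₀ ≤ k → ∀ z : Space d, ‖z‖ ≤ δ →
      eLpNorm (fun ω : Sph d => heatConv f (s k) (ω + z) - heatConv f (s k) ω) 2 (surf d) ≤
        ENNReal.ofReal ε)
    {φ : Space d → ℝ} (hφ0 : ∀ z, 0 ≤ φ z) (hφ1 : ∀ z, φ z ≤ 1)
    (hφc : Continuous φ) (hφ : Integrable φ) (hsupp : ∀ z, φ z ≠ 0 → ‖z‖ ≤ δ) :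
    eLpNorm (fun ω : Sph d => smear (fun y => (φ y : ℂ)) f ω - ((∫ z, φ z : ℝ) : ℂ) * u ω) 2
      (surf d) ≤ ENNReal.ofReal ((∫ z, φ z) * ε) := by
  set V := ∫ z, φ z
  have hV : 0 ≤ V := integral_nonneg hφ0
  have hTc := fun k => continuous_heatConv hf (hs0 k)
  have hφabs : ∀ z, |φ z| ≤ 1 := fun z => by rw [abs_of_nonneg (hφ0 z)]; exact hφ1 z
  set X : ℕ → Sph d → ℂ := fun k ω => ∫ z, (φ z : ℂ) * heatConv f (s k) (ω + z)
  have hXs : ∀ k (ω : Sph d), X k ω =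
      smear (fun y => ∫ z, (gk (s k) (y - z) : ℂ) * (φ z : ℂ)) f ω :=
    fun k ω => integral_mul_heatConv hf hφ (hs0 k) ω
  have hXm : ∀ k, AEStronglyMeasurable (X k) (surf d) := fun k => by
    simp_rw [funext (hXs k)]
    exact aestronglyMeasurable_smear hf (measurable_integral_gk_mul hφc)
  have hXlim : ∀ ω, Tendsto (fun k => X k ω) atTop (𝓝 (smear (fun y => (φ y : ℂ)) f ω)) :=
    fun ω => by
      simp_rw [hXs]
      exact tendsto_smear hf (fun k => measurable_integral_gk_mul hφc)
        (fun k y => norm_integral_gk_mul_le hφabs (hs0 k) y)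
        (fun y => tendsto_integral_gk_mul hφc hφ hs0 hs y) ω
  have hum : AEStronglyMeasurable u (surf d) := hu.1
  have hTm : ∀ k, AEStronglyMeasurable (fun ω : Sph d => heatConv f (s k) ω) (surf d) := fun k =>
    ((hTc k).comp continuous_subtype_val).aestronglyMeasurable
  have hc : Tendsto (fun k => ENNReal.ofReal (V * ε) + ENNReal.ofReal V *
      eLpNorm (fun ω : Sph d => heatConv f (s k) ω - u ω) 2 (surf d)) atTop
      (𝓝 (ENNReal.ofReal (V * ε))) := by
    have := (ENNReal.Tendsto.const_mul hlim (Or.inr (ENNReal.ofReal_ne_top (r := V)))).const_add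
      (ENNReal.ofReal (V * ε))
    simpa using this
  refine eLpNorm_le_of_tendsto_of_le (F := fun k ω => X k ω - (V : ℂ) * u ω)
    (fun k => (hXm k).sub (hum.const_mul _)) (fun ω => (hXlim ω).sub_const _) ?_ hc
  filter_upwards [eventually_ge_atTop k₀] with k hk
  have e : (fun ω => X k ω - (V : ℂ) * u ω) =
      (fun ω : Sph d => X k ω - (V : ℂ) * heatConv f (s k) ω) +
      (V : ℂ) • fun ω : Sph d => heatConv f (s k) ω - u ω := by
    ext ω; simp; ring
  rw [e]
  refine (eLpNorm_add_le ((hXm k).sub ((hTm k).const_mul _))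
    (((hTm k).sub hum).const_smul _) one_le_two).trans (add_le_add ?_ ?_)
  · exact eLpNorm_integral_mul_sub_le (hTc k)
      (fun x => norm_smear_le hf (B := (Real.pi / s k) ^ ((d : ℝ) / 2)) (fun y => by
        rw [Complex.norm_real, Real.norm_eq_abs, abs_of_nonneg (gk_nonneg (hs0 k) _)]
        exact gk_le (hs0 k) _) x) hφ0 hφc hφ hε
      fun z hz => htr k hk z (hsupp z hz)
  · rw [eLpNorm_const_smul]
    refine le_of_eq ?_
    congr 1
    rw [← ofReal_norm, Complex.norm_real, Real.norm_eq_abs, abs_of_nonneg hV]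

/-- The ball indicator is not continuous, so it is approached from outside by thickened indicators.
The strict inequality `r < δ` leaves room for their supports. -/
theorem eLpNorm_ballAverage_sub_le {f : Fin n → Sph d → ℂ}
    (hf : ∀ j, Integrable (f j) (surf d)) {s : ℕ → ℝ} (hs0 : ∀ k, 0 < s k)
    (hs : Tendsto s atTop (𝓝 0)) {u : Sph d → ℂ} (hu : MemLp u 2 (surf d))
    (hlim : Tendsto (fun k => eLpNorm (fun ω : Sph d => heatConv f (s k) ω - u ω) 2 (surf d))
      atTop (𝓝 0)) {δ ε : ℝ} (hε : 0 ≤ ε) {k₀ : ℕ}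
    (htr : ∀ k, k₀ ≤ k → ∀ z : Space d, ‖z‖ ≤ δ →
      eLpNorm (fun ω : Sph d => heatConv f (s k) (ω + z) - heatConv f (s k) ω) 2 (surf d) ≤
        ENNReal.ofReal ε)
    {r : ℝ} (hr : 0 < r) (hrδ : r < δ) :
    eLpNorm (fun ω : Sph d => ballAverage (convMeasure f) r ω - u ω) 2 (surf d) ≤
      ENNReal.ofReal ε := by
  set K := Metric.closedBall (0 : Space d) r
  -- Thickening widths tending to `0`, all at most `δ - r`.
  set t : ℕ → ℝ := fun k => (δ - r) / (k + 1)
  have ht0 : ∀ k, 0 < t k := fun k => div_pos (by linarith) (by positivity)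
  have htδ : ∀ k, t k ≤ δ - r := fun k => div_le_self (by linarith) (by simp)
  have htlim : Tendsto t atTop (𝓝 0) := by
    have := (tendsto_one_div_add_atTop_nhds_zero_nat (𝕜 := ℝ)).const_mul (δ - r)
    simpa [t, div_eq_mul_inv] using this
  set φ : ℕ → Space d → ℝ := fun k z => (thickenedIndicator (ht0 k) K z : ℝ)
  have hφc : ∀ k, Continuous (φ k) := fun k =>
    NNReal.continuous_coe.comp (thickenedIndicator (ht0 k) K).continuous
  have hφ0 : ∀ k z, 0 ≤ φ k z := fun k z => NNReal.coe_nonneg _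
  have hφ1 : ∀ k z, φ k z ≤ 1 := fun k z => by
    exact_mod_cast thickenedIndicator_le_one (ht0 k) K z
  have hsupp : ∀ k z, φ k z ≠ 0 → ‖z‖ ≤ δ := fun k z hz => by
    by_contra hcon
    refine hz ?_
    simp only [φ, NNReal.coe_eq_zero]
    refine thickenedIndicator_zero (ht0 k) K fun hmem => hcon ?_
    obtain ⟨y, hy, hzy⟩ := Metric.mem_thickening_iff.1 hmem
    have h1 : ‖y‖ ≤ r := by simpa [K] using hy
    rw [dist_eq_norm] at hzy
    have h2 := norm_le_norm_add_norm_sub' z y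
    have := htδ k
    linarith
  have hdom : ∀ k z, ‖φ k z‖ ≤ (Metric.closedBall (0 : Space d) δ).indicator (fun _ => (1 : ℝ)) z :=
    fun k z => by
      rw [Real.norm_eq_abs, abs_of_nonneg (hφ0 k z)]
      by_cases hz : φ k z = 0
      · rw [hz]; exact Set.indicator_nonneg (fun _ _ => zero_le_one) z
      · rw [Set.indicator_of_mem (by simpa using hsupp k z hz)]; exact hφ1 k z
  have hbi : Integrable ((Metric.closedBall (0 : Space d) δ).indicator fun _ => (1 : ℝ)) :=
    (integrable_indicator_iff measurableSet_closedBall).2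
      (integrableOn_const measure_closedBall_lt_top.ne)
  have hφi : ∀ k, Integrable (φ k) := fun k =>
    hbi.mono' (hφc k).aestronglyMeasurable (ae_of_all _ (hdom k))
  have hφlim : ∀ z, Tendsto (fun k => φ k z) atTop (𝓝 (K.indicator (fun _ => (1 : ℝ)) z)) :=
    fun z => by
      have h1 := thickenedIndicator_tendsto_indicator_closure ht0 htlim K
      rw [Metric.isClosed_closedBall.closure_eq] at h1
      have h2 := (NNReal.continuous_coe.tendsto _).comp (tendsto_pi_nhds.1 h1 z)
      have e : K.indicator (fun _ => (1 : ℝ)) z = ((K.indicator (fun _ => (1 : ℝ≥0)) z : ℝ≥0) : ℝ) := by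
        by_cases hz : z ∈ K <;> simp [hz]
      rw [e]
      exact h2
  set V := volume.real K
  have hV : 0 < V := by
    refine ENNReal.toReal_pos (Metric.measure_closedBall_pos _ _ hr).ne'
      measure_closedBall_lt_top.ne
  have hVlim : Tendsto (fun k => ∫ z, φ k z) atTop (𝓝 V) := by
    have := tendsto_integral_of_dominated_convergence _ (fun k => (hφc k).aestronglyMeasurable)
      hbi (fun k => ae_of_all _ (hdom k)) (ae_of_all _ hφlim)
    rwa [integral_indicator measurableSet_closedBall, setIntegral_const, smul_eq_mul, mul_one]
      at this
  have hSlim : ∀ ω : Sph d, Tendsto (fun k => smear (fun y => (φ k y : ℂ)) f ω) atTop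
      (𝓝 (smear (K.indicator fun _ => 1) f ω)) := fun ω => by
    refine tendsto_smear hf (B := 1)
      (fun k => (Complex.continuous_ofReal.comp (hφc k)).measurable) (fun k y => ?_) (fun y => ?_) ω
    · rw [Function.comp_apply, Complex.norm_real, Real.norm_eq_abs, abs_of_nonneg (hφ0 k y)]; exact hφ1 k y
    · have := (Complex.continuous_ofReal.tendsto _).comp (hφlim y)
      have e : K.indicator (fun _ => (1 : ℂ)) y = ((K.indicator (fun _ => (1 : ℝ)) y : ℝ) : ℂ) := by
        by_cases hz : y ∈ K <;> simp [hz]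
      rw [e]
      exact this
  have hfat : eLpNorm (fun ω : Sph d => smear (K.indicator fun _ => 1) f ω - (V : ℂ) * u ω) 2
      (surf d) ≤ ENNReal.ofReal (V * ε) := by
    refine eLpNorm_le_of_tendsto_of_le
      (F := fun k (ω : Sph d) => smear (fun y => (φ k y : ℂ)) f ω -
        ((∫ z, φ k z : ℝ) : ℂ) * u ω)
      (c := fun k => ENNReal.ofReal ((∫ z, φ k z) * ε)) (fun k => ?_) (fun ω => ?_) ?_ ?_
    · exact (aestronglyMeasurable_smear hf
        (Complex.continuous_ofReal.comp (hφc k)).measurable).sub (hu.1.const_mul _)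
    · exact (hSlim ω).sub (((Complex.continuous_ofReal.tendsto _).comp hVlim).mul_const _)
    · exact Eventually.of_forall fun k => eLpNorm_smear_sub_le hf hs0 hs hu hlim hε htr
        (hφ0 k) (hφ1 k) (hφc k) (hφi k) (hsupp k)
    · exact ENNReal.tendsto_ofReal (hVlim.mul_const ε)
  have hvol : ∀ x : Space d, volume.real (Metric.closedBall x r) = V := fun x => by
    simp only [V, K, Measure.real]; rw [Measure.addHaar_closedBall_center]
  have e : (fun ω : Sph d => ballAverage (convMeasure f) r ω - u ω) =
      ((V⁻¹ : ℝ) : ℂ) • fun ω : Sph d => smear (K.indicator fun _ => 1) f ω - (V : ℂ) * u ω := by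
    ext ω
    simp only [ballAverage, hvol, convMeasure_apply hf, Pi.smul_apply, smul_eq_mul]
    have : (V : ℂ) ≠ 0 := by exact_mod_cast hV.ne'
    push_cast
    field_simp
    rfl
  rw [e, eLpNorm_const_smul, ← ofReal_norm, Complex.norm_real, Real.norm_eq_abs,
    abs_of_pos (inv_pos.2 hV)]
  refine (mul_le_mul_right hfat _).trans_eq ?_
  rw [← ENNReal.ofReal_mul (inv_pos.2 hV).le, inv_mul_cancel_left₀ hV.ne']

/-! ### Quantitative bounds for the regularised convolution -/

theorem norm_fhat_le_rpow (d : ℕ) [NeZero d] {β : ℝ} (hβ0 : 0 ≤ β) (hβ1 : β < 1)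
    (hβ : β ≤ ((d : ℝ) - 1) / 2) :
    ∃ C : ℝ, 0 ≤ C ∧ ∀ (L : ℝ) (h : Sph d → ℂ), 0 ≤ L → LipBound L h → ∀ ξ : Space d, ξ ≠ 0 →
      ‖fhat h ξ‖ ≤ C * L * ‖ξ‖ ^ (-β) := by
  obtain ⟨C, hC, hdec⟩ := norm_integral_mul_osc_le d hβ0 hβ1 hβ
  refine ⟨C, hC, fun L h hL hh ξ hξ => ?_⟩
  have hξ' : 0 < ‖ξ‖ := norm_pos_iff.2 hξ
  have e : ∀ x, ch ξ x = osc (‖ξ‖⁻¹ • ξ) (2 * Real.pi * ‖ξ‖) x := fun x => by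
    unfold ch osc
    rw [real_inner_smul_left, mul_assoc (2 * Real.pi), mul_inv_cancel_left₀ hξ'.ne']
  have h1 := hdec (‖ξ‖⁻¹ • ξ) (by rw [norm_smul, norm_inv, norm_norm, inv_mul_cancel₀ hξ'.ne'])
    (2 * Real.pi * ‖ξ‖) (by positivity) L h hL hh
  unfold fhat
  simp_rw [e]
  refine h1.trans (mul_le_mul_of_nonneg_left ?_ (by positivity))
  rw [Real.mul_rpow (by positivity) hξ'.le]
  refine mul_le_of_le_one_left (by positivity) ?_
  exact Real.rpow_le_one_of_one_le_of_nonpos (by have := Real.pi_gt_three; linarith) (by linarith)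

theorem norm_prod_fhat_le {m : ℕ} {C β : ℝ} {L : Fin m → ℝ} {h : Fin m → Sph d → ℂ} {ξ : Space d}
    (hξ : ξ ≠ 0) (hmβ : m * β = 3 / 2)
    (hdec : ∀ j, ‖fhat (h j) ξ‖ ≤ C * L j * ‖ξ‖ ^ (-β)) :
    ‖∏ j, fhat (h j) ξ‖ ≤ C ^ m * (∏ j, L j) * ‖ξ‖ ^ (-(3 / 2) : ℝ) := by
  have hξ' : 0 < ‖ξ‖ := norm_pos_iff.2 hξ
  rw [norm_prod]
  refine (Finset.prod_le_prod (fun _ _ => norm_nonneg _) fun j _ => hdec j).trans_eq ?_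
  rw [Finset.prod_mul_distrib, Finset.prod_mul_distrib]
  simp only [Finset.prod_const, Finset.card_univ, Fintype.card_fin]
  rw [← Real.rpow_natCast (‖ξ‖ ^ (-β)), ← Real.rpow_mul hξ'.le]
  congr 2
  linarith

theorem integral_norm_le_of_memLp {g : Sph d → ℂ} (hg : MemLp g 2 (surf d)) :
    ∫ ν, ‖g ν‖ ∂(surf d) ≤ ((surf d).real Set.univ) ^ (1 / 2 : ℝ) *
      (eLpNorm g 2 (surf d)).toReal := by
  have h1 := eLpNorm_le_eLpNorm_mul_rpow_measure_univ (μ := surf d) (p := 1) (q := 2)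
    one_le_two hg.1
  rw [integral_norm_eq_lintegral_enorm hg.1, ← eLpNorm_one_eq_lintegral_enorm]
  have h2 := ENNReal.toReal_mono (ENNReal.mul_ne_top hg.2.ne
    (ENNReal.rpow_ne_top_of_nonneg (by norm_num) (measure_ne_top _ _))) h1
  refine h2.trans_eq ?_
  rw [ENNReal.toReal_mul, mul_comm, ← ENNReal.toReal_rpow]
  norm_num [Measure.real]

theorem massProd_snoc_le {m : ℕ} {L : Fin m → ℝ} {h : Fin m → Sph d → ℂ}
    (hh : ∀ j, LipBound (L j) (h j)) {g : Sph d → ℂ} (hg : MemLp g 2 (surf d)) :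
    massProd (Fin.snoc (α := fun _ => Sph d → ℂ) h g) ≤
      ((surf d).real Set.univ) ^ m * ((surf d).real Set.univ) ^ (1 / 2 : ℝ) *
        (∏ j, L j) * (eLpNorm g 2 (surf d)).toReal := by
  have h1 : ∀ j, ∫ ν, ‖h j ν‖ ∂(surf d) ≤ (surf d).real Set.univ * L j := fun j => by
    have : ∫ ν, ‖h j ν‖ ∂(surf d) ≤ ∫ _, L j ∂(surf d) :=
      integral_mono (hh j).integrable.norm (integrable_const _) (hh j).norm_le
    simpa using this
  have h2 : ∏ j, ∫ ν, ‖h j ν‖ ∂(surf d) ≤ ((surf d).real Set.univ) ^ m * ∏ j, L j := by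
    refine (Finset.prod_le_prod (fun j _ => integral_nonneg fun _ => norm_nonneg _)
      fun j _ => h1 j).trans_eq ?_
    simp [Finset.prod_mul_distrib]
  have h0 : 0 ≤ ∏ j, ∫ ν, ‖h j ν‖ ∂(surf d) :=
    Finset.prod_nonneg fun j _ => integral_nonneg fun _ => norm_nonneg _
  unfold massProd
  rw [Fin.prod_univ_castSucc]
  simp only [Fin.snoc_castSucc, Fin.snoc_last]
  refine (mul_le_mul h2 (integral_norm_le_of_memLp hg) (integral_nonneg fun _ => norm_nonneg _)
    (h0.trans h2)).trans_eq ?_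
  ring

/-- The growth `2^{k(d+1)/2}` is the kernel height `s^{-d/2}` times the inverse width `s^{-1/2}` at
`s = 2^{-k}`. -/
theorem norm_heatConv_dyadic_sub_le {f : Fin n → Sph d → ℂ} (hf : ∀ j, Integrable (f j) (surf d))
    (k : ℕ) (x y : Space d) :
    ‖heatConv f ((1 / 2) ^ k) x - heatConv f ((1 / 2) ^ k) y‖ ≤
      Real.pi ^ ((d : ℝ) / 2) * Real.pi * massProd f * (2 ^ (((d : ℝ) + 1) / 2)) ^ k * ‖x - y‖ := by
  have hs : (0 : ℝ) < (1 / 2) ^ k := by positivity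
  have hB : ∀ y : Space d, ‖((gk ((1 / 2) ^ k) y : ℝ) : ℂ)‖ ≤
      (Real.pi / (1 / 2) ^ k) ^ ((d : ℝ) / 2) := fun y => by
    rw [Complex.norm_real, Real.norm_eq_abs, abs_of_nonneg (gk_nonneg hs _)]
    exact gk_le hs _
  have hK : ∀ y y' : Space d, ‖((gk ((1 / 2) ^ k) y : ℝ) : ℂ) - ((gk ((1 / 2) ^ k) y' : ℝ) : ℂ)‖ ≤
      ((Real.pi / (1 / 2) ^ k) ^ ((d : ℝ) / 2) * (Real.pi / √((1 / 2) ^ k))) * ‖y - y'‖ :=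
    fun y y' => by
      rw [← Complex.ofReal_sub, Complex.norm_real]
      exact abs_gk_sub_le hs y y'
  refine (norm_smear_sub_le hf (Complex.continuous_ofReal.comp (continuous_gk _)).measurable
    hB hK x y).trans_eq ?_
  have e1 : Real.pi / (1 / 2) ^ k = Real.pi * 2 ^ k := by
    rw [one_div, inv_pow, div_inv_eq_mul]
  have e2 : Real.pi / √((1 / 2) ^ k) = Real.pi * (2 ^ k) ^ (1 / 2 : ℝ) := by
    rw [Real.sqrt_eq_rpow, one_div (2 : ℝ), inv_pow, Real.inv_rpow (by positivity), div_inv_eq_mul]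
  have e3 : ((2 : ℝ) ^ (((d : ℝ) + 1) / 2)) ^ k =
      (2 ^ k) ^ ((d : ℝ) / 2) * (2 ^ k) ^ (1 / 2 : ℝ) := by
    rw [← Real.rpow_add (by positivity), ← Real.rpow_natCast, ← Real.rpow_natCast,
      ← Real.rpow_mul (by norm_num), ← Real.rpow_mul (by norm_num)]
    congr 1; ring
  rw [e1, e2, e3, Real.mul_rpow (by positivity) (by positivity)]
  ring

theorem norm_heatConv_one_le {f : Fin n → Sph d → ℂ} (hf : ∀ j, Integrable (f j) (surf d))
    (x : Space d) : ‖heatConv f 1 x‖ ≤ Real.pi ^ ((d : ℝ) / 2) * massProd f := by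
  refine norm_smear_le hf (fun y => ?_) x
  rw [Complex.norm_real, Real.norm_eq_abs, abs_of_nonneg (gk_nonneg one_pos _)]
  simpa using gk_le one_pos y

theorem eLpNorm_heatConv_dyadic_sub_le (d : ℕ) [NeZero d] :
    ∃ C : ℝ, 0 < C ∧ ∀ (m : ℕ) (h : Fin m → Sph d → ℂ) (g : Sph d → ℂ) (H : ℝ),
      (∀ j, Integrable (h j) (surf d)) → MemLp g 2 (surf d) → 0 ≤ H →
      (∀ ξ : Space d, ξ ≠ 0 → ‖∏ j, fhat (h j) ξ‖ ≤ H * ‖ξ‖ ^ (-(3 / 2) : ℝ)) →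
      ∀ (k : ℕ) (z : Space d),
      eLpNorm (fun ω : Sph d =>
          heatConv (Fin.snoc (α := fun _ => Sph d → ℂ) h g) ((1 / 2) ^ k) (ω + z) -
          heatConv (Fin.snoc (α := fun _ => Sph d → ℂ) h g) ((1 / 2) ^ (k + 1)) (ω + z)) 2 (surf d) ≤
        ENNReal.ofReal (C * H * (eLpNorm g 2 (surf d)).toReal *
          ((1 / 2 : ℝ) ^ (1 / 4 : ℝ)) ^ k) := by
  obtain ⟨C, hC, hb⟩ := integral_norm_heatConv_sub_sq_le d
  refine ⟨C, hC, fun m h g H hh hg hH hdec k z => ?_⟩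
  set f : Fin (m + 1) → Sph d → ℂ := Fin.snoc (α := fun _ => Sph d → ℂ) h g
  have hf : ∀ j, Integrable (f j) (surf d) := fun j => by
    refine Fin.lastCases ?_ (fun j => ?_) j
    · simpa [f] using hg.integrable one_le_two
    · simpa [f] using hh j
  set G := (eLpNorm g 2 (surf d)).toReal
  have hG : 0 ≤ G := ENNReal.toReal_nonneg
  have hgG : ∫ ν, ‖g ν‖ ^ 2 ∂(surf d) ≤ G ^ 2 :=
    (eLpNorm_two_le_ofReal_iff hg hG).1 (ENNReal.ofReal_toReal hg.2.ne).ge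
  have hs : (0 : ℝ) < (1 / 2) ^ k := by positivity
  have hs' : (0 : ℝ) < (1 / 2) ^ (k + 1) := by positivity
  have hc : Continuous fun ω : Sph d =>
      heatConv f ((1 / 2) ^ k) (ω + z) - heatConv f ((1 / 2) ^ (k + 1)) (ω + z) := by
    have h1 := continuous_heatConv hf hs
    have h2 := continuous_heatConv hf hs'
    fun_prop
  rw [eLpNorm_two_le_ofReal_iff (memLp_two_of_continuous hc) (by positivity)]
  have e2 : ((1 / 2 : ℝ) ^ k) ^ (1 / 4 : ℝ) = ((1 / 2 : ℝ) ^ (1 / 4 : ℝ)) ^ k := by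
    rw [← Real.rpow_natCast, ← Real.rpow_natCast, ← Real.rpow_mul (by norm_num),
      ← Real.rpow_mul (by norm_num), mul_comm]
  set q := ((1 / 2 : ℝ) ^ (1 / 4 : ℝ)) ^ k
  -- The earlier bound needs a positive constant, while `H = 0` is possible (some `h_j` may vanish);
  -- it is applied to `H' > H`, and then `H'` decreases to `H`.
  have hpos : ∀ H' ∈ Set.Ioi H, ∫ ω : Sph d, ‖heatConv f ((1 / 2) ^ k) (ω + z) -
      heatConv f ((1 / 2) ^ (k + 1)) (ω + z)‖ ^ 2 ∂(surf d) ≤ (C * H' * q) ^ 2 * G ^ 2 :=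
    fun H' hH' => by
      have hH'0 : 0 < H' := hH.trans_lt hH'
      have := hb m h g H' hh hg hH'0 (fun ξ hξ => (hdec ξ hξ).trans
        (mul_le_mul_of_nonneg_right (le_of_lt hH') (by positivity))) ((1 / 2) ^ k) hs z
      rw [e2, show ((1 / 2 : ℝ) ^ k) / 2 = (1 / 2) ^ (k + 1) by rw [pow_succ]; ring] at this
      exact this.trans (mul_le_mul_of_nonneg_left hgG (sq_nonneg _))
  have hcont : Tendsto (fun H' => (C * H' * q) ^ 2 * G ^ 2) (𝓝[>] H)
      (𝓝 ((C * H * q) ^ 2 * G ^ 2)) :=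
    ((by fun_prop : Continuous fun H' => (C * H' * q) ^ 2 * G ^ 2).tendsto H).mono_left
      nhdsWithin_le_nhds
  refine (ge_of_tendsto hcont (eventually_mem_nhdsWithin.mono hpos)).trans_eq ?_
  ring

/-! ### Uniqueness of the restriction and the Hölder norm -/

/-- Both functions are `L²` limits of the same ball averages. Since `M` selects an unspecified
restriction, this is what transfers estimates to it. -/
theorem IsRestriction.ae_eq {μ : ComplexMeasure (Space d)} {u v : Sph d → ℂ}
    (hμ : ∀ r, AEStronglyMeasurable (fun ω : Sph d => ballAverage μ r ω) (surf d))
    (hu : IsRestriction μ u) (hv : IsRestriction μ v) : u =ᵐ[surf d] v := by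
  have h0 : eLpNorm (fun ω => v ω - u ω) 2 (surf d) ≤ 0 := by
    have hlim := hu.2.add hv.2
    rw [add_zero] at hlim
    refine ge_of_tendsto hlim (Eventually.of_forall fun r => ?_)
    have e : (fun ω => v ω - u ω) = (fun ω : Sph d => ballAverage μ r ω - u ω) -
        fun ω : Sph d => ballAverage μ r ω - v ω := by
      ext ω; simp
    rw [e]
    exact eLpNorm_sub_le ((hμ r).sub hu.1.1) ((hμ r).sub hv.1.1) one_le_two
  have h1 := (eLpNorm_eq_zero_iff (hv.1.1.sub hu.1.1) two_ne_zero).1 (le_antisymm h0 zero_le)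
  filter_upwards [h1] with ω hω
  have h2 : v ω - u ω = 0 := hω
  exact (sub_eq_zero.1 h2).symm

/-- Rotations preserve null sets, so every difference in the seminorm is also insensitive to the
representative. -/
theorem eHNorm_congr_ae {s : ℝ} {u v : Sph d → ℂ} (h : u =ᵐ[surf d] v) :
    eHNorm s u = eHNorm s v := by
  unfold eHNorm
  rw [eLpNorm_congr_ae h]
  congr 1
  refine Finset.sum_congr rfl fun p _ => iSup_congr fun t => iSup_congr fun _ => ?_
  congr 1
  refine eLpNorm_congr_ae ?_
  have h1 := (measurePreserving_sphMap
    (rotIsometry p.1.1 p.1.2 p.2.ne t)).quasiMeasurePreserving.ae_eq_comp h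
  exact h1.sub h

theorem eHNorm_le {α : ℝ} {u : Sph d → ℂ} {a b : ℝ} (ha : 0 ≤ a) (hb : 0 ≤ b)
    (hu : eLpNorm u 2 (surf d) ≤ ENNReal.ofReal a)
    (h : ∀ (i j : Fin d) (hij : i < j) (t : ℝ), 0 < |t| → |t| ≤ 1 →
      eLpNorm (fun ω => u (rot i j hij t ω) - u ω) 2 (surf d) ≤ ENNReal.ofReal (b * |t| ^ α)) :
    eHNorm α u ≤ ENNReal.ofReal
      (a + (Fintype.card {p : Fin d × Fin d // p.1 < p.2} : ℝ) * b) := by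
  unfold eHNorm
  rw [ENNReal.ofReal_add ha (by positivity)]
  refine add_le_add hu ?_
  refine (Finset.sum_le_card_nsmul _ _ (ENNReal.ofReal b) fun p _ => ?_).trans_eq ?_
  · refine iSup_le fun t => iSup_le fun ht => ?_
    refine (mul_le_mul_right (h p.1.1 p.1.2 p.2 t ht.1 ht.2) _).trans_eq ?_
    rw [← ENNReal.ofReal_mul (by positivity)]
    congr 1
    rw [mul_left_comm, ← Real.rpow_add ht.1]; simp
  · rw [nsmul_eq_mul, ENNReal.ofReal_mul (by positivity)]
    simp

theorem isRestriction_of_geometric {f : Fin n → Sph d → ℂ} (hf : ∀ j, Integrable (f j) (surf d))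
    {D A r Λ : ℝ} (hD : 0 ≤ D) (hA : 0 ≤ A) (hr0 : 0 < r) (hr1 : r < 1) (hΛ : 0 ≤ Λ)
    (h : ∀ (k : ℕ) z, eLpNorm (fun ω : Sph d => heatConv f ((1 / 2) ^ k) (ω + z) -
      heatConv f ((1 / 2) ^ (k + 1)) (ω + z)) 2 (surf d) ≤ ENNReal.ofReal (D * r ^ k))
    (hlip : ∀ (k : ℕ) x y, ‖heatConv f ((1 / 2) ^ k) x - heatConv f ((1 / 2) ^ k) y‖ ≤
      A * Λ ^ k * ‖x - y‖) {u : Sph d → ℂ} (hu : MemLp u 2 (surf d))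
    (hlim : ∀ k : ℕ, eLpNorm (fun ω : Sph d => heatConv f ((1 / 2) ^ k) ω - u ω) 2 (surf d) ≤
      ENNReal.ofReal (D * r ^ k / (1 - r))) :
    IsRestriction (convMeasure f) u := by
  refine ⟨hu, ?_⟩
  have hs0 : ∀ k : ℕ, (0 : ℝ) < (1 / 2) ^ k := fun k => by positivity
  have hs : Tendsto (fun k : ℕ => (1 / 2 : ℝ) ^ k) atTop (𝓝 0) :=
    tendsto_pow_atTop_nhds_zero_of_lt_one (by norm_num) (by norm_num)
  have hgeo : Tendsto (fun k : ℕ => D * r ^ k / (1 - r)) atTop (𝓝 0) := by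
    have := ((tendsto_pow_atTop_nhds_zero_of_lt_one hr0.le hr1).const_mul D).div_const (1 - r)
    simpa using this
  have hlim0 : Tendsto (fun k : ℕ => eLpNorm (fun ω : Sph d =>
      heatConv f ((1 / 2) ^ k) ω - u ω) 2 (surf d)) atTop (𝓝 0) := by
    have := ENNReal.tendsto_ofReal hgeo
    rw [ENNReal.ofReal_zero] at this
    exact tendsto_of_tendsto_of_tendsto_of_le_of_le tendsto_const_nhds this
      (fun _ => zero_le) hlim
  refine ENNReal.tendsto_nhds_zero.2 fun ε hε => ?_
  obtain ⟨ε', hε'0, hε'⟩ : ∃ ε' : ℝ, 0 < ε' ∧ ENNReal.ofReal ε' ≤ ε := by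
    obtain ⟨q, hq0, hq⟩ := ENNReal.lt_iff_exists_nnreal_btwn.1 hε
    exact ⟨q, by exact_mod_cast hq0, by rw [ENNReal.ofReal_coe_nnreal]; exact hq.le⟩
  -- Order of choices: `k₀` makes the two geometric tails at most half of `ε'`; then `δ` is taken
  -- small against the Lipschitz constant at level `k₀`.
  obtain ⟨k₀, hk₀⟩ := (hgeo.eventually (gt_mem_nhds (by positivity : 0 < ε' / 4))).exists
  set S := ((surf d).real Set.univ) ^ (1 / 2 : ℝ)
  have hS : 0 ≤ S := by positivity
  set Q := S * (A * Λ ^ k₀)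
  have hQ : 0 ≤ Q := by positivity
  set δ := ε' / (2 * (Q + 1))
  have hδ : 0 < δ := by positivity
  have hQδ : Q * δ ≤ ε' / 2 := by
    have : Q * δ = ε' / 2 * (Q / (Q + 1)) := by simp only [δ]; field_simp
    rw [this]
    exact mul_le_of_le_one_right (by positivity) (div_le_one_of_le₀ (by linarith) (by linarith))
  filter_upwards [Ioo_mem_nhdsGT hδ] with ρ hρ
  refine le_trans ?_ hε'
  refine eLpNorm_ballAverage_sub_le hf hs0 hs hu hlim0 hε'0.le (k₀ := k₀) (fun k hk z hz => ?_)
    hρ.1 hρ.2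
  refine (eLpNorm_translate_sub_le (fun k => continuous_heatConv hf (hs0 k)) hD hA hr0.le hr1 hΛ
    h hlip hk z).trans (ENNReal.ofReal_le_ofReal ?_)
  have h1 : S * (A * Λ ^ k₀ * ‖z‖) ≤ Q * δ := by
    rw [← mul_assoc]; exact mul_le_mul_of_nonneg_left hz hQ
  linarith

theorem aestronglyMeasurable_ballAverage {f : Fin n → Sph d → ℂ}
    (hf : ∀ j, Integrable (f j) (surf d)) (r : ℝ) :
    AEStronglyMeasurable (fun ω : Sph d => ballAverage (convMeasure f) r ω) (surf d) := by
  unfold ballAverage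
  simp_rw [convMeasure_apply hf, Measure.real, Measure.addHaar_closedBall_center volume,
    div_eq_mul_inv]
  exact (aestronglyMeasurable_smear hf
    (measurable_const.indicator measurableSet_closedBall)).mul_const _

/-! ### Assembly -/

/-- The dyadic terms converge at rate `r = 2^{-1/4}` and have Lipschitz constants growing like
`Λ^k`, so the exponent is `α = log r / log (r/Λ)`. It lies in `(0, 1)` because `r/Λ < r < 1`, and it
depends on `d` alone. -/
theorem exists_isRestriction_eHNorm_le (d m : ℕ) [NeZero d] {β : ℝ} (hβ0 : 0 ≤ β) (hβ1 : β < 1)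
    (hβ : β ≤ ((d : ℝ) - 1) / 2) (hmβ : m * β = 3 / 2) :
    ∃ α : ℝ, 0 < α ∧ α < 1 ∧ ∃ K : ℝ, 0 ≤ K ∧
      ∀ (L : Fin m → ℝ) (h : Fin m → Sph d → ℂ) (g : Sph d → ℂ), (∀ j, 0 ≤ L j) →
        (∀ j, LipBound (L j) (h j)) → MemLp g 2 (surf d) →
        ∃ u, IsRestriction (convMeasure (Fin.snoc (α := fun _ => Sph d → ℂ) h g)) u ∧
          eHNorm α u ≤ ENNReal.ofReal (K * (∏ j, L j) * (eLpNorm g 2 (surf d)).toReal) := by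
  obtain ⟨C₁, hC₁, hdec⟩ := norm_fhat_le_rpow d hβ0 hβ1 hβ
  obtain ⟨C₂, hC₂, hdyad⟩ := eLpNorm_heatConv_dyadic_sub_le d
  set r : ℝ := (1 / 2 : ℝ) ^ (1 / 4 : ℝ)
  have hr0 : 0 < r := by positivity
  have hr1 : r < 1 := Real.rpow_lt_one (by norm_num) (by norm_num) (by norm_num)
  have h1r : 0 < 1 - r := by linarith
  set Λ : ℝ := 2 ^ (((d : ℝ) + 1) / 2)
  have hΛ : 1 < Λ := Real.one_lt_rpow (by norm_num) (by positivity)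
  have hΛ0 : 0 < Λ := by linarith
  have hθ0 : 0 < r / Λ := by positivity
  have hθ : r / Λ < r := div_lt_self hr0 hΛ
  have hθ1 : r / Λ < 1 := hθ.trans hr1
  set S₀ := (surf d).real Set.univ
  set S := S₀ ^ (1 / 2 : ℝ)
  have hS₀ : 0 ≤ S₀ := measureReal_nonneg
  have hS : 0 ≤ S := by positivity
  set a₁ : ℝ := C₂ * C₁ ^ m
  set a₂ : ℝ := Real.pi ^ ((d : ℝ) / 2) * (S₀ ^ m * S)
  have ha₁ : 0 ≤ a₁ := by positivity
  have ha₂ : 0 ≤ a₂ := by positivity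
  set N : ℝ := (Fintype.card {p : Fin d × Fin d // p.1 < p.2} : ℝ)
  refine ⟨Real.logb (r / Λ) r, Real.logb_pos_of_base_lt_one hθ0 hθ1 hr0 hr1, ?_,
    (a₁ / (1 - r) + S * a₂) + N * ((2 * (a₁ / (1 - r)) + a₂ * Real.pi * S) / r),
    by positivity, fun L h g hL hh hg => ?_⟩
  · rw [Real.logb_lt_iff_lt_rpow_of_base_lt_one hθ0 hθ1 hr0, Real.rpow_one]
    exact hθ
  set f : Fin (m + 1) → Sph d → ℂ := Fin.snoc (α := fun _ => Sph d → ℂ) h g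
  have hf : ∀ j, Integrable (f j) (surf d) := fun j => by
    refine Fin.lastCases ?_ (fun j => ?_) j
    · simpa [f] using hg.integrable one_le_two
    · simpa [f] using (hh j).integrable
  set P := ∏ j, L j
  have hP : 0 ≤ P := Finset.prod_nonneg fun j _ => hL j
  set G := (eLpNorm g 2 (surf d)).toReal
  have hG : 0 ≤ G := ENNReal.toReal_nonneg
  set D := a₁ * P * G
  have hD : 0 ≤ D := by positivity
  have hgeo := hdyad m h g (C₁ ^ m * P) (fun j => (hh j).integrable) hg (by positivity)
    fun ξ hξ => norm_prod_fhat_le hξ hmβ fun j => hdec (L j) (h j) (hL j) (hh j) ξ hξ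
  rw [show C₂ * (C₁ ^ m * P) * G = D by simp only [D, a₁]; ring] at hgeo
  have hs0 : ∀ k : ℕ, (0 : ℝ) < (1 / 2) ^ k := fun k => by positivity
  have hTc : ∀ k : ℕ, Continuous (heatConv f ((1 / 2) ^ k)) := fun k =>
    continuous_heatConv hf (hs0 k)
  set A := a₂ * Real.pi * P * G
  have hA : 0 ≤ A := by positivity
  have hmass : Real.pi ^ ((d : ℝ) / 2) * massProd f ≤ a₂ * P * G := by
    refine (mul_le_mul_of_nonneg_left (massProd_snoc_le hh hg) (by positivity)).trans_eq ?_
    simp only [a₂]; ring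
  have hlip : ∀ (k : ℕ) (x y : Space d),
      ‖heatConv f ((1 / 2) ^ k) x - heatConv f ((1 / 2) ^ k) y‖ ≤ A * Λ ^ k * ‖x - y‖ :=
    fun k x y => by
      refine (norm_heatConv_dyadic_sub_le hf k x y).trans ?_
      refine mul_le_mul_of_nonneg_right (mul_le_mul_of_nonneg_right ?_ (by positivity))
        (norm_nonneg _)
      have := mul_le_mul_of_nonneg_right hmass Real.pi_pos.le
      refine le_trans (le_of_eq ?_) (this.trans_eq ?_)
      · ring
      · simp only [A]; ring
  obtain ⟨u, hu, hlim⟩ := exists_limit_of_geometric hTc hD hr0 hr1 hgeo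
  refine ⟨u, isRestriction_of_geometric hf hD hA hr0 hr1 hΛ0.le hgeo hlip hu hlim, ?_⟩
  -- The size of `u` itself comes from level `0`: `heatConv f 1` is bounded by the product of the
  -- masses, and `u` differs from it by the whole geometric series.
  have hu0 : eLpNorm u 2 (surf d) ≤ ENNReal.ofReal ((a₁ / (1 - r) + S * a₂) * P * G) := by
    have hm0 : MemLp (fun ω : Sph d => heatConv f 1 ω) 2 (surf d) :=
      memLp_two_of_continuous ((continuous_heatConv hf one_pos).comp continuous_subtype_val)
    have b0 : eLpNorm (fun ω : Sph d => heatConv f 1 ω - u ω) 2 (surf d) ≤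
        ENNReal.ofReal (D / (1 - r)) := by simpa using hlim 0
    have b1 : eLpNorm (fun ω : Sph d => heatConv f 1 ω) 2 (surf d) ≤
        ENNReal.ofReal (S * (a₂ * P * G)) := by
      have hb : ∀ᵐ ω : Sph d ∂(surf d), ‖heatConv f 1 ω‖ ≤ a₂ * P * G :=
        ae_of_all _ fun ω => (norm_heatConv_one_le hf _).trans hmass
      refine (eLpNorm_le_of_ae_bound hb).trans_eq ?_
      rw [ENNReal.ofReal_mul hS]
      congr 1
      simp only [S, S₀]
      rw [← ENNReal.ofReal_rpow_of_nonneg measureReal_nonneg (by norm_num), ofReal_measureReal]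
      norm_num
    have e : u = (fun ω : Sph d => heatConv f 1 ω) - fun ω : Sph d => heatConv f 1 ω - u ω := by
      ext ω; simp
    rw [e]
    refine (eLpNorm_sub_le hm0.1 (hm0.sub hu).1 one_le_two).trans
      ((add_le_add b1 b0).trans_eq ?_)
    rw [← ENNReal.ofReal_add (by positivity) (by positivity)]
    congr 1
    simp only [D]; ring
  refine (eHNorm_le (a := (a₁ / (1 - r) + S * a₂) * P * G)
    (b := (2 * (D / (1 - r)) + A * S) / r) (by positivity) (by positivity) hu0
    fun i j hij t ht0 ht1 => ?_).trans_eq ?_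
  · exact eLpNorm_comp_sphMap_sub_le hTc (D := D / (1 - r)) (by positivity) hA hr0 hr1 hΛ hlip hu
      (fun k => (hlim k).trans_eq (by congr 1; ring)) (rotIsometry i j hij.ne t) ht0 ht1
      (norm_rot_sub_le hij.ne t)
  · congr 1
    simp only [D, A]; ring

theorem eLipNorm_lt_top {h : Sph d → ℂ} {K : ℝ≥0} (hK : LipschitzWith K h) : eLipNorm h < ⊤ := by
  unfold eLipNorm
  refine ENNReal.add_lt_top.2 ⟨?_, ?_⟩
  · obtain ⟨B, hB⟩ := (isCompact_range hK.continuous).isBounded.exists_norm_le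
    refine (iSup_le fun ω => ?_).trans_lt (ENNReal.ofReal_lt_top (r := B))
    rw [← ofReal_norm]
    exact ENNReal.ofReal_le_ofReal (hB _ ⟨ω, rfl⟩)
  · refine (iSup_le fun ω => iSup_le fun ω' => iSup_le fun hne => ?_).trans_lt
      (ENNReal.coe_lt_top (r := K))
    refine ENNReal.div_le_of_le_mul ?_
    rw [← edist_eq_enorm_sub]
    exact hK ω ω'

theorem lipBound_eLipNorm {h : Sph d → ℂ} (hfin : eLipNorm h < ⊤) :
    LipBound (eLipNorm h).toReal h := by
  constructor
  · intro ω
    rw [← toReal_enorm]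
    refine ENNReal.toReal_mono hfin.ne ?_
    exact (le_iSup (fun ω => ‖h ω‖ₑ) ω).trans le_self_add
  · intro ω ω'
    rcases eq_or_ne ω ω' with rfl | hne
    · simp
    · have h1 : ‖h ω - h ω'‖ₑ / edist ω ω' ≤ eLipNorm h :=
        by
        refine le_trans ?_ le_add_self
        exact le_iSup_of_le ω (le_iSup_of_le ω'
          (le_iSup (fun _ : ω ≠ ω' => ‖h ω - h ω'‖ₑ / edist ω ω') hne))
      rw [ENNReal.div_le_iff (edist_pos.2 hne).ne' (edist_ne_top _ _)] at h1
      have h2 := ENNReal.toReal_mono (ENNReal.mul_ne_top hfin.ne (edist_ne_top _ _)) h1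
      rw [ENNReal.toReal_mul, toReal_enorm] at h2
      refine h2.trans_eq ?_
      rw [← dist_edist, Subtype.dist_eq, dist_eq_norm]

theorem isRestriction_M {f : Fin n → Sph d → ℂ} {u : Sph d → ℂ}
    (h : IsRestriction (convMeasure f) u) : IsRestriction (convMeasure f) (M f) := by
  have hex : ∃ u, IsRestriction (convMeasure f) u := ⟨u, h⟩
  unfold M
  rw [dif_pos hex]
  exact hex.choose_spec

/-- Each factor is asked for less decay than the curvature of the sphere allows: `3/8 < 1/2`, `1/2 <
1`, and `3/4 < 1 ≤ (d-1)/2` in the three cases. This room keeps `β < 1` while the total is exactly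
`3/2`. -/
theorem boundaryParams_exponent {d m : ℕ} (hdm : (d, m) ∈ boundaryParams) :
    d ≠ 0 ∧ ∃ β : ℝ, 0 ≤ β ∧ β < 1 ∧ β ≤ ((d : ℝ) - 1) / 2 ∧ m * β = 3 / 2 := by
  simp only [boundaryParams, Set.mem_union, Set.mem_insert_iff, Set.mem_singleton_iff,
    Prod.mk.injEq, Set.mem_ofPred_eq] at hdm
  rcases hdm with (⟨rfl, rfl⟩ | ⟨rfl, rfl⟩) | ⟨hd, rfl⟩
  · exact ⟨by norm_num, 3 / 8, by norm_num, by norm_num, by norm_num, by norm_num⟩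
  · exact ⟨by norm_num, 1 / 2, by norm_num, by norm_num, by norm_num, by norm_num⟩
  · have : (3 : ℝ) ≤ d := by exact_mod_cast hd
    exact ⟨by omega, 3 / 4, by norm_num, by norm_num, by linarith, by norm_num⟩

end SphereConv

end

theorem mainTheorem5 (d m : ℕ) (hdm : (d, m) ∈ SphereConv.boundaryParams) :
    ∃ α : ℝ, 0 < α ∧ α < 1 ∧ ∃ C : ℝ≥0,
      ∀ (h : Fin m → SphereConv.Sph d → ℂ) (g : SphereConv.Sph d → ℂ),
        (∀ j, ∃ K : ℝ≥0, LipschitzWith K (h j)) →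
        MemLp g 2 (SphereConv.surf d) →
          SphereConv.IsRestriction
              (SphereConv.convMeasure (Fin.snoc (α := fun _ => SphereConv.Sph d → ℂ) h g))
              (SphereConv.M (Fin.snoc (α := fun _ => SphereConv.Sph d → ℂ) h g)) ∧
            SphereConv.MemH α
              (SphereConv.M (Fin.snoc (α := fun _ => SphereConv.Sph d → ℂ) h g)) ∧
            SphereConv.eHNorm α
                (SphereConv.M (Fin.snoc (α := fun _ => SphereConv.Sph d → ℂ) h g)) ≤
              C * (∏ j, SphereConv.eLipNorm (h j)) * eLpNorm g 2 (SphereConv.surf d) := by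
  obtain ⟨hd, β, hβ0, hβ1, hβ, hmβ⟩ := SphereConv.boundaryParams_exponent hdm
  have : NeZero d := ⟨hd⟩
  obtain ⟨α, hα0, hα1, K, hK, hmain⟩ :=
    SphereConv.exists_isRestriction_eHNorm_le d m hβ0 hβ1 hβ hmβ
  refine ⟨α, hα0, hα1, K.toNNReal, fun h g hh hg => ?_⟩
  have hfin : ∀ j, SphereConv.eLipNorm (h j) < ⊤ := fun j =>
    SphereConv.eLipNorm_lt_top (hh j).choose_spec
  obtain ⟨u, hu, hbound⟩ := hmain (fun j => (SphereConv.eLipNorm (h j)).toReal) h g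
    (fun j => ENNReal.toReal_nonneg) (fun j => SphereConv.lipBound_eLipNorm (hfin j)) hg
  have hf : ∀ j, Integrable (Fin.snoc (α := fun _ => SphereConv.Sph d → ℂ) h g j)
      (SphereConv.surf d) := fun j => by
    refine Fin.lastCases ?_ (fun j => ?_) j
    · simpa using hg.integrable one_le_two
    · simpa using (SphereConv.lipBound_eLipNorm (hfin j)).integrable
  have hM := SphereConv.isRestriction_M hu
  have hae := SphereConv.IsRestriction.ae_eq
    (SphereConv.aestronglyMeasurable_ballAverage hf) hM hu
  have hle : SphereConv.eHNorm α
      (SphereConv.M (Fin.snoc (α := fun _ => SphereConv.Sph d → ℂ) h g)) ≤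
      K.toNNReal * (∏ j, SphereConv.eLipNorm (h j)) * eLpNorm g 2 (SphereConv.surf d) := by
    rw [SphereConv.eHNorm_congr_ae hae]
    refine hbound.trans_eq ?_
    have hP : 0 ≤ ∏ j, (SphereConv.eLipNorm (h j)).toReal :=
      Finset.prod_nonneg fun j _ => ENNReal.toReal_nonneg
    rw [ENNReal.ofReal_mul (by positivity), ENNReal.ofReal_mul hK, ENNReal.ofReal_toReal hg.2.ne,
      ENNReal.ofReal_prod_of_nonneg fun j _ => ENNReal.toReal_nonneg]
    simp_rw [fun j => ENNReal.ofReal_toReal (hfin j).ne]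
    rfl
  refine ⟨hM, ⟨hM.1, hle.trans_lt ?_⟩, hle⟩
  exact ENNReal.mul_lt_top (ENNReal.mul_lt_top ENNReal.coe_lt_top
    (ENNReal.prod_lt_top fun j _ => hfin j)) hg.2
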